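/- Let $n\in\mathbb N$, $f:\mathbb R^n\to\mathbb R^n$, $B:\mathbb R^n\to\mathbb R^{n\times n}$, $s\in\mathbb R$, $u_-\in\mathbb R^n$, $T>0$, and let $\bar u:\mathbb R\to\mathbb R^n$ be a nonconstant $T$-periodic solution of the traveling-wave equation $$B(u)u'=f(u)-f(u_-)-s(u-u_-),$$ so that $\bar u(x-st)$ is a periodic traveling wave of $u_t+f(u)_x=(B(u)u_x)_x$. Assume: - (H0) $f$ and $B$ are of class $C^2$; - (H1) $\operatorname{Re}\sigma(B(\bar u(x)))>0$ for all $x$; - (H2) $df(u_-)-sI$ is invertible; - (H3) $\bar u$ is a transversal $T$-periodic orbit, even allowing variation of the speed: if $d(u_0,\sigma):=u(T)-u(0)$, where $u$ solves $B(u)u'=f(u)-f(u_-)-\sigma(u-u_-)$ on $[0,T]$ with $u(0)=u_0$, then the derivative of $d:\mathbb R^n\times\mathbb R\to\mathbb R^n$ at $(\bar u(0),s)$ has full rank $n$. Write $B(x):=B(\bar u(x))$, $A(x)v:=(df(\bar u(x))-sI)v-(dB(\bar u(x))v)\,\bar u'(x)$, and let $$Lv:=(Bv')'-(Av)'$$ be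 the linearized operator about the wave, in the rest frame of the wave. Let $\Psi(\cdot,\lambda)$, $\lambda\in\mathbb C$, be the solution of $\Psi'=\mathbb A(\lambda,x)\Psi$, $\Psi(0,\lambda)=I$, with $$\mathbb A=\begin{pmatrix}0&I\\ B^{-1}(\lambda I+A')&B^{-1}(A-B')\end{pmatrix},$$ and define the periodic Evans function $D(k,\lambda):=\det\big(\Psi(T,\lambda)-e^{ikT}I\big)$. Then $D(0,\cdot)$ is entire and real on the real axis, the limit $\operatorname{sgn}D(0,+\infty):=\lim_{\lambda\to+\infty}\operatorname{sgn}D(0,\lambda)$ along the real axis exists and is nonzero, and with the stability index $$\Gamma:=\operatorname{sgn}\Big(\big(\partial/\partial\lambda\big)^{n+1}D(0,0)\;D(0,+\infty)\Big)$$ the following hold. The operator $L$, acting on $T$-periodic functions (with domain the $\mathbb C^n$-valued $T$-periodic $C^2$ functions), has only finitely many unstable eigenvalues, i.e. eigenvalues $\lambda$ with $\operatorname{Re}\lambda>0$, each of finite algebraic multiplicity $\dim\bigcup_m\ker(L-\lambda)^m$, and their number, counted with algebraic multiplicity, is even if $\Gamma>0$ and odd if $\Gamma<0$. In particular, $\Gamma\ge0$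 is necessary for weak spectral stability: for every $p\in[1,\infty]$, if the spectrum $\sigma(L)$ of $L$ as an operator on $L^p(\mathbb R;\mathbb C^n)$ with domain $W^{2,p}(\mathbb R;\mathbb C^n)$ satisfies $\sigma(L)\subset\{\operatorname{Re}\lambda\le0\}$, then $\Gamma\ge0$. -/

import Mathlib

open Filter Topology MeasureTheory
open scoped Matrix ENNReal ContDiff

noncomputable section

/-! ## The traveling wave and the structural hypotheses

`f : ℝⁿ → ℝⁿ` and `B : ℝⁿ → ℝⁿˣⁿ` are the flux and the viscosity of `u_t + f(u)_x = (B(u) u_x)_x`.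
`Fin n → ℝ` and `Fin n → ℂ` are used for `ℝⁿ` and `ℂⁿ`; all norms on them are equivalent, and
nothing below depends on the choice. -/

/-- `u` solves the traveling-wave equation
`B(u) u' = f(u) - f(u₋) - s (u - u₋)` on the set `S` (one-sided derivatives at endpoints). -/
def IsTravelingWaveOn {n : ℕ} (f : (Fin n → ℝ) → (Fin n → ℝ))
    (B : (Fin n → ℝ) → Matrix (Fin n) (Fin n) ℝ) (um : Fin n → ℝ) (s : ℝ)
    (u : ℝ → (Fin n → ℝ)) (S : Set ℝ) : Prop :=
  ∀ x ∈ S, ∃ u' : Fin n → ℝ,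
    HasDerivWithinAt u u' S x ∧ B (u x) *ᵥ u' = f (u x) - f um - s • (u x - um)

/-- The Jacobian matrix `df(u)`. -/
def jacobian {n : ℕ} (f : (Fin n → ℝ) → (Fin n → ℝ)) (u : Fin n → ℝ) :
    Matrix (Fin n) (Fin n) ℝ :=
  Matrix.of fun i j => fderiv ℝ f u (Pi.single j 1) i

open Classical in
/-- The separation function `d(u₋, u₀, s) = u(T) - u(0)`, where `u` is the solution on `[0, T]` of
the traveling-wave equation with parameters `(u₋, s)` and `u(0) = u₀`
(set to `0` if there is no solution on `[0, T]`). -/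
def separation {n : ℕ} (f : (Fin n → ℝ) → (Fin n → ℝ))
    (B : (Fin n → ℝ) → Matrix (Fin n) (Fin n) ℝ) (T : ℝ) (um u0 : Fin n → ℝ) (s : ℝ) :
    Fin n → ℝ :=
  if h : ∃ u : ℝ → (Fin n → ℝ), IsTravelingWaveOn f B um s u (Set.Icc 0 T) ∧ u 0 = u0 then
    h.choose T - h.choose 0
  else 0

/-- (H0): `f` and `B` are of class `C²`. -/
def HypH0 {n : ℕ} (f : (Fin n → ℝ) → (Fin n → ℝ))
    (B : (Fin n → ℝ) → Matrix (Fin n) (Fin n) ℝ) : Prop :=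
  ContDiff ℝ 2 f ∧ ∀ i j, ContDiff ℝ 2 (fun u => B u i j)

/-- (H1): the spectrum of `B(ū(x))` lies in the open right half-plane, for all `x`. -/
def HypH1 {n : ℕ} (B : (Fin n → ℝ) → Matrix (Fin n) (Fin n) ℝ) (ubar : ℝ → (Fin n → ℝ)) : Prop :=
  ∀ x : ℝ, ∀ μ ∈ spectrum ℂ ((B (ubar x)).map ((↑) : ℝ → ℂ)), 0 < μ.re

/-- (H2): `df(u₋) - s I` is invertible. -/
def HypH2 {n : ℕ} (f : (Fin n → ℝ) → (Fin n → ℝ)) (um : Fin n → ℝ) (s : ℝ) : Prop :=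
  IsUnit (jacobian f um - s • (1 : Matrix (Fin n) (Fin n) ℝ))

/-- (H3): `ū` is a transversal `T`-periodic orbit of the traveling-wave equation augmented with
`s' = 0`, i.e. `∂d/∂(u₀, s) : ℝⁿ × ℝ → ℝⁿ` has full rank `n` at `(ū(0), s)`. -/
def HypH3 {n : ℕ} (f : (Fin n → ℝ) → (Fin n → ℝ))
    (B : (Fin n → ℝ) → Matrix (Fin n) (Fin n) ℝ) (T : ℝ) (um : Fin n → ℝ) (s : ℝ)
    (ubar : ℝ → (Fin n → ℝ)) : Prop :=
  DifferentiableAt ℝ (fun p : (Fin n → ℝ) × ℝ => separation f B T um p.1 p.2) (ubar 0, s) ∧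
  Function.Surjective
    (fderiv ℝ (fun p : (Fin n → ℝ) × ℝ => separation f B T um p.1 p.2) (ubar 0, s))

/-! ## Coefficients of the linearization in the rest frame of the wave -/

/-- `B(x) = B(ū(x))`. -/
def coeffB {n : ℕ} (B : (Fin n → ℝ) → Matrix (Fin n) (Fin n) ℝ) (ubar : ℝ → (Fin n → ℝ)) :
    ℝ → Matrix (Fin n) (Fin n) ℝ :=
  fun x => B (ubar x)

/-- `A(x) v = (df(ū(x)) - s I) v - (dB(ū(x)) v) ū'(x)`. -/
def coeffA {n : ℕ} (f : (Fin n → ℝ) → (Fin n → ℝ))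
    (B : (Fin n → ℝ) → Matrix (Fin n) (Fin n) ℝ) (s : ℝ) (ubar : ℝ → (Fin n → ℝ)) :
    ℝ → Matrix (Fin n) (Fin n) ℝ :=
  fun x => jacobian f (ubar x) - s • (1 : Matrix (Fin n) (Fin n) ℝ)
    - Matrix.of fun i j =>
        ∑ k, fderiv ℝ (fun u => B u i k) (ubar x) (Pi.single j 1) * deriv ubar x k

/-- A real matrix, seen as a complex one. -/
def complexify {n : ℕ} (M : Matrix (Fin n) (Fin n) ℝ) : Matrix (Fin n) (Fin n) ℂ :=
  M.map ((↑) : ℝ → ℂ)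

/-- The entrywise derivative of a matrix function. -/
def matrixDeriv {n : ℕ} (M : ℝ → Matrix (Fin n) (Fin n) ℝ) (x : ℝ) : Matrix (Fin n) (Fin n) ℝ :=
  Matrix.of fun i j => deriv (fun y => M y i j) x

/-! ## The operator `L v = (B v')' - (A v)'` on periodic functions -/

/-- `L v = (B v')' - (A v)'`, with classical derivatives. -/
def linOp {n : ℕ} (B A : ℝ → Matrix (Fin n) (Fin n) ℝ) (v : ℝ → (Fin n → ℂ)) :
    ℝ → (Fin n → ℂ) :=
  fun x => deriv (fun y => complexify (B y) *ᵥ deriv v y) x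
    - deriv (fun y => complexify (A y) *ᵥ v y) x

/-- The domain of `L` on `T`-periodic functions: `ℂⁿ`-valued `T`-periodic functions of
class `C²`. -/
def periodicDomain (n : ℕ) (T : ℝ) : Set (ℝ → (Fin n → ℂ)) :=
  {v | ContDiff ℝ 2 v ∧ Function.Periodic v T}

/-- The kernel of `(L - λ)^m` on `T`-periodic functions. -/
def genKernel {n : ℕ} (B A : ℝ → Matrix (Fin n) (Fin n) ℝ) (T : ℝ) (lam : ℂ) :
    ℕ → Set (ℝ → (Fin n → ℂ))
  | 0 => {0}
  | m + 1 => {v | v ∈ periodicDomain n T ∧ linOp B A v - lam • v ∈ genKernel B A T lam m}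

/-- The generalized eigenspace `⋃ₘ ker (L - λ)^m` of `L` on `T`-periodic functions. (The union is
already a linear space when `B` and `A` are differentiable.) -/
def genEigenspace {n : ℕ} (B A : ℝ → Matrix (Fin n) (Fin n) ℝ) (T : ℝ) (lam : ℂ) :
    Submodule ℂ (ℝ → (Fin n → ℂ)) :=
  Submodule.span ℂ (⋃ m : ℕ, genKernel B A T lam m)

/-- The unstable eigenvalues of `L` on `T`-periodic functions. -/
def unstableEigenvalues {n : ℕ} (B A : ℝ → Matrix (Fin n) (Fin n) ℝ) (T : ℝ) : Set ℂ :=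
  {lam | 0 < lam.re ∧ ∃ v ∈ periodicDomain n T, v ≠ 0 ∧ linOp B A v = lam • v}

/-- The number of unstable eigenvalues of `L` on `T`-periodic functions, counted with algebraic
multiplicity. -/
def unstableCount {n : ℕ} (B A : ℝ → Matrix (Fin n) (Fin n) ℝ) (T : ℝ) : ℕ :=
  ∑ᶠ lam ∈ unstableEigenvalues B A T, Module.finrank ℂ (genEigenspace B A T lam)

/-! ## The periodic Evans function and the stability index -/

/-- The coefficient `𝔸(λ, x)` of the eigenvalue equation `(B w')' = (A w)' + λ w`, written as a
first-order system for `(w, w')`. -/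
def evansCoeff {n : ℕ} (B A : ℝ → Matrix (Fin n) (Fin n) ℝ) (lam : ℂ) (x : ℝ) :
    Matrix (Fin n ⊕ Fin n) (Fin n ⊕ Fin n) ℂ :=
  Matrix.fromBlocks 0 1
    (complexify ((B x)⁻¹) * (lam • (1 : Matrix (Fin n) (Fin n) ℂ) + complexify (matrixDeriv A x)))
    (complexify ((B x)⁻¹ * (A x - matrixDeriv B x)))

/-- `Ψ` is the fundamental solution: `Ψ' = 𝔸(λ, x) Ψ`, `Ψ(0) = I`. -/
def IsFundamentalSolution {n : ℕ} (B A : ℝ → Matrix (Fin n) (Fin n) ℝ) (lam : ℂ)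
    (Ψ : ℝ → Matrix (Fin n ⊕ Fin n) (Fin n ⊕ Fin n) ℂ) : Prop :=
  Ψ 0 = 1 ∧ ∀ x i j, HasDerivAt (fun y => Ψ y i j) ((evansCoeff B A lam x * Ψ x) i j) x

/-- The monodromy matrix `M(λ) = Ψ(T, λ)`. -/
def monodromy {n : ℕ} (B A : ℝ → Matrix (Fin n) (Fin n) ℝ) (T : ℝ) (lam : ℂ) :
    Matrix (Fin n ⊕ Fin n) (Fin n ⊕ Fin n) ℂ :=
  Classical.epsilon (IsFundamentalSolution B A lam) T

/-- The Evans function `D(k, λ) = det (M(λ) - e^{ikT})`. -/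
def evans {n : ℕ} (B A : ℝ → Matrix (Fin n) (Fin n) ℝ) (T : ℝ) (k : ℝ) (lam : ℂ) : ℂ :=
  (monodromy B A T lam
    - Complex.exp (Complex.I * k * T) • (1 : Matrix (Fin n ⊕ Fin n) (Fin n ⊕ Fin n) ℂ)).det

/-- The sign of `D(0, +∞)`: the limit of `sgn D(0, λ)` as `λ → +∞` along the real axis. -/
def evansSignInfty {n : ℕ} (B A : ℝ → Matrix (Fin n) (Fin n) ℝ) (T : ℝ) : ℝ :=
  limUnder atTop (fun r : ℝ => Real.sign (evans B A T 0 (r : ℂ)).re)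

/-- The stability index `Γ = sgn (∂/∂λ)^{n+1} D(0, 0) D(0, +∞)`. -/
def stabilityIndex {n : ℕ} (B A : ℝ → Matrix (Fin n) (Fin n) ℝ) (T : ℝ) : ℝ :=
  Real.sign ((iteratedDeriv (n + 1) (evans B A T 0) 0).re * evansSignInfty B A T)

/-- All ingredients of the stability index are meaningful: `D(0, ·)` is entire and real on the real
axis, and `sgn D(0, λ)` has a nonzero limit as `λ → +∞` along the real axis. -/
def StabilityIndexWellDefined {n : ℕ} (B A : ℝ → Matrix (Fin n) (Fin n) ℝ) (T : ℝ) : Prop :=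
  Differentiable ℂ (evans B A T 0) ∧
  (∀ r : ℝ, (evans B A T 0 (r : ℂ)).im = 0) ∧
  Tendsto (fun r : ℝ => Real.sign (evans B A T 0 (r : ℂ)).re) atTop (𝓝 (evansSignInfty B A T)) ∧
  evansSignInfty B A T ≠ 0

/-! ## The operator `L` on `Lᵖ(ℝ)` and weak spectral stability -/

/-- `g` is the weak derivative of `v` on `ℝ`. -/
def HasWeakDeriv {n : ℕ} (v g : ℝ → (Fin n → ℂ)) : Prop :=
  ∀ φ : ℝ → ℝ, ContDiff ℝ ∞ φ → HasCompactSupport φ →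
    ∫ x, deriv φ x • v x = - ∫ x, φ x • g x

/-- `v` is in the domain `W^{2,p}(ℝ; ℂⁿ)` of `L` on `Lᵖ(ℝ; ℂⁿ)`, and
`L v = (B v')' - (A v)' = g ∈ Lᵖ`. -/
def IsLpImage {n : ℕ} (B A : ℝ → Matrix (Fin n) (Fin n) ℝ) (p : ℝ≥0∞)
    (v g : Lp (Fin n → ℂ) p (volume : Measure ℝ)) : Prop :=
  ∃ v1 v2 : Lp (Fin n → ℂ) p (volume : Measure ℝ),
    HasWeakDeriv v v1 ∧ HasWeakDeriv v1 v2 ∧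
    HasWeakDeriv (fun x => complexify (B x) *ᵥ v1 x - complexify (A x) *ᵥ v x) g

/-- The spectrum of `L` on `Lᵖ(ℝ; ℂⁿ)`: the `λ` for which `L - λ` does not have a bounded
everywhere defined two-sided inverse. -/
def lpSpectrum {n : ℕ} (B A : ℝ → Matrix (Fin n) (Fin n) ℝ) (p : ℝ≥0∞) [Fact (1 ≤ p)] : Set ℂ :=
  {lam | ¬ ∃ R : Lp (Fin n → ℂ) p (volume : Measure ℝ) →L[ℂ] Lp (Fin n → ℂ) p (volume : Measure ℝ),
    (∀ v g, IsLpImage B A p v g → R (g - lam • v) = v) ∧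
    (∀ h, IsLpImage B A p (R h) (h + lam • R h))}

/-- Weak spectral stability: `σ(L) ⊂ {Re λ ≤ 0}`, with `L` acting on `Lᵖ(ℝ; ℂⁿ)`. -/
def WeaklySpectrallyStable {n : ℕ} (B A : ℝ → Matrix (Fin n) (Fin n) ℝ) (p : ℝ≥0∞)
    [Fact (1 ≤ p)] : Prop :=
  lpSpectrum B A p ⊆ {lam | lam.re ≤ 0}

end

namespace PeriodicEvans

open scoped BoundedContinuousFunction

/-! ### Linear differential equations depending affinely on a parameter -/

/-! The theorem is an intermediate value argument for the real entire function D = D(0, ·) on the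
positive axis, comparing its sign just right of 0 with its sign at +∞. The sign changes there
according to the number of positive zeros with multiplicity; nonreal zeros come in conjugate pairs,
so the same parity counts all zeros in the open right half-plane (`parity_zeros`). What has to be
supplied is an analytic dictionary between D and L.

Multiplicity. Expand the fundamental matrix at λ + X as a matrix P of formal power series. The
coefficients of P φ form chains (L - λ) v_j = v_{j-1}, periodic up to the order to which (P(T) - 1)
φ vanishes. Taking the residue of P (P(T) - 1)⁻¹ y identifies the cokernel of P(T) - 1 over the
power series ring with the generalized eigenspace, and the dimension of that cokernel is the order
of det (P(T) - 1), the Taylor series of D (`finrank_coker_eq_order`, `ker_residueMap`,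
`finrank_genEigenspace`).

The origin. At λ = 0 the flux B w' - A w is conserved, so in flux coordinates n rows of P(T) - 1 are
divisible by X. After dividing them, the matrix still annihilates at X = 0 the initial data of ū',
because ū' is periodic with mean zero. Hence D vanishes to order at least n + 1
(`succ_le_analyticOrderAt_evans`). If Γ ≠ 0 the order is exactly n + 1, and the (n+1)-st derivative
gives the sign of D at small positive λ.

Infinity. Periodic eigenvalues with Re λ ≥ 0 are bounded, by an energy estimate with a symmetrizer
for B (`exists_eigenvalue_bound`). So D has finitely many zeros in the closed right half-plane and a
constant nonzero sign for large real λ.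

Stability. If Γ < 0 the number of unstable periodic eigenvalues is odd, so one exists; cutting its
eigenfunction off at larger and larger scales shows that it lies in every Lᵖ(ℝ) spectrum
(`mem_lpSpectrum_of_eigenvalue`). -/

lemma abs_integral_exp_abs_le {κ : ℝ} (hκ : 0 < κ) (x : ℝ) :
    |∫ s in (0 : ℝ)..x, Real.exp (κ * |s|)| ≤ Real.exp (κ * |x|) / κ := by
  have key : ∀ x : ℝ, 0 ≤ x → ∫ s in (0 : ℝ)..x, Real.exp (κ * |s|) = (Real.exp (κ * x) - 1) / κ := by
    intro x hx
    have h1 : ∫ s in (0 : ℝ)..x, Real.exp (κ * |s|) = ∫ s in (0 : ℝ)..x, Real.exp (κ * s) := by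
      apply intervalIntegral.integral_congr
      intro s hs
      rw [Set.uIcc_of_le hx] at hs
      simp only [abs_of_nonneg hs.1]
    rw [h1, intervalIntegral.integral_comp_mul_left (fun s => Real.exp s) hκ.ne']
    simp [div_eq_inv_mul]
  have bound : ∀ x : ℝ, 0 ≤ x → |(Real.exp (κ * x) - 1) / κ| ≤ Real.exp (κ * x) / κ := by
    intro x hx
    have : 1 ≤ Real.exp (κ * x) := Real.one_le_exp (by positivity)
    rw [abs_of_nonneg (div_nonneg (by linarith) hκ.le)]
    gcongr
    linarith
  rcases le_total 0 x with hx | hx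
  · rw [key x hx, abs_of_nonneg hx]
    exact bound x hx
  · have h2 : ∫ s in (0 : ℝ)..x, Real.exp (κ * |s|)
        = - ∫ s in (0 : ℝ)..(-x), Real.exp (κ * |s|) := by
      have := intervalIntegral.integral_comp_neg (a := 0) (b := x)
        (fun s => Real.exp (κ * |s|))
      simp only [abs_neg, neg_zero] at this
      rw [this, intervalIntegral.integral_symm]
    rw [h2, abs_neg, key _ (by linarith), abs_of_nonpos hx]
    exact bound _ (by linarith)

variable {ι : Type*} [Fintype ι]

/-- The Volterra integral `x ↦ ∫₀ˣ A z`, conjugated by the weight `e^{κ|x|}`. -/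
noncomputable def weightedVolterra (κ : ℝ) (A : ℝ → (ι → ℂ) →L[ℂ] (ι → ℂ)) (z : ℝ → ι → ℂ) (x : ℝ) :
    ι → ℂ :=
  Real.exp (-(κ * |x|)) • ∫ s in (0 : ℝ)..x, Real.exp (κ * |s|) • A s (z s)

lemma continuous_weightedVolterra {κ : ℝ} {A : ℝ → (ι → ℂ) →L[ℂ] (ι → ℂ)} (hA : Continuous A)
    {z : ℝ → ι → ℂ} (hz : Continuous z) : Continuous (weightedVolterra κ A z) := by
  have hc : Continuous fun s => Real.exp (κ * |s|) • A s (z s) := by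
    have := hA.clm_apply hz
    fun_prop
  have := intervalIntegral.continuous_primitive (fun a b => hc.intervalIntegrable a b) 0
    (μ := volume)
  unfold weightedVolterra
  fun_prop

/-- The exponential weight turns the Volterra operator into one of norm at most K/κ on the whole
line, so a large κ makes it a contraction and global solutions come from a single Neumann series. -/
lemma norm_weightedVolterra_le {κ K : ℝ} (hκ : 0 < κ) {A : ℝ → (ι → ℂ) →L[ℂ] (ι → ℂ)}
    (hK : ∀ x, ‖A x‖ ≤ K) {z : ℝ → ι → ℂ} {C : ℝ} (hz : ∀ x, ‖z x‖ ≤ C) (x : ℝ) :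
    ‖weightedVolterra κ A z x‖ ≤ K / κ * C := by
  have hK0 : 0 ≤ K := (norm_nonneg _).trans (hK 0)
  have hC0 : 0 ≤ C := (norm_nonneg _).trans (hz 0)
  have h1 : ‖∫ s in (0 : ℝ)..x, Real.exp (κ * |s|) • A s (z s)‖
      ≤ |∫ s in (0 : ℝ)..x, (K * C) * Real.exp (κ * |s|)| := by
    apply intervalIntegral.norm_integral_le_abs_of_norm_le
    · refine Eventually.of_forall fun s => ?_
      rw [norm_smul, Real.norm_eq_abs, Real.abs_exp, mul_comm]
      gcongr
      calc ‖A s (z s)‖ ≤ ‖A s‖ * ‖z s‖ := (A s).le_opNorm _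
        _ ≤ K * C := by gcongr; exacts [hK s, hz s]
    · exact Continuous.intervalIntegrable (by fun_prop) _ _
  rw [intervalIntegral.integral_const_mul, abs_mul, abs_of_nonneg (by positivity)] at h1
  unfold weightedVolterra
  rw [norm_smul, Real.norm_eq_abs, Real.abs_exp]
  calc Real.exp (-(κ * |x|)) * ‖∫ s in (0 : ℝ)..x, Real.exp (κ * |s|) • A s (z s)‖
      ≤ Real.exp (-(κ * |x|)) * (K * C * (Real.exp (κ * |x|) / κ)) := by
        gcongr
        exact h1.trans (by gcongr; exact abs_integral_exp_abs_le hκ x)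
    _ = K / κ * C := by
        rw [Real.exp_neg]
        field_simp

/-- `weightedVolterra` as a bounded operator on bounded continuous functions. -/
noncomputable def volterraCLM {κ K : ℝ} (hκ : 0 < κ) {A : ℝ → (ι → ℂ) →L[ℂ] (ι → ℂ)}
    (hA : Continuous A) (hK : ∀ x, ‖A x‖ ≤ K) : (ℝ →ᵇ (ι → ℂ)) →L[ℂ] (ℝ →ᵇ (ι → ℂ)) :=
  LinearMap.mkContinuous
    { toFun := fun z => BoundedContinuousFunction.ofNormedAddCommGroup (weightedVolterra κ A z)
        (continuous_weightedVolterra hA z.continuous) (K / κ * ‖z‖)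
        (norm_weightedVolterra_le hκ hK z.norm_coe_le_norm)
      map_add' := by
        intro y z
        ext1 x
        have hc : ∀ z : ℝ →ᵇ (ι → ℂ), Continuous fun s => Real.exp (κ * |s|) • A s (z s) := by
          intro z
          have := hA.clm_apply z.continuous
          fun_prop
        simp only [weightedVolterra, BoundedContinuousFunction.coe_ofNormedAddCommGroup,
          BoundedContinuousFunction.coe_add, Pi.add_apply, map_add, smul_add]
        rw [intervalIntegral.integral_add ((hc y).intervalIntegrable _ _)
          ((hc z).intervalIntegrable _ _), smul_add]
      map_smul' := by
        intro c z
        ext1 x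
        simp only [weightedVolterra, BoundedContinuousFunction.coe_ofNormedAddCommGroup,
          BoundedContinuousFunction.coe_smul, map_smul, RingHom.id_apply]
        have : (fun s => Real.exp (κ * |s|) • c • A s (z s))
            = fun s => c • Real.exp (κ * |s|) • A s (z s) := by
          funext s
          rw [smul_comm c]
        rw [this, intervalIntegral.integral_smul, smul_comm c] }
    (K / κ) (by
      intro z
      have hK0 : 0 ≤ K := (norm_nonneg _).trans (hK 0)
      exact BoundedContinuousFunction.norm_ofNormedAddCommGroup_le _ (by positivity)
        (norm_weightedVolterra_le hκ hK z.norm_coe_le_norm))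

lemma volterraCLM_apply {κ K : ℝ} (hκ : 0 < κ) {A : ℝ → (ι → ℂ) →L[ℂ] (ι → ℂ)}
    (hA : Continuous A) (hK : ∀ x, ‖A x‖ ≤ K) (z : ℝ →ᵇ (ι → ℂ)) (x : ℝ) :
    volterraCLM hκ hA hK z x = weightedVolterra κ A z x := rfl

lemma norm_volterraCLM_le {κ K : ℝ} (hκ : 0 < κ) {A : ℝ → (ι → ℂ) →L[ℂ] (ι → ℂ)}
    (hA : Continuous A) (hK : ∀ x, ‖A x‖ ≤ K) : ‖volterraCLM hκ hA hK‖ ≤ K / κ := by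
  have hK0 : 0 ≤ K := (norm_nonneg _).trans (hK 0)
  exact LinearMap.mkContinuous_norm_le _ (by positivity) _

/-- The weight `e^{-κ|x|}` times a constant vector. -/
noncomputable def weightedConst {κ : ℝ} (hκ : 0 < κ) (c : ι → ℂ) : ℝ →ᵇ (ι → ℂ) :=
  BoundedContinuousFunction.ofNormedAddCommGroup (fun x => Real.exp (-(κ * |x|)) • c)
    (by fun_prop) ‖c‖ (by
      intro x
      rw [norm_smul, Real.norm_eq_abs, Real.abs_exp]
      exact mul_le_of_le_one_left (norm_nonneg _) (Real.exp_le_one_iff.2 (by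
        have := abs_nonneg x
        nlinarith)))

/-- A fixed point of the weighted integral equation yields a solution of the differential
equation. -/
lemma hasDerivAt_of_integral_eq {κ : ℝ} {A A' : ℝ → (ι → ℂ) →L[ℂ] (ι → ℂ)}
    (hA : Continuous A) (hA' : Continuous A') (c : ι → ℂ) (z z' : ℝ →ᵇ (ι → ℂ))
    (h : ∀ x, z x = Real.exp (-(κ * |x|)) • c + weightedVolterra κ A z x
      + weightedVolterra κ A' z' x) :
    Real.exp (κ * |(0 : ℝ)|) • z 0 = c ∧
    ∀ x, HasDerivAt (fun x => Real.exp (κ * |x|) • z x)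
      (A x (Real.exp (κ * |x|) • z x) + A' x (Real.exp (κ * |x|) • z' x)) x := by
  have hmul : ∀ x (v : ι → ℂ), Real.exp (κ * |x|) • Real.exp (-(κ * |x|)) • v = v := by
    intro x v
    rw [smul_smul, ← Real.exp_add]
    simp
  have key : (fun x => Real.exp (κ * |x|) • z x) = fun x => c +
      (∫ s in (0 : ℝ)..x, Real.exp (κ * |s|) • A s (z s))
      + ∫ s in (0 : ℝ)..x, Real.exp (κ * |s|) • A' s (z' s) := by
    funext x
    rw [h x, smul_add, smul_add, weightedVolterra, weightedVolterra, hmul, hmul, hmul]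
  have hc : ∀ (A : ℝ → (ι → ℂ) →L[ℂ] (ι → ℂ)) (hA : Continuous A) (z : ℝ →ᵇ (ι → ℂ)),
      Continuous fun s => Real.exp (κ * |s|) • A s (z s) := by
    intro A hA z
    have := hA.clm_apply z.continuous
    fun_prop
  constructor
  · have := congrFun key 0
    simpa using this
  · intro x
    rw [key]
    have h1 := intervalIntegral.integral_hasDerivAt_right
      ((hc A hA z).intervalIntegrable 0 x)
      ((hc A hA z).stronglyMeasurableAtFilter _ _) (hc A hA z).continuousAt
    have h2 := intervalIntegral.integral_hasDerivAt_right
      ((hc A' hA' z').intervalIntegrable 0 x)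
      ((hc A' hA' z').stronglyMeasurableAtFilter _ _) (hc A' hA' z').continuousAt
    have h3 := ((h1.const_add c).add h2)
    convert! h3 using 1
    have hs : ∀ (L : (ι → ℂ) →L[ℂ] (ι → ℂ)) (r : ℝ) (v : ι → ℂ), L (r • v) = r • L v :=
      fun L r v => LinearMap.map_smul_of_tower L.toLinearMap r v
    rw [hs, hs]

/-- The solution of `Z = c + V₀ Z + t V₁ Z` as a power series in `t`. -/
lemma exists_neumann_series {X : Type*} [NormedAddCommGroup X] [NormedSpace ℂ X] [CompleteSpace X]
    {V₀ : X →L[ℂ] X} (hV₀ : ‖V₀‖ < 1) (V₁ : X →L[ℂ] X) (c : X) :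
    ∃ z : ℕ → X, z 0 = c + V₀ (z 0) ∧ (∀ j, z (j + 1) = V₀ (z (j + 1)) + V₁ (z j)) ∧
      ∃ r > 0, ∀ t : ℂ, ‖t‖ < r → ∃ Z : X, HasSum (fun j => t ^ j • z j) Z ∧
        Z = c + V₀ Z + t • V₁ Z := by
  -- With R = (1 - V₀)⁻¹ and Q = R V₁ the equation reads Z = R c + t Q Z, hence Z = ∑ tʲ Qʲ R c.
  set u := Units.oneSub V₀ hV₀
  set R : X →L[ℂ] X := ↑(u⁻¹)
  have hR : ∀ z, R z = z + V₀ (R z) := by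
    intro z
    have h : (1 - V₀) * R = 1 := u.mul_inv
    have := DFunLike.congr_fun h z
    have h' : R z - V₀ (R z) = z := this
    rwa [sub_eq_iff_eq_add] at h'
  set Q := R * V₁
  set z : ℕ → X := fun j => (Q ^ j) (R c)
  have hz0 : z 0 = c + V₀ (z 0) := by
    simpa [z] using hR c
  have hzs : ∀ j, z (j + 1) = V₀ (z (j + 1)) + V₁ (z j) := by
    intro j
    have : z (j + 1) = R (V₁ (z j)) := by
      simp only [z, pow_succ']
      rfl
    rw [this, add_comm]
    exact hR _
  -- The `+ 1` keeps the radius meaningful when Q = 0.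
  refine ⟨z, hz0, hzs, (‖Q‖ + 1)⁻¹, by positivity, fun t ht => ?_⟩
  have htQ : ‖t • Q‖ < 1 := by
    rw [norm_smul]
    have : ‖t‖ * (‖Q‖ + 1) < 1 := by
      rw [← one_div] at ht
      exact (lt_div_iff₀ (by positivity)).1 ht
    nlinarith [norm_nonneg t, norm_nonneg Q]
  have hsum : Summable fun j => (t • Q) ^ j := summable_geometric_of_norm_lt_one htQ
  have hsum' : HasSum (fun j => t ^ j • z j) ((∑' j, (t • Q) ^ j) (R c)) := by
    have := hsum.hasSum.mapL (ContinuousLinearMap.apply ℂ X (R c))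
    simpa [smul_pow, z] using this
  set Z := (∑' j, (t • Q) ^ j) (R c)
  refine ⟨Z, hsum', ?_⟩
  have a1 : HasSum (fun j => t ^ (j + 1) • z (j + 1)) (Z - z 0) := by
    have := (hasSum_nat_add_iff' 1).2 hsum'
    simpa using this
  have a2 : HasSum (fun j => t ^ (j + 1) • z (j + 1)) (V₀ (Z - z 0) + t • V₁ Z) := by
    have b3 := (a1.mapL V₀).add ((hsum'.mapL V₁).const_smul t)
    convert b3 using 2 with j
    conv_lhs => rw [hzs j]
    simp only [map_smul, smul_add, smul_smul, pow_succ']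
  have a3 := a1.unique a2
  have : Z = z 0 + (V₀ (Z - z 0) + t • V₁ Z) := by rw [← a3]; abel
  calc Z = z 0 + (V₀ (Z - z 0) + t • V₁ Z) := this
    _ = (c + V₀ (z 0)) + (V₀ (Z - z 0) + t • V₁ Z) := by rw [← hz0]
    _ = _ := by rw [map_sub]; abel

/-- The linear equation `Y' = (A₀ + t A₁) Y`, `Y(0) = y₀`, has a global solution given by a power
series in the parameter `t`, whose coefficients solve the corresponding recursive system. -/
theorem exists_parametric_solution {A₀ A₁ : ℝ → (ι → ℂ) →L[ℂ] (ι → ℂ)} (h0 : Continuous A₀)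
    (h1 : Continuous A₁) {K₀ K₁ : ℝ} (hK₀ : ∀ x, ‖A₀ x‖ ≤ K₀) (hK₁ : ∀ x, ‖A₁ x‖ ≤ K₁)
    (y₀ : ι → ℂ) :
    ∃ y : ℕ → ℝ → ι → ℂ, y 0 0 = y₀ ∧ (∀ j, y (j + 1) 0 = 0) ∧
      (∀ x, HasDerivAt (y 0) (A₀ x (y 0 x)) x) ∧
      (∀ j x, HasDerivAt (y (j + 1)) (A₀ x (y (j + 1) x) + A₁ x (y j x)) x) ∧
      ∃ r > 0, ∀ t : ℂ, ‖t‖ < r → ∃ Y : ℝ → ι → ℂ, Y 0 = y₀ ∧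
        (∀ x, HasDerivAt Y (A₀ x (Y x) + t • A₁ x (Y x)) x) ∧
        ∀ x, HasSum (fun j => t ^ j • y j x) (Y x) := by
  have hK0 : 0 ≤ K₀ := (norm_nonneg _).trans (hK₀ 0)
  -- This makes K₀ / κ < 1 and keeps κ positive even if K₀ = 0. Only A₀ must be contracted; A₁ is
  -- absorbed by the smallness of t.
  set κ : ℝ := 2 * K₀ + 1 with hκdef
  have hκ : 0 < κ := by positivity
  set V₀ := volterraCLM hκ h0 hK₀
  set V₁ := volterraCLM hκ h1 hK₁
  have hV₀ : ‖V₀‖ < 1 := (norm_volterraCLM_le hκ h0 hK₀).trans_lt (by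
    rw [div_lt_one hκ]; linarith)
  obtain ⟨z, hz0, hzs, r, hr, hZ⟩ := exists_neumann_series hV₀ V₁ (weightedConst hκ y₀)
  have e0 := hasDerivAt_of_integral_eq (κ := κ) (z' := 0) h0 h1 y₀ (z 0) (by
    intro x
    have := DFunLike.congr_fun hz0 x
    rw [this]
    simp [V₀, volterraCLM_apply, weightedConst, weightedVolterra])
  have es := fun j => hasDerivAt_of_integral_eq (κ := κ) h0 h1 0 (z (j + 1)) (z j) (by
    intro x
    have := DFunLike.congr_fun (hzs j) x
    rw [this]
    simp [V₀, V₁, volterraCLM_apply])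
  refine ⟨fun j x => Real.exp (κ * |x|) • z j x, e0.1, fun j => (es j).1, ?_,
    fun j x => (es j).2 x, ?_⟩
  · intro x
    simpa using e0.2 x
  refine ⟨r, hr, fun t ht => ?_⟩
  obtain ⟨Z, hsum', hZ⟩ := hZ t ht
  refine ⟨fun x => Real.exp (κ * |x|) • Z x, ?_⟩
  have e := hasDerivAt_of_integral_eq (κ := κ) (A' := fun x => t • A₁ x) h0 (h1.const_smul t) y₀
    Z Z (by
    intro x
    have := DFunLike.congr_fun hZ x
    rw [this]
    simp only [V₀, V₁, volterraCLM_apply, weightedConst, weightedVolterra,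
      BoundedContinuousFunction.coe_add, Pi.add_apply,
      BoundedContinuousFunction.coe_ofNormedAddCommGroup, BoundedContinuousFunction.coe_smul,
      _root_.smul_apply]
    congr 1
    rw [smul_comm t, ← intervalIntegral.integral_smul]
    simp only [smul_comm t])
  refine ⟨e.1, fun x => ?_, fun x => ?_⟩
  · simpa using e.2 x
  · have b := (hsum'.mapL (BoundedContinuousFunction.evalCLM ℂ x)).const_smul
      (Real.exp (κ * |x|))
    simpa only [BoundedContinuousFunction.evalCLM_apply, BoundedContinuousFunction.coe_smul,
      smul_comm _ (Real.exp (κ * |x|))] using b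

/-- Uniqueness of solutions of linear differential equations. -/
theorem linear_ode_unique {A : ℝ → (ι → ℂ) →L[ℂ] (ι → ℂ)} {K : ℝ} (hK : ∀ x, ‖A x‖ ≤ K)
    {b y z : ℝ → ι → ℂ} (hy : ∀ x, HasDerivAt y (A x (y x) + b x) x)
    (hz : ∀ x, HasDerivAt z (A x (z x) + b x) x) (h0 : y 0 = z 0) : y = z := by
  have hK0 : 0 ≤ K := (norm_nonneg _).trans (hK 0)
  refine ODE_solution_unique_univ (v := fun x w => A x w + b x) (s := fun _ => Set.univ)
    (K := ⟨K, hK0⟩) (t₀ := 0) ?_ (fun x => ⟨hy x, trivial⟩) (fun x => ⟨hz x, trivial⟩) h0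
  intro x
  refine LipschitzWith.lipschitzOnWith ?_
  refine LipschitzWith.of_dist_le_mul fun v w => ?_
  rw [dist_eq_norm, dist_eq_norm, add_sub_add_right_eq_sub, ← map_sub]
  exact (A x).le_of_opNorm_le (hK x) _

end PeriodicEvans

namespace PeriodicEvans

/-! ### Cokernels of matrices over a ring of formal power series -/

section Cokernel

open PowerSeries

variable {K : Type*} [Field K]

/-- Additivity of the dimension of the cokernel. -/
lemma finrank_coker_comp {V : Type*} [AddCommGroup V] [Module K V] {f g : V →ₗ[K] V}
    (hf : Function.Injective f) [FiniteDimensional K (V ⧸ LinearMap.range f)]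
    [FiniteDimensional K (V ⧸ LinearMap.range g)] :
    FiniteDimensional K (V ⧸ LinearMap.range (f ∘ₗ g)) ∧
    Module.finrank K (V ⧸ LinearMap.range (f ∘ₗ g))
      = Module.finrank K (V ⧸ LinearMap.range f) + Module.finrank K (V ⧸ LinearMap.range g) := by
  -- The maps φ and π form the exact sequence 0 → V/ran g → V/ran (f g) → V/ran f → 0; injectivity
  -- of f is what makes φ injective.
  set φ : V ⧸ LinearMap.range g →ₗ[K] V ⧸ LinearMap.range (f ∘ₗ g) :=
    Submodule.mapQ _ _ f (by
      rintro _ ⟨x, rfl⟩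
      exact ⟨x, rfl⟩) with hφ
  set π : V ⧸ LinearMap.range (f ∘ₗ g) →ₗ[K] V ⧸ LinearMap.range f :=
    Submodule.mapQ _ _ LinearMap.id (by
      rintro _ ⟨x, rfl⟩
      exact ⟨g x, rfl⟩) with hπ
  have hφi : Function.Injective φ := by
    rw [← LinearMap.ker_eq_bot, LinearMap.ker_eq_bot']
    intro q hq
    obtain ⟨x, rfl⟩ := Submodule.Quotient.mk_surjective _ q
    simp only [hφ, Submodule.mapQ_apply] at hq
    rw [Submodule.Quotient.mk_eq_zero] at hq ⊢
    obtain ⟨y, hy⟩ := hq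
    exact ⟨y, hf hy⟩
  have hπs : Function.Surjective π := by
    intro q
    obtain ⟨x, rfl⟩ := Submodule.Quotient.mk_surjective _ q
    exact ⟨Submodule.Quotient.mk x, rfl⟩
  have hker : LinearMap.ker π = LinearMap.range φ := by
    ext q
    obtain ⟨x, rfl⟩ := Submodule.Quotient.mk_surjective _ q
    constructor
    · intro hq
      rw [LinearMap.mem_ker] at hq
      simp only [hπ, Submodule.mapQ_apply, LinearMap.id_apply] at hq
      rw [Submodule.Quotient.mk_eq_zero] at hq
      obtain ⟨y, rfl⟩ := hq
      exact ⟨Submodule.Quotient.mk y, rfl⟩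
    · rintro ⟨p, hp⟩
      obtain ⟨y, rfl⟩ := Submodule.Quotient.mk_surjective _ p
      rw [← hp, LinearMap.mem_ker]
      simp only [hπ, hφ, Submodule.mapQ_apply, LinearMap.id_apply]
      rw [Submodule.Quotient.mk_eq_zero]
      exact ⟨y, rfl⟩
  have : FiniteDimensional K (LinearMap.ker π) := by
    rw [hker]; infer_instance
  have hfd : FiniteDimensional K (V ⧸ LinearMap.range (f ∘ₗ g)) := by
    have := Module.Finite.equiv (π.quotKerEquivOfSurjective hπs).symm
    exact Module.Finite.of_submodule_quotient (LinearMap.ker π)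
  refine ⟨hfd, ?_⟩
  rw [← LinearMap.finrank_range_add_finrank_ker π, hker, LinearMap.range_eq_top.2 hπs, finrank_top,
    LinearMap.finrank_range_of_inj hφi]

variable {N : Type*} [Fintype N]

/-- Multiplication by a matrix of power series, as a linear map over the coefficient field. -/
noncomputable def seriesMulVec (F : Matrix N N K⟦X⟧) : (N → K⟦X⟧) →ₗ[K] (N → K⟦X⟧) :=
  F.mulVecLin.restrictScalars K

@[simp] lemma seriesMulVec_apply (F : Matrix N N K⟦X⟧) (v : N → K⟦X⟧) :
    seriesMulVec F v = F *ᵥ v := rfl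

lemma seriesMulVec_mul (F G : Matrix N N K⟦X⟧) :
    seriesMulVec (F * G) = seriesMulVec F ∘ₗ seriesMulVec G := by
  refine LinearMap.ext fun v => ?_
  simp [Matrix.mulVec_mulVec]

variable [DecidableEq N]

lemma seriesMulVec_injective {F : Matrix N N K⟦X⟧} (hF : F.det ≠ 0) :
    Function.Injective (seriesMulVec F) :=
  Matrix.mulVec_injective_of_det_ne_zero hF

lemma range_seriesMulVec_of_isUnit {F : Matrix N N K⟦X⟧} (hF : IsUnit F.det) :
    LinearMap.range (seriesMulVec F) = ⊤ := by
  rw [LinearMap.range_eq_top]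
  intro y
  refine ⟨F⁻¹ *ᵥ y, ?_⟩
  simp [Matrix.mulVec_mulVec, Matrix.mul_nonsing_inv _ hF]

/-- The cokernel of `diag(1, …, X, …, 1)` is one-dimensional. -/
lemma finrank_coker_diagonal_X (i : N) :
    FiniteDimensional K ((N → K⟦X⟧) ⧸ LinearMap.range
      (seriesMulVec (Matrix.diagonal (Function.update (1 : N → K⟦X⟧) i X)))) ∧
    Module.finrank K ((N → K⟦X⟧) ⧸ LinearMap.range
      (seriesMulVec (Matrix.diagonal (Function.update (1 : N → K⟦X⟧) i X)))) = 1 := by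
  set c : (N → K⟦X⟧) →ₗ[K] K := (PowerSeries.coeff 0).comp (LinearMap.proj i) with hc
  have hker : LinearMap.range
      (seriesMulVec (Matrix.diagonal (Function.update (1 : N → K⟦X⟧) i X))) = LinearMap.ker c := by
    ext v
    constructor
    · rintro ⟨w, rfl⟩
      simp [hc, Matrix.mulVec_diagonal]
    · intro hv
      have hv' : PowerSeries.constantCoeff (v i) = 0 := by
        simpa [hc] using hv
      obtain ⟨p, hp⟩ := PowerSeries.X_dvd_iff.2 hv'
      refine ⟨Function.update v i p, ?_⟩
      ext1 j
      rw [seriesMulVec_apply, Matrix.mulVec_diagonal]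
      by_cases h : j = i
      · subst h; simp [hp]
      · simp [h]
  have hsurj : Function.Surjective c := by
    intro a
    exact ⟨fun _ => PowerSeries.C a, by simp [hc]⟩
  rw [hker]
  have e := c.quotKerEquivOfSurjective hsurj
  exact ⟨Module.Finite.equiv e.symm, by rw [e.finrank_eq, Module.finrank_self]⟩

/-- A matrix of power series which is singular at `0` factors off a matrix
`diag(1, …, X, …, 1)`. -/
lemma exists_factor_of_det (F : Matrix N N K⟦X⟧) (hF : PowerSeries.constantCoeff F.det = 0) :
    ∃ (P G : Matrix N N K⟦X⟧) (i : N), IsUnit P.det ∧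
      F * P = G * Matrix.diagonal (Function.update (1 : N → K⟦X⟧) i X) := by
  have h0 : (F.map (PowerSeries.constantCoeff (R := K))).det = 0 := by
    rw [← hF]
    exact (RingHom.map_det _ F).symm
  obtain ⟨c, hc, hFc⟩ := Matrix.exists_mulVec_eq_zero_iff.2 h0
  obtain ⟨i, hi⟩ := Function.ne_iff.1 hc
  have hi : c i ≠ 0 := hi
  set c' : N → K⟦X⟧ := fun j => PowerSeries.C (c j)
  have hdvd : ∀ j, X ∣ (F *ᵥ c') j := by
    intro j
    rw [PowerSeries.X_dvd_iff]
    have := congrFun hFc j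
    simpa [Matrix.mulVec, dotProduct, c'] using this
  choose g hg using hdvd
  -- P is the identity with column i replaced by a kernel vector c of F(0), so det P = c i ≠ 0, and
  -- column i of F P is F c, which is divisible by X.
  refine ⟨Matrix.updateCol 1 i c', Matrix.updateCol F i g, i, ?_, ?_⟩
  · have : (Matrix.updateCol (1 : Matrix N N K⟦X⟧) i c').det = PowerSeries.C (c i) := by
      rw [← Matrix.cramer_apply, Matrix.cramer_one]
      rfl
    rw [this]
    exact (isUnit_iff_ne_zero.2 hi).map _
  · ext1 j k
    rw [Matrix.mul_diagonal]
    by_cases h : k = i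
    · subst h
      have : (F * Matrix.updateCol (1 : Matrix N N K⟦X⟧) k c') j k = (F *ᵥ c') j := by
        simp [Matrix.mul_apply, Matrix.mulVec, dotProduct]
      rw [this, hg]
      simp [mul_comm]
    · have : (F * Matrix.updateCol (1 : Matrix N N K⟦X⟧) i c') j k = F j k := by
        simp [Matrix.mul_apply, h, Matrix.one_apply]
      rw [this]
      simp [h]

/-- The dimension of the cokernel of a matrix of power series is the order of its determinant. -/
theorem finrank_coker_eq_order (d : ℕ) : ∀ (F : Matrix N N K⟦X⟧) (u : K⟦X⟧), IsUnit u →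
    F.det = X ^ d * u →
    FiniteDimensional K ((N → K⟦X⟧) ⧸ LinearMap.range (seriesMulVec F)) ∧
    Module.finrank K ((N → K⟦X⟧) ⧸ LinearMap.range (seriesMulVec F)) = d := by
  induction d with
  | zero =>
    intro F u hu hF
    rw [pow_zero, one_mul] at hF
    rw [range_seriesMulVec_of_isUnit (hF ▸ hu)]
    exact ⟨inferInstance, Module.finrank_zero_of_subsingleton⟩
  | succ d ih =>
    intro F u hu hF
    -- Each step strips one factor X from the determinant and, by additivity, one dimension from the
    -- cokernel.
    obtain ⟨P, G, i, hP, hPG⟩ := exists_factor_of_det F (by rw [hF]; simp)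
    have hdet := congrArg Matrix.det hPG
    rw [Matrix.det_mul, Matrix.det_mul, Matrix.det_diagonal, Finset.prod_update_of_mem
      (Finset.mem_univ i), hF] at hdet
    simp only [Pi.one_apply, Finset.prod_const_one, mul_one] at hdet
    have hG : G.det = X ^ d * (u * P.det) := by
      have hX : (X : K⟦X⟧) ≠ 0 := PowerSeries.X_ne_zero
      apply mul_right_cancel₀ hX
      rw [← hdet]; ring
    obtain ⟨h1, h2⟩ := ih G _ (hu.mul hP) hG
    obtain ⟨h3, h4⟩ := finrank_coker_diagonal_X (K := K) i
    have hGne : G.det ≠ 0 := by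
      rw [hG]
      exact mul_ne_zero (pow_ne_zero _ PowerSeries.X_ne_zero) (hu.mul hP).ne_zero
    -- Multiplying on the right by the invertible P does not change the range.
    have hrange : LinearMap.range (seriesMulVec F) = LinearMap.range
        (seriesMulVec G ∘ₗ
          seriesMulVec (Matrix.diagonal (Function.update (1 : N → K⟦X⟧) i X))) := by
      rw [← seriesMulVec_mul, ← hPG, seriesMulVec_mul, LinearMap.range_comp,
        range_seriesMulVec_of_isUnit hP, Submodule.map_top]
    rw [hrange]
    obtain ⟨h5, h6⟩ := finrank_coker_comp (seriesMulVec_injective hGne)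
      (g := seriesMulVec (Matrix.diagonal (Function.update (1 : N → K⟦X⟧) i X)))
    exact ⟨h5, by rw [h6, h2, h4]⟩

end Cokernel

end PeriodicEvans

namespace PeriodicEvans

open PowerSeries

/-! ### Functions given by a power series near a point -/

section Taylor

/-- `f` is the sum of the power series `p` near `z₀`. -/
def HasSeriesAt (f : ℂ → ℂ) (p : ℂ⟦X⟧) (z₀ : ℂ) : Prop :=
  ∀ᶠ t in 𝓝 0, HasSum (fun j => t ^ j • PowerSeries.coeff j p) (f (z₀ + t))

variable {f g : ℂ → ℂ} {p q : ℂ⟦X⟧} {z₀ : ℂ}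

lemma HasSeriesAt.hasFPowerSeriesAt (h : HasSeriesAt f p z₀) :
    HasFPowerSeriesAt f (FormalMultilinearSeries.ofScalars ℂ fun j => PowerSeries.coeff j p) z₀ := by
  rw [hasFPowerSeriesAt_iff]
  unfold HasSeriesAt at h
  simpa only [FormalMultilinearSeries.coeff_ofScalars] using h

lemma HasSeriesAt.iteratedDeriv_eq (h : HasSeriesAt f p z₀) (j : ℕ) :
    iteratedDeriv j f z₀ = (Nat.factorial j : ℂ) * PowerSeries.coeff j p := by
  obtain ⟨r, hr⟩ := h.hasFPowerSeriesAt
  have := hr.factorial_smul 1 j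
  rw [iteratedDeriv_eq_iteratedFDeriv, ← this]
  simp [FormalMultilinearSeries.ofScalars]

lemma hasSeriesAt_const (c : ℂ) : HasSeriesAt (fun _ => c) (PowerSeries.C c) z₀ := by
  refine Eventually.of_forall fun t => ?_
  have := hasSum_single (f := fun j => t ^ j • PowerSeries.coeff j (PowerSeries.C c)) 0
    (fun j hj => by simp [PowerSeries.coeff_C, hj])
  simpa using this

lemma HasSeriesAt.add (hf : HasSeriesAt f p z₀) (hg : HasSeriesAt g q z₀) :
    HasSeriesAt (fun z => f z + g z) (p + q) z₀ := by
  filter_upwards [hf, hg] with t h1 h2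
  simpa [mul_add] using h1.add h2

lemma HasSeriesAt.mul (hf : HasSeriesAt f p z₀) (hg : HasSeriesAt g q z₀) :
    HasSeriesAt (fun z => f z * g z) (p * q) z₀ := by
  filter_upwards [hf, hg] with t h1 h2
  have s1 := summable_norm_iff.2 h1.summable
  have s2 := summable_norm_iff.2 h2.summable
  have e := tsum_mul_tsum_eq_tsum_sum_antidiagonal_of_summable_norm s1 s2
  rw [h1.tsum_eq, h2.tsum_eq] at e
  have s3 := (summable_norm_sum_mul_antidiagonal_of_summable_norm s1 s2).of_norm
  have e2 := s3.hasSum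
  rw [← e] at e2
  suffices hfun : (fun j => t ^ j • PowerSeries.coeff j (p * q)) = fun n =>
      ∑ kl ∈ Finset.HasAntidiagonal.antidiagonal n,
        t ^ kl.1 • PowerSeries.coeff kl.1 p * t ^ kl.2 • PowerSeries.coeff kl.2 q by
    rw [hfun]
    exact e2
  funext j
  rw [PowerSeries.coeff_mul, Finset.smul_sum]
  refine Finset.sum_congr rfl fun a ha => ?_
  rw [← Finset.HasAntidiagonal.mem_antidiagonal.1 ha, pow_add]
  simp only [smul_eq_mul]
  ring

lemma HasSeriesAt.sum {α : Type*} (s : Finset α) {f : α → ℂ → ℂ} {p : α → ℂ⟦X⟧}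
    (h : ∀ a ∈ s, HasSeriesAt (f a) (p a) z₀) :
    HasSeriesAt (fun z => ∑ a ∈ s, f a z) (∑ a ∈ s, p a) z₀ := by
  classical
  induction s using Finset.induction_on with
  | empty => simpa using hasSeriesAt_const (z₀ := z₀) 0
  | insert a s ha ih =>
    simp only [Finset.sum_insert ha]
    exact (h a (by simp)).add (ih fun b hb => h b (by simp [hb]))

lemma HasSeriesAt.prod {α : Type*} (s : Finset α) {f : α → ℂ → ℂ} {p : α → ℂ⟦X⟧}
    (h : ∀ a ∈ s, HasSeriesAt (f a) (p a) z₀) :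
    HasSeriesAt (fun z => ∏ a ∈ s, f a z) (∏ a ∈ s, p a) z₀ := by
  classical
  induction s using Finset.induction_on with
  | empty => simpa using hasSeriesAt_const (z₀ := z₀) 1
  | insert a s ha ih =>
    simp only [Finset.prod_insert ha]
    exact (h a (by simp)).mul (ih fun b hb => h b (by simp [hb]))

lemma HasSeriesAt.det {N : Type*} [Fintype N] [DecidableEq N] {f : ℂ → Matrix N N ℂ}
    {p : Matrix N N ℂ⟦X⟧} (h : ∀ i j, HasSeriesAt (fun z => f z i j) (p i j) z₀) :
    HasSeriesAt (fun z => (f z).det) p.det z₀ := by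
  simp only [Matrix.det_apply']
  refine HasSeriesAt.sum _ fun σ _ => ?_
  have := (hasSeriesAt_const (z₀ := z₀) ((Equiv.Perm.sign σ : ℤ) : ℂ)).mul
    (HasSeriesAt.prod Finset.univ fun i _ => h (σ i) i)
  simpa using this

/-- The order of a function is the order of its power series. -/
lemma HasSeriesAt.analyticOrderAt_eq {d : ℕ} {u : ℂ⟦X⟧} (hu : IsUnit u)
    (h : HasSeriesAt f (X ^ d * u) z₀) : analyticOrderAt f z₀ = d := by
  have han : AnalyticAt ℂ f z₀ := h.hasFPowerSeriesAt.analyticAt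
  rw [analyticOrderAt_eq_nat_iff_iteratedDeriv_eq_zero han]
  constructor
  · intro i hi
    rw [h.iteratedDeriv_eq, PowerSeries.coeff_X_pow_mul', if_neg (by omega), mul_zero]
  · rw [h.iteratedDeriv_eq, PowerSeries.coeff_X_pow_mul', if_pos le_rfl, Nat.sub_self,
      PowerSeries.coeff_zero_eq_constantCoeff_apply]
    exact mul_ne_zero (Nat.cast_ne_zero.2 (Nat.factorial_ne_zero d))
      (hu.map PowerSeries.constantCoeff).ne_zero

/-- A nonzero power series is a power of the variable times a unit. -/
lemma exists_eq_X_pow_mul_isUnit (hp : p ≠ 0) : ∃ (d : ℕ) (u : ℂ⟦X⟧), IsUnit u ∧ p = X ^ d * u := by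
  refine ⟨p.order.toNat, PowerSeries.divXPowOrder p, ?_, PowerSeries.X_pow_order_mul_divXPowOrder.symm⟩
  rw [PowerSeries.isUnit_iff_constantCoeff, isUnit_iff_ne_zero]
  rw [PowerSeries.constantCoeff_divXPowOrder]
  exact PowerSeries.coeff_order hp

end Taylor

end PeriodicEvans

namespace PeriodicEvans

open PowerSeries

/-! ### Differential equations for power series with coefficients depending on `x` -/

/-- `g'` is the coefficientwise derivative of `g : ℝ → ℂ⟦X⟧` at `x`, up to order `m`. -/
def HasSeriesDerivAt (m : ℕ) (g : ℝ → ℂ⟦X⟧) (g' : ℂ⟦X⟧) (x : ℝ) : Prop :=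
  ∀ j < m, HasDerivAt (fun y => PowerSeries.coeff j (g y)) (PowerSeries.coeff j g') x

section SeriesDeriv

variable {m : ℕ} {g h : ℝ → ℂ⟦X⟧} {g' h' : ℂ⟦X⟧} {x : ℝ}

lemma HasSeriesDerivAt.sub (hg : HasSeriesDerivAt m g g' x) (hh : HasSeriesDerivAt m h h' x) :
    HasSeriesDerivAt m (fun y => g y - h y) (g' - h') x := by
  intro j hj
  simpa using (hg j hj).fun_sub (hh j hj)

lemma HasSeriesDerivAt.mul_const (hg : HasSeriesDerivAt m g g' x) (p : ℂ⟦X⟧) :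
    HasSeriesDerivAt m (fun y => g y * p) (g' * p) x := by
  intro j hj
  simp only [PowerSeries.coeff_mul]
  refine HasDerivAt.fun_sum fun a ha => (hg a.1 ?_).mul_const _
  have := Finset.HasAntidiagonal.mem_antidiagonal.1 ha
  omega

lemma HasSeriesDerivAt.sum {α : Type*} (s : Finset α) {g : α → ℝ → ℂ⟦X⟧} {g' : α → ℂ⟦X⟧}
    (hg : ∀ a ∈ s, HasSeriesDerivAt m (g a) (g' a) x) :
    HasSeriesDerivAt m (fun y => ∑ a ∈ s, g a y) (∑ a ∈ s, g' a) x := by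
  intro j hj
  simp only [map_sum]
  exact HasDerivAt.fun_sum fun a ha => hg a ha j hj

end SeriesDeriv

variable {N : Type*} [Fintype N]

/-- The matrix of power series `A₀ + X A₁`. -/
noncomputable def pencil (A₀ A₁ : Matrix N N ℂ) : Matrix N N ℂ⟦X⟧ :=
  A₀.map PowerSeries.C + (X : ℂ⟦X⟧) • A₁.map PowerSeries.C

lemma coeff_zero_pencil_mulVec (A₀ A₁ : Matrix N N ℂ) (v : N → ℂ⟦X⟧) (i : N) :
    PowerSeries.coeff 0 ((pencil A₀ A₁ *ᵥ v) i) = (A₀ *ᵥ fun k => PowerSeries.coeff 0 (v k)) i := by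
  simp [pencil, Matrix.mulVec, dotProduct]

lemma coeff_succ_pencil_mulVec (A₀ A₁ : Matrix N N ℂ) (v : N → ℂ⟦X⟧) (i : N) (j : ℕ) :
    PowerSeries.coeff (j + 1) ((pencil A₀ A₁ *ᵥ v) i)
      = (A₀ *ᵥ fun k => PowerSeries.coeff (j + 1) (v k)) i
        + (A₁ *ᵥ fun k => PowerSeries.coeff j (v k)) i := by
  simp [pencil, Matrix.mulVec, dotProduct, add_mul, Finset.sum_add_distrib, mul_assoc,
    PowerSeries.coeff_succ_X_mul]

/-- A matrix as a continuous linear map. -/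
noncomputable def matrixCLM : Matrix N N ℂ →ₗ[ℂ] ((N → ℂ) →L[ℂ] (N → ℂ)) where
  toFun M := LinearMap.toContinuousLinearMap M.mulVecLin
  map_add' M M' := by
    ext1 v
    simp
  map_smul' c M := by
    ext1 v
    simp

@[simp] lemma matrixCLM_apply (M : Matrix N N ℂ) (v : N → ℂ) : matrixCLM M v = M *ᵥ v := rfl

lemma continuous_matrixCLM : Continuous (matrixCLM (N := N)) :=
  LinearMap.continuous_of_finiteDimensional _

/-- `A` is a continuous `T`-periodic matrix function. -/
structure IsPeriodicCoeff (A : ℝ → Matrix N N ℂ) (T : ℝ) : Prop where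
  continuous : Continuous A
  periodic : Function.Periodic A T

lemma IsPeriodicCoeff.exists_bound {A : ℝ → Matrix N N ℂ} {T : ℝ} (h : IsPeriodicCoeff A T)
    (hT : 0 < T) : ∃ K, ∀ x, ‖matrixCLM (A x)‖ ≤ K := by
  have hp : Function.Periodic (fun x => matrixCLM (A x)) T := fun x => by simp only [h.periodic x]
  obtain ⟨K, hK⟩ := (hp.isBounded_of_continuous hT.ne'
    (continuous_matrixCLM.comp h.continuous)).exists_norm_le
  exact ⟨K, fun x => hK _ ⟨x, rfl⟩⟩

lemma IsPeriodicCoeff.ode_unique {A : ℝ → Matrix N N ℂ} {T : ℝ} (h : IsPeriodicCoeff A T)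
    (hT : 0 < T) {y z : ℝ → N → ℂ} (hy : ∀ x i, HasDerivAt (fun x => y x i) ((A x *ᵥ y x) i) x)
    (hz : ∀ x i, HasDerivAt (fun x => z x i) ((A x *ᵥ z x) i) x) (h0 : y 0 = z 0) : y = z := by
  obtain ⟨K, hK⟩ := h.exists_bound hT
  refine linear_ode_unique (b := 0) hK (fun x => ?_) (fun x => ?_) h0
  · rw [hasDerivAt_pi]
    intro i
    simpa using hy x i
  · rw [hasDerivAt_pi]
    intro i
    simpa using hz x i

/-- `Y` solves `Y' = (A₀ + X A₁) Y` modulo `X ^ m`. -/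
def IsSeriesSolution (m : ℕ) (A₀ A₁ : ℝ → Matrix N N ℂ) (Y : ℝ → N → ℂ⟦X⟧) : Prop :=
  ∀ x i, HasSeriesDerivAt m (fun y => Y y i) ((pencil (A₀ x) (A₁ x) *ᵥ Y x) i) x

/-- Once the lower coefficients vanish, coefficient j solves the homogeneous equation for A₀ alone,
so ordinary uniqueness applies inductively. Working modulo `X ^ m` matters because finite Jordan
chains only yield truncated solutions. -/
lemma IsSeriesSolution.eq_zero {m : ℕ} {A₀ A₁ : ℝ → Matrix N N ℂ} {T : ℝ}
    (h : IsPeriodicCoeff A₀ T) (hT : 0 < T) {Y : ℝ → N → ℂ⟦X⟧} (hY : IsSeriesSolution m A₀ A₁ Y)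
    (h0 : ∀ j < m, ∀ i, PowerSeries.coeff j (Y 0 i) = 0) :
    ∀ j < m, ∀ x i, PowerSeries.coeff j (Y x i) = 0 := by
  intro j
  induction j with
  | zero =>
    intro hj x i
    have := h.ode_unique hT (y := fun x i => PowerSeries.coeff 0 (Y x i)) (z := 0)
      (fun x i => by
        have := hY x i 0 hj
        rwa [coeff_zero_pencil_mulVec] at this)
      (fun x i => by simpa using hasDerivAt_const x (0 : ℂ)) (by
        ext1 i
        exact h0 0 hj i)
    exact congrFun (congrFun this x) i
  | succ j ih =>
    intro hj x i
    have ih := ih (by omega)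
    have := h.ode_unique hT (y := fun x i => PowerSeries.coeff (j + 1) (Y x i)) (z := 0)
      (fun x i => by
        have := hY x i (j + 1) hj
        rw [coeff_succ_pencil_mulVec] at this
        simp only [ih, ← Pi.zero_def, Matrix.mulVec_zero, Pi.zero_apply, add_zero] at this
        exact this)
      (fun x i => by simpa using hasDerivAt_const x (0 : ℂ)) (by
        ext1 i
        exact h0 (j + 1) hj i)
    exact congrFun (congrFun this x) i

/-- `Ψ` is the fundamental matrix of `Y' = A Y`. -/
def IsFundamentalMatrix [DecidableEq N] (A : ℝ → Matrix N N ℂ) (Ψ : ℝ → Matrix N N ℂ) : Prop :=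
  Ψ 0 = 1 ∧ ∀ x i j, HasDerivAt (fun y => Ψ y i j) ((A x * Ψ x) i j) x

lemma IsFundamentalMatrix.unique [DecidableEq N] {A : ℝ → Matrix N N ℂ} {T : ℝ}
    (h : IsPeriodicCoeff A T) (hT : 0 < T) {Ψ Φ : ℝ → Matrix N N ℂ}
    (hΨ : IsFundamentalMatrix A Ψ) (hΦ : IsFundamentalMatrix A Φ) : Ψ = Φ := by
  funext x
  ext i j
  have := h.ode_unique hT (y := fun x i => Ψ x i j) (z := fun x i => Φ x i j)
    (fun x i => by simpa [Matrix.mul_apply, Matrix.mulVec, dotProduct] using hΨ.2 x i j)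
    (fun x i => by simpa [Matrix.mul_apply, Matrix.mulVec, dotProduct] using hΦ.2 x i j)
    (by ext1 i; rw [hΨ.1, hΦ.1])
  exact congrFun (congrFun this x) i

/-- The Taylor expansion, in the parameter, of the fundamental matrix of `A₀ + t A₁`. -/
structure IsSeriesFundamental [DecidableEq N] (A₀ A₁ : ℝ → Matrix N N ℂ)
    (P : ℝ → Matrix N N ℂ⟦X⟧) : Prop where
  init : P 0 = 1
  hasDeriv : ∀ (m : ℕ) x i k, HasSeriesDerivAt m (fun y => P y i k) ((pencil (A₀ x) (A₁ x) * P x) i k) x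
  hasSum : ∀ᶠ t in 𝓝 (0 : ℂ), ∃ Ψ, IsFundamentalMatrix (fun x => A₀ x + t • A₁ x) Ψ ∧
    ∀ x i k, HasSum (fun j => t ^ j • PowerSeries.coeff j (P x i k)) (Ψ x i k)

theorem exists_isSeriesFundamental [DecidableEq N] {A₀ A₁ : ℝ → Matrix N N ℂ} {T : ℝ}
    (h₀ : IsPeriodicCoeff A₀ T) (h₁ : IsPeriodicCoeff A₁ T) (hT : 0 < T) :
    ∃ P, IsSeriesFundamental A₀ A₁ P := by
  obtain ⟨K₀, hK₀⟩ := h₀.exists_bound hT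
  obtain ⟨K₁, hK₁⟩ := h₁.exists_bound hT
  have H := fun k : N => exists_parametric_solution (continuous_matrixCLM.comp h₀.continuous)
    (continuous_matrixCLM.comp h₁.continuous) hK₀ hK₁ (Pi.single k 1)
  choose y hy0 hys hd0 hds r hr hY using H
  refine ⟨fun x => Matrix.of fun i k => PowerSeries.mk fun j => y k j x i, ?_, ?_, ?_⟩
  · ext i k j
    rcases j with _ | j
    · simp [hy0, Matrix.one_apply, Pi.single_apply, apply_ite]
    · by_cases hik : i = k <;> simp [hys, Matrix.one_apply, hik, PowerSeries.coeff_one]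
  · intro m x i k j _
    rcases j with _ | j
    · have h1 := coeff_zero_pencil_mulVec (A₀ x) (A₁ x)
        (fun i => PowerSeries.mk fun j => y k j x i) i
      have h2 := hasDerivAt_pi.1 (hd0 k x) i
      simp only [Function.comp_apply, matrixCLM_apply] at h2
      simp only [PowerSeries.coeff_mk] at h1
      rw [← h1] at h2
      simpa [Matrix.mul_apply, Matrix.mulVec, dotProduct] using h2
    · have h1 := coeff_succ_pencil_mulVec (A₀ x) (A₁ x)
        (fun i => PowerSeries.mk fun j => y k j x i) i j
      have h2 := hasDerivAt_pi.1 (hds k j x) i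
      simp only [Function.comp_apply, matrixCLM_apply, Pi.add_apply] at h2
      simp only [PowerSeries.coeff_mk] at h1
      rw [← h1] at h2
      simpa [Matrix.mul_apply, Matrix.mulVec, dotProduct] using h2
  · have : ∀ᶠ t in 𝓝 (0 : ℂ), ∀ k, ‖t‖ < r k := by
      rw [eventually_all]
      intro k
      have := Metric.ball_mem_nhds (0 : ℂ) (hr k)
      filter_upwards [this] with t ht
      simpa using ht
    filter_upwards [this] with t ht
    choose Y hY0 hYd hYs using fun k => hY k t (ht k)
    refine ⟨fun x => Matrix.of fun i k => Y k x i, ⟨?_, ?_⟩, ?_⟩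
    · ext i k
      simp [hY0, Matrix.one_apply, Pi.single_apply]
    · intro x i k
      have := hasDerivAt_pi.1 (hYd k x) i
      simp only [Function.comp_apply, matrixCLM_apply, Pi.add_apply, Pi.smul_apply] at this
      rw [← Pi.smul_apply, ← Pi.add_apply, ← Matrix.smul_mulVec, ← Matrix.add_mulVec] at this
      simpa only [Matrix.mul_apply, Matrix.mulVec, dotProduct, Matrix.of_apply] using this
    · intro x i k
      have := Pi.hasSum.1 (hYs k x) i
      simpa using this

namespace IsSeriesFundamental

variable [DecidableEq N] {A₀ A₁ : ℝ → Matrix N N ℂ} {P : ℝ → Matrix N N ℂ⟦X⟧} {T : ℝ}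

lemma mulVec_isSeriesSolution (hP : IsSeriesFundamental A₀ A₁ P) (φ : N → ℂ⟦X⟧) (m : ℕ) :
    IsSeriesSolution m A₀ A₁ (fun x => P x *ᵥ φ) := by
  intro x i
  have : HasSeriesDerivAt m (fun y => ∑ k, P y i k * φ k)
      (∑ k, (pencil (A₀ x) (A₁ x) * P x) i k * φ k) x :=
    HasSeriesDerivAt.sum _ fun k _ => (hP.hasDeriv m x i k).mul_const _
  rw [Matrix.mulVec_mulVec]
  exact this

/-- A solution modulo `X ^ m` is determined by its initial value. -/
lemma coeff_eq (hP : IsSeriesFundamental A₀ A₁ P) (h₀ : IsPeriodicCoeff A₀ T) (hT : 0 < T) {m : ℕ}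
    {Y : ℝ → N → ℂ⟦X⟧} (hY : IsSeriesSolution m A₀ A₁ Y) (φ : N → ℂ⟦X⟧)
    (h0 : ∀ j < m, ∀ i, PowerSeries.coeff j (Y 0 i) = PowerSeries.coeff j (φ i)) :
    ∀ j < m, ∀ x i, PowerSeries.coeff j (Y x i) = PowerSeries.coeff j ((P x *ᵥ φ) i) := by
  have hsub : IsSeriesSolution m A₀ A₁ (fun x => Y x - P x *ᵥ φ) := by
    intro x i
    have := (hY x i).sub (hP.mulVec_isSeriesSolution φ m x i)
    rw [Matrix.mulVec_sub]
    exact this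
  intro j hj x i
  have := hsub.eq_zero h₀ hT (by
    intro j hj i
    simp [hP.init, h0 j hj i]) j hj x i
  simpa [sub_eq_zero] using this

/-- Floquet relation. -/
lemma add_period (hP : IsSeriesFundamental A₀ A₁ P) (h₀ : IsPeriodicCoeff A₀ T)
    (h₁ : IsPeriodicCoeff A₁ T) (hT : 0 < T) (x : ℝ) : P (x + T) = P x * P T := by
  ext i k j
  -- By periodicity the translated column solves the same system; truncation at order j + 1 is just
  -- enough to compare coefficient j.
  have hY : IsSeriesSolution (j + 1) A₀ A₁ (fun x i => P (x + T) i k) := by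
    intro x i l hl
    have := (hP.hasDeriv (j + 1) (x + T) i k l hl).comp_add_const x T
    rw [h₀.periodic, h₁.periodic] at this
    simpa [Matrix.mul_apply, Matrix.mulVec, dotProduct] using this
  have := hP.coeff_eq h₀ hT hY (fun i => P T i k) (by simp) j (by omega) x i
  simpa [Matrix.mul_apply, Matrix.mulVec, dotProduct] using this

end IsSeriesFundamental

end PeriodicEvans

namespace PeriodicEvans

/-! ### Regularity of matrix functions -/

section MatrixCalculus

variable {𝕜 : Type*} [RCLike 𝕜] {N : Type*} [Fintype N]

lemma contDiff_matrix_mul {k : ℕ∞} {M M' : ℝ → Matrix N N 𝕜}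
    (hM : ∀ i j, ContDiff ℝ k fun x => M x i j) (hM' : ∀ i j, ContDiff ℝ k fun x => M' x i j)
    (i j : N) : ContDiff ℝ k fun x => (M x * M' x) i j := by
  simp only [Matrix.mul_apply]
  exact ContDiff.sum fun l _ => (hM _ _).mul (hM' _ _)

lemma contDiff_mulVec {k : ℕ∞} {M : ℝ → Matrix N N 𝕜} {v : ℝ → N → 𝕜}
    (hM : ∀ i j, ContDiff ℝ k fun x => M x i j) (hv : ContDiff ℝ k v) :
    ContDiff ℝ k fun x => M x *ᵥ v x := by
  rw [contDiff_pi] at hv ⊢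
  intro i
  simp only [Matrix.mulVec, dotProduct]
  exact ContDiff.sum fun l _ => (hM _ _).mul (hv _)

lemma hasDerivAt_mulVec {M : ℝ → Matrix N N 𝕜} {M' : Matrix N N 𝕜} {v : ℝ → N → 𝕜} {v' : N → 𝕜}
    {x : ℝ} (hM : ∀ i j, HasDerivAt (fun x => M x i j) (M' i j) x) (hv : HasDerivAt v v' x) :
    HasDerivAt (fun x => M x *ᵥ v x) (M' *ᵥ v x + M x *ᵥ v') x := by
  rw [hasDerivAt_pi] at hv ⊢
  intro i
  simp only [Matrix.mulVec, dotProduct, Pi.add_apply, ← Finset.sum_add_distrib]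
  exact HasDerivAt.fun_sum fun l _ => (hM i l).mul (hv l)

variable [DecidableEq N]

lemma contDiff_matrix_det {k : ℕ∞} {M : ℝ → Matrix N N 𝕜}
    (hM : ∀ i j, ContDiff ℝ k fun x => M x i j) : ContDiff ℝ k fun x => (M x).det := by
  simp only [Matrix.det_apply']
  refine ContDiff.sum fun σ _ => contDiff_const.mul ?_
  exact contDiff_prod fun i _ => hM _ _

/-- By Cramer's rule the entries are quotients of determinants, that is, of polynomials in the
entries of M. -/
lemma contDiff_matrix_inv {k : ℕ∞} {M : ℝ → Matrix N N 𝕜}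
    (hM : ∀ i j, ContDiff ℝ k fun x => M x i j) (hdet : ∀ x, (M x).det ≠ 0) (i j : N) :
    ContDiff ℝ k fun x => (M x)⁻¹ i j := by
  simp only [Matrix.inv_def, Ring.inverse_eq_inv', Matrix.smul_apply, smul_eq_mul,
    Matrix.adjugate_apply]
  refine ((contDiff_matrix_det hM).inv hdet).mul (contDiff_matrix_det fun a b => ?_)
  by_cases h : a = j
  · subst h
    simpa using contDiff_const
  · simpa [Matrix.updateRow_ne h] using hM a b

end MatrixCalculus

section Complexify

variable {n : ℕ}

lemma complexify_mul (M M' : Matrix (Fin n) (Fin n) ℝ) :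
    complexify (M * M') = complexify M * complexify M' :=
  Matrix.map_mul (f := Complex.ofRealHom)

lemma complexify_sub (M M' : Matrix (Fin n) (Fin n) ℝ) :
    complexify (M - M') = complexify M - complexify M' := by
  ext i j
  simp [complexify]

lemma complexify_one : complexify (1 : Matrix (Fin n) (Fin n) ℝ) = 1 := by
  ext i j
  simp [complexify, Matrix.one_apply, apply_ite]

lemma hasDerivAt_complexify {M : ℝ → Matrix (Fin n) (Fin n) ℝ}
    (hM : ∀ i j, ContDiff ℝ 1 fun x => M x i j) (x : ℝ) (i j : Fin n) :
    HasDerivAt (fun x => complexify (M x) i j) (complexify (matrixDeriv M x) i j) x := by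
  have := ((hM i j).differentiable one_ne_zero x).hasDerivAt.ofReal_comp
  simpa [complexify, matrixDeriv] using this

lemma continuous_complexify {M : ℝ → Matrix (Fin n) (Fin n) ℝ}
    (hM : ∀ i j, Continuous fun x => M x i j) : Continuous fun x => complexify (M x) := by
  refine continuous_matrix fun i j => ?_
  exact Complex.continuous_ofReal.comp (hM i j)

lemma isUnit_det_of_spectrum {M : Matrix (Fin n) (Fin n) ℝ}
    (h : ∀ μ ∈ spectrum ℂ (complexify M), 0 < μ.re) : IsUnit M.det := by
  have h0 : (0 : ℂ) ∉ spectrum ℂ (complexify M) := fun h0 => by simpa using h 0 h0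
  rw [spectrum.zero_notMem_iff, Matrix.isUnit_iff_isUnit_det] at h0
  have : (complexify M).det = (M.det : ℂ) := (RingHom.map_det Complex.ofRealHom _).symm
  rw [this] at h0
  simpa using h0

end Complexify

/-- The coefficients of a linearized operator: `C¹`, `T`-periodic, and `B` has spectrum in the open
right half-plane. -/
structure ParabolicCoeffs {n : ℕ} (B A : ℝ → Matrix (Fin n) (Fin n) ℝ) (T : ℝ) : Prop where
  pos : 0 < T
  contDiff_B : ∀ i j, ContDiff ℝ 1 fun x => B x i j
  contDiff_A : ∀ i j, ContDiff ℝ 1 fun x => A x i j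
  periodic_B : Function.Periodic B T
  periodic_A : Function.Periodic A T
  spectrum_B : ∀ x, ∀ μ ∈ spectrum ℂ (complexify (B x)), 0 < μ.re

/-- The derivative of `evansCoeff` with respect to `λ`. -/
noncomputable def evansCoeffDeriv {n : ℕ} (B : ℝ → Matrix (Fin n) (Fin n) ℝ) (x : ℝ) :
    Matrix (Fin n ⊕ Fin n) (Fin n ⊕ Fin n) ℂ :=
  Matrix.fromBlocks 0 0 (complexify ((B x)⁻¹)) 0

namespace ParabolicCoeffs

variable {n : ℕ} {B A : ℝ → Matrix (Fin n) (Fin n) ℝ} {T : ℝ}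

lemma isUnit_det (h : ParabolicCoeffs B A T) (x : ℝ) : IsUnit (B x).det :=
  isUnit_det_of_spectrum (h.spectrum_B x)

lemma inv_mul (h : ParabolicCoeffs B A T) (x : ℝ) :
    complexify ((B x)⁻¹) * complexify (B x) = 1 := by
  rw [← complexify_mul, Matrix.nonsing_inv_mul _ (h.isUnit_det x), complexify_one]

lemma mul_inv (h : ParabolicCoeffs B A T) (x : ℝ) :
    complexify (B x) * complexify ((B x)⁻¹) = 1 := by
  rw [← complexify_mul, Matrix.mul_nonsing_inv _ (h.isUnit_det x), complexify_one]

lemma contDiff_inv (h : ParabolicCoeffs B A T) (i j : Fin n) :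
    ContDiff ℝ 1 fun x => (B x)⁻¹ i j :=
  contDiff_matrix_inv (k := 1) h.contDiff_B (fun x => (h.isUnit_det x).ne_zero) i j

lemma continuous_inv (h : ParabolicCoeffs B A T) : Continuous fun x => complexify ((B x)⁻¹) :=
  continuous_complexify fun i j => (h.contDiff_inv i j).continuous

lemma continuous_B (h : ParabolicCoeffs B A T) : Continuous fun x => complexify (B x) :=
  continuous_complexify fun i j => (h.contDiff_B i j).continuous

lemma continuous_A (h : ParabolicCoeffs B A T) : Continuous fun x => complexify (A x) :=
  continuous_complexify fun i j => (h.contDiff_A i j).continuous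

lemma continuous_matrixDeriv_B (h : ParabolicCoeffs B A T) :
    Continuous fun x => complexify (matrixDeriv B x) :=
  continuous_complexify fun i j => (h.contDiff_B i j).continuous_deriv le_rfl

lemma continuous_matrixDeriv_A (h : ParabolicCoeffs B A T) :
    Continuous fun x => complexify (matrixDeriv A x) :=
  continuous_complexify fun i j => (h.contDiff_A i j).continuous_deriv le_rfl

lemma _root_.PeriodicEvans.matrixDeriv_periodic {M : ℝ → Matrix (Fin n) (Fin n) ℝ}
    (hM : Function.Periodic M T) : Function.Periodic (matrixDeriv M) T := by
  intro x
  ext i j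
  simp only [matrixDeriv, Matrix.of_apply]
  rw [← deriv_comp_add_const]
  simp only [hM _]

lemma isPeriodicCoeff_evansCoeff (h : ParabolicCoeffs B A T) (lam : ℂ) :
    IsPeriodicCoeff (evansCoeff B A lam) T where
  continuous := by
    unfold evansCoeff
    refine Continuous.matrix_fromBlocks continuous_const continuous_const ?_ ?_
    · exact h.continuous_inv.mul (continuous_const.add h.continuous_matrixDeriv_A)
    · simp only [complexify_mul, complexify_sub]
      exact h.continuous_inv.mul (h.continuous_A.sub h.continuous_matrixDeriv_B)
  periodic x := by
    simp only [evansCoeff, h.periodic_B x, h.periodic_A x, matrixDeriv_periodic h.periodic_A x,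
      matrixDeriv_periodic h.periodic_B x]

lemma isPeriodicCoeff_evansCoeffDeriv (h : ParabolicCoeffs B A T) :
    IsPeriodicCoeff (evansCoeffDeriv B) T where
  continuous := by
    unfold evansCoeffDeriv
    exact Continuous.matrix_fromBlocks continuous_const continuous_const h.continuous_inv
      continuous_const
  periodic x := by
    simp only [evansCoeffDeriv, h.periodic_B x]

end ParabolicCoeffs

/-! ### The Evans function: Taylor series, holomorphy, reality -/

section Evans

variable {n : ℕ} {B A : ℝ → Matrix (Fin n) (Fin n) ℝ} {T : ℝ}

/-- The system is affine in the spectral parameter, so the power series construction applies at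
every base point λ. -/
lemma evansCoeff_add (lam t : ℂ) (x : ℝ) :
    evansCoeff B A (lam + t) x = evansCoeff B A lam x + t • evansCoeffDeriv B x := by
  simp only [evansCoeff, evansCoeffDeriv, Matrix.fromBlocks_smul, Matrix.fromBlocks_add]
  congr 1
  · simp
  · simp
  · simp only [add_smul, mul_add, Matrix.mul_smul, mul_one]
    abel
  · simp

/-- `monodromy` is defined by a choice; uniqueness of the fundamental solution allows any convenient
one to be used instead. -/
lemma monodromy_eq (h : ParabolicCoeffs B A T) {lam : ℂ}
    {Ψ : ℝ → Matrix (Fin n ⊕ Fin n) (Fin n ⊕ Fin n) ℂ}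
    (hΨ : IsFundamentalMatrix (evansCoeff B A lam) Ψ) : monodromy B A T lam = Ψ T := by
  have h1 : IsFundamentalSolution B A lam Ψ := hΨ
  have h2 : IsFundamentalMatrix (evansCoeff B A lam)
      (Classical.epsilon (IsFundamentalSolution B A lam)) :=
    Classical.epsilon_spec (p := IsFundamentalSolution B A lam) ⟨Ψ, h1⟩
  rw [monodromy, h2.unique (h.isPeriodicCoeff_evansCoeff lam) h.pos hΨ]

lemma evans_zero (lam : ℂ) : evans B A T 0 lam = (monodromy B A T lam - 1).det := by
  simp [evans]

/-- The Taylor series of the Evans function is the determinant of the Taylor series of the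
monodromy matrix minus the identity. -/
lemma evans_hasSeriesAt (h : ParabolicCoeffs B A T) {lam : ℂ}
    {P : ℝ → Matrix (Fin n ⊕ Fin n) (Fin n ⊕ Fin n) (PowerSeries ℂ)}
    (hP : IsSeriesFundamental (evansCoeff B A lam) (evansCoeffDeriv B) P) :
    HasSeriesAt (evans B A T 0) (P T - 1).det lam := by
  have : evans B A T 0 = fun z => (monodromy B A T z - 1).det := funext evans_zero
  rw [this]
  refine HasSeriesAt.det fun i k => ?_
  have h1 : HasSeriesAt (fun z => monodromy B A T z i k) (P T i k) lam := by
    filter_upwards [hP.hasSum] with t ⟨Ψ, hΨ, hs⟩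
    have e : (fun x => evansCoeff B A lam x + t • evansCoeffDeriv B x)
        = evansCoeff B A (lam + t) := by
      funext x
      rw [evansCoeff_add]
    rw [e] at hΨ
    rw [monodromy_eq h hΨ]
    exact hs T i k
  have h2 := h1.add (hasSeriesAt_const (z₀ := lam) (-(1 : Matrix _ _ ℂ) i k))
  have e : (P T - 1) i k = P T i k + PowerSeries.C (-(1 : Matrix _ _ ℂ) i k) := by
    by_cases hik : i = k <;> simp [Matrix.one_apply, hik, sub_eq_add_neg]
  rw [e]
  simpa [sub_eq_add_neg] using h2

lemma exists_evans_series (h : ParabolicCoeffs B A T) (lam : ℂ) :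
    ∃ P, IsSeriesFundamental (evansCoeff B A lam) (evansCoeffDeriv B) P :=
  exists_isSeriesFundamental (h.isPeriodicCoeff_evansCoeff lam) h.isPeriodicCoeff_evansCoeffDeriv
    h.pos

lemma differentiable_evans (h : ParabolicCoeffs B A T) : Differentiable ℂ (evans B A T 0) := by
  intro lam
  obtain ⟨P, hP⟩ := exists_evans_series h lam
  exact (evans_hasSeriesAt h hP).hasFPowerSeriesAt.analyticAt.differentiableAt

lemma exists_fundamentalMatrix (h : ParabolicCoeffs B A T) (lam : ℂ) :
    ∃ Ψ, IsFundamentalMatrix (evansCoeff B A lam) Ψ := by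
  obtain ⟨P, hP⟩ := exists_evans_series h lam
  obtain ⟨Ψ, hΨ, -⟩ := hP.hasSum.self_of_nhds
  refine ⟨Ψ, ?_⟩
  simpa using hΨ

open ComplexConjugate in
-- Since B and A are real, the complex conjugate of the fundamental matrix at λ is the fundamental
-- matrix at the conjugate of λ.
lemma evans_conj (h : ParabolicCoeffs B A T) (lam : ℂ) :
    evans B A T 0 (conj lam) = conj (evans B A T 0 lam) := by
  obtain ⟨Ψ, hΨ⟩ := exists_fundamentalMatrix h lam
  have hcoef : ∀ x, (evansCoeff B A lam x).map conj = evansCoeff B A (conj lam) x := by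
    intro x
    have hr : ∀ M : Matrix (Fin n) (Fin n) ℝ, (complexify M).map conj = complexify M := by
      intro M
      ext i j
      simp [complexify]
    rw [evansCoeff, Matrix.fromBlocks_map, evansCoeff]
    congr 1
    · ext i j; simp
    · ext i j; by_cases hij : i = j <;> simp [hij, Matrix.one_apply]
    · rw [Matrix.map_mul, hr]
      congr 1
      ext i j
      by_cases hij : i = j <;> simp [hij, complexify]
    · exact hr _
  have hΨ' : IsFundamentalMatrix (evansCoeff B A (conj lam)) (fun x => (Ψ x).map conj) := by
    refine ⟨?_, fun x i j => ?_⟩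
    · simp [hΨ.1]
    · have := (hΨ.2 x i j).star
      rw [← hcoef, ← Matrix.map_mul]
      exact this
  rw [evans_zero, evans_zero, monodromy_eq h hΨ', monodromy_eq h hΨ, RingHom.map_det]
  congr 1
  ext i j
  by_cases hij : i = j <;> simp [hij]

end Evans

end PeriodicEvans

namespace PeriodicEvans

open PowerSeries

variable {n : ℕ} {B A : ℝ → Matrix (Fin n) (Fin n) ℝ} {T : ℝ}

/-! ### The eigenvalue equation as a first-order system -/

lemma linOp_eq (h : ParabolicCoeffs B A T) {v v' : ℝ → Fin n → ℂ} (hv : ∀ x, HasDerivAt v (v' x) x)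
    {v'' : Fin n → ℂ} {x : ℝ} (hv' : HasDerivAt v' v'' x) :
    linOp B A v x = (complexify (matrixDeriv B x) *ᵥ v' x + complexify (B x) *ᵥ v'')
      - (complexify (matrixDeriv A x) *ᵥ v x + complexify (A x) *ᵥ v' x) := by
  have hd : deriv v = v' := funext fun y => (hv y).deriv
  rw [linOp, hd, (hasDerivAt_mulVec (hasDerivAt_complexify h.contDiff_B x) hv').deriv,
    (hasDerivAt_mulVec (hasDerivAt_complexify h.contDiff_A x) (hv x)).deriv]

/-- The second component of the first-order system. -/
noncomputable def systemRHS (B A : ℝ → Matrix (Fin n) (Fin n) ℝ) (lam : ℂ) (x : ℝ)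
    (v v' : Fin n → ℂ) : Fin n → ℂ :=
  complexify ((B x)⁻¹) *ᵥ (lam • v + complexify (matrixDeriv A x) *ᵥ v
    + (complexify (A x) *ᵥ v' - complexify (matrixDeriv B x) *ᵥ v'))

lemma evansCoeff_mulVec (lam : ℂ) (x : ℝ) (w : Fin n ⊕ Fin n → ℂ) :
    evansCoeff B A lam x *ᵥ w
      = Sum.elim (w ∘ Sum.inr) (systemRHS B A lam x (w ∘ Sum.inl) (w ∘ Sum.inr)) := by
  rw [evansCoeff, Matrix.fromBlocks_mulVec, systemRHS]
  congr 1
  · simp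
  · rw [complexify_mul, complexify_sub, ← Matrix.mulVec_mulVec, ← Matrix.mulVec_mulVec,
      ← Matrix.mulVec_add, Matrix.add_mulVec, Matrix.smul_mulVec, Matrix.one_mulVec,
      Matrix.sub_mulVec]

lemma evansCoeffDeriv_mulVec (x : ℝ) (w : Fin n ⊕ Fin n → ℂ) :
    evansCoeffDeriv B x *ᵥ w = Sum.elim (0 : Fin n → ℂ) (complexify ((B x)⁻¹) *ᵥ (w ∘ Sum.inl)) := by
  rw [evansCoeffDeriv, Matrix.fromBlocks_mulVec]
  simp

lemma linOp_sub_eq_of_system (h : ParabolicCoeffs B A T) {lam : ℂ} {v v' g : ℝ → Fin n → ℂ}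
    (hv : ∀ x, HasDerivAt v (v' x) x)
    (hv' : ∀ x, HasDerivAt v' (systemRHS B A lam x (v x) (v' x) + complexify ((B x)⁻¹) *ᵥ g x) x) :
    linOp B A v - lam • v = g := by
  funext x
  rw [Pi.sub_apply, linOp_eq h hv (hv' x), systemRHS, ← Matrix.mulVec_add, Matrix.mulVec_mulVec,
    h.mul_inv, Matrix.one_mulVec, Pi.smul_apply]
  abel

lemma hasDerivAt_of_linOp_sub_eq (h : ParabolicCoeffs B A T) {lam : ℂ} {v g : ℝ → Fin n → ℂ}
    (hv : ContDiff ℝ 2 v) (hg : linOp B A v - lam • v = g) (x : ℝ) :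
    HasDerivAt v (deriv v x) x ∧ HasDerivAt (deriv v)
      (systemRHS B A lam x (v x) (deriv v x) + complexify ((B x)⁻¹) *ᵥ g x) x := by
  have hv1 : ∀ x, HasDerivAt v (deriv v x) x := fun x =>
    (hv.differentiable two_ne_zero x).hasDerivAt
  have hv2 : ∀ x, HasDerivAt (deriv v) (deriv (deriv v) x) x := by
    have : ContDiff ℝ 1 (deriv v) := (contDiff_succ_iff_deriv (n := 1).1 hv).2.2
    exact fun x => (this.differentiable one_ne_zero x).hasDerivAt
  refine ⟨hv1 x, ?_⟩
  have e : complexify (B x) *ᵥ deriv (deriv v) x = (lam • v x + complexify (matrixDeriv A x) *ᵥ v x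
      + (complexify (A x) *ᵥ deriv v x - complexify (matrixDeriv B x) *ᵥ deriv v x)) + g x := by
    rw [← hg, Pi.sub_apply, linOp_eq h hv1 (hv2 x), Pi.smul_apply]
    abel
  have e2 := congrArg (fun w => complexify ((B x)⁻¹) *ᵥ w) e
  simp only [Matrix.mulVec_mulVec, h.inv_mul, Matrix.one_mulVec] at e2
  rw [Matrix.mulVec_add] at e2
  rw [systemRHS, ← e2]
  exact hv2 x

lemma contDiff_two_of_system (h : ParabolicCoeffs B A T) {lam : ℂ} {v v' g : ℝ → Fin n → ℂ}
    (hv : ∀ x, HasDerivAt v (v' x) x) (hg : Continuous g)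
    (hv' : ∀ x, HasDerivAt v' (systemRHS B A lam x (v x) (v' x) + complexify ((B x)⁻¹) *ᵥ g x) x) :
    ContDiff ℝ 2 v := by
  have hd : deriv v = v' := funext fun y => (hv y).deriv
  have hd' := funext fun y => (hv' y).deriv
  have hvc : Continuous v := continuous_iff_continuousAt.2 fun x => (hv x).continuousAt
  have hvc' : Continuous v' := continuous_iff_continuousAt.2 fun x => (hv' x).continuousAt
  have h1 : ContDiff ℝ 1 v' := by
    rw [contDiff_one_iff_deriv]
    refine ⟨fun x => (hv' x).differentiableAt, ?_⟩
    rw [hd']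
    unfold systemRHS
    exact (h.continuous_inv.matrix_mulVec (((hvc.const_smul lam).add
      (h.continuous_matrixDeriv_A.matrix_mulVec hvc)).add ((h.continuous_A.matrix_mulVec hvc').sub
      (h.continuous_matrixDeriv_B.matrix_mulVec hvc')))).add (h.continuous_inv.matrix_mulVec hg)
  exact (contDiff_succ_iff_deriv (n := 1)).2
    ⟨fun x => (hv x).differentiableAt, by simp, by rwa [hd]⟩

/-! ### Chains of generalized eigenfunctions and series solutions -/

/-- The `j`-th coefficient of the first component. -/
noncomputable def topCoeff (j : ℕ) (Y : ℝ → Fin n ⊕ Fin n → ℂ⟦X⟧) : ℝ → Fin n → ℂ :=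
  fun x i => PowerSeries.coeff j (Y x (Sum.inl i))

/-- The `j`-th coefficient of the second component. -/
noncomputable def botCoeff (j : ℕ) (Y : ℝ → Fin n ⊕ Fin n → ℂ⟦X⟧) : ℝ → Fin n → ℂ :=
  fun x i => PowerSeries.coeff j (Y x (Sum.inr i))

/-- The right-hand side of the `j`-th equation of a chain. -/
noncomputable def prevCoeff (Y : ℝ → Fin n ⊕ Fin n → ℂ⟦X⟧) : ℕ → ℝ → Fin n → ℂ
  | 0 => 0
  | j + 1 => topCoeff j Y

lemma coeff_pencil_evans (lam : ℂ) (Y : ℝ → Fin n ⊕ Fin n → ℂ⟦X⟧) (x : ℝ) (j : ℕ) (i : Fin n) :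
    PowerSeries.coeff j ((pencil (evansCoeff B A lam x) (evansCoeffDeriv B x) *ᵥ Y x) (Sum.inl i))
        = botCoeff j Y x i ∧
    PowerSeries.coeff j ((pencil (evansCoeff B A lam x) (evansCoeffDeriv B x) *ᵥ Y x) (Sum.inr i))
        = (systemRHS B A lam x (topCoeff j Y x) (botCoeff j Y x)
          + complexify ((B x)⁻¹) *ᵥ prevCoeff Y j x) i := by
  rcases j with _ | j
  · rw [coeff_zero_pencil_mulVec, coeff_zero_pencil_mulVec, evansCoeff_mulVec]
    refine ⟨rfl, ?_⟩
    simp only [prevCoeff, Pi.zero_apply, Matrix.mulVec_zero, add_zero]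
    rfl
  · rw [coeff_succ_pencil_mulVec, coeff_succ_pencil_mulVec, evansCoeff_mulVec,
      evansCoeffDeriv_mulVec]
    refine ⟨by simp [botCoeff], rfl⟩

/-- Comparing powers of X turns the system at λ + X into the chain equations (L - λ) v_j = v_{j-1}
with v_{-1} = 0, in first-order form. This is the bridge between Taylor coefficients and generalized
eigenfunctions. -/
lemma isSeriesSolution_evans_iff {m : ℕ} {lam : ℂ} {Y : ℝ → Fin n ⊕ Fin n → ℂ⟦X⟧} :
    IsSeriesSolution m (evansCoeff B A lam) (evansCoeffDeriv B) Y ↔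
      ∀ j < m, ∀ x, HasDerivAt (topCoeff j Y) (botCoeff j Y x) x ∧ HasDerivAt (botCoeff j Y)
        (systemRHS B A lam x (topCoeff j Y x) (botCoeff j Y x)
          + complexify ((B x)⁻¹) *ᵥ prevCoeff Y j x) x := by
  simp only [hasDerivAt_pi]
  constructor
  · intro hY j hj x
    refine ⟨fun i => ?_, fun i => ?_⟩
    · rw [← (coeff_pencil_evans lam Y x j i).1]
      exact hY x (Sum.inl i) j hj
    · rw [← (coeff_pencil_evans lam Y x j i).2]
      exact hY x (Sum.inr i) j hj
  · rintro hY x (i | i) j hj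
    · rw [(coeff_pencil_evans lam Y x j i).1]
      exact (hY j hj x).1 i
    · rw [(coeff_pencil_evans lam Y x j i).2]
      exact (hY j hj x).2 i

/-- The coefficients of a series solution are `C²` and form a chain. -/
lemma IsSeriesSolution.chain (h : ParabolicCoeffs B A T) {m : ℕ} {lam : ℂ}
    {Y : ℝ → Fin n ⊕ Fin n → ℂ⟦X⟧}
    (hY : IsSeriesSolution m (evansCoeff B A lam) (evansCoeffDeriv B) Y) {j : ℕ} (hj : j < m) :
    ContDiff ℝ 2 (topCoeff j Y) ∧
      linOp B A (topCoeff j Y) - lam • topCoeff j Y = prevCoeff Y j := by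
  rw [isSeriesSolution_evans_iff] at hY
  have hprev : Continuous (prevCoeff Y j) := by
    rcases j with _ | j
    · exact continuous_zero
    · exact continuous_iff_continuousAt.2 fun x => (hY j (by omega) x).1.continuousAt
  exact ⟨contDiff_two_of_system h (fun x => (hY j hj x).1) hprev fun x => (hY j hj x).2,
    linOp_sub_eq_of_system h (fun x => (hY j hj x).1) fun x => (hY j hj x).2⟩

/-- Periodic series solutions yield generalized eigenfunctions. -/
lemma IsSeriesSolution.topCoeff_mem_genKernel (h : ParabolicCoeffs B A T) {m : ℕ} {lam : ℂ}
    {Y : ℝ → Fin n ⊕ Fin n → ℂ⟦X⟧}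
    (hY : IsSeriesSolution m (evansCoeff B A lam) (evansCoeffDeriv B) Y)
    (hper : ∀ j < m, Function.Periodic (topCoeff j Y) T) :
    ∀ j < m, topCoeff j Y ∈ genKernel B A T lam (j + 1) := by
  intro j
  induction j with
  | zero =>
    intro hj
    obtain ⟨h1, h2⟩ := hY.chain h hj
    exact ⟨⟨h1, hper 0 hj⟩, h2⟩
  | succ j ih =>
    intro hj
    obtain ⟨h1, h2⟩ := hY.chain h hj
    refine ⟨⟨h1, hper _ hj⟩, ?_⟩
    rw [h2]
    exact ih (by omega)

lemma periodic_deriv {v : ℝ → Fin n → ℂ} (hv : Function.Periodic v T) :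
    Function.Periodic (deriv v) T := by
  intro x
  rw [← deriv_comp_add_const]
  simp only [hv _]

lemma genKernel_mono_succ (lam : ℂ) (m : ℕ) :
    genKernel B A T lam m ⊆ genKernel B A T lam (m + 1) := by
  induction m with
  | zero =>
    rintro v rfl
    refine ⟨⟨contDiff_zero_fun, fun x => rfl⟩, ?_⟩
    have : linOp B A (0 : ℝ → Fin n → ℂ) = 0 := by
      funext x
      have h0 : deriv (0 : ℝ → Fin n → ℂ) = 0 := by
        funext y
        exact deriv_const y 0
      have h1 : deriv (fun _ : ℝ => (0 : Fin n → ℂ)) x = 0 := deriv_const x 0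
      simp only [linOp, h0, Pi.zero_apply, Matrix.mulVec_zero, h1, sub_zero]
    rw [this, smul_zero, sub_zero]
    rfl
  | succ m ih =>
    rintro v ⟨h1, h2⟩
    exact ⟨h1, ih h2⟩

lemma genKernel_mono (lam : ℂ) : Monotone (genKernel B A T lam) :=
  monotone_nat_of_le_succ fun m => genKernel_mono_succ lam m

/-- Iterates of `L - λ`. -/
noncomputable def shiftIterate (B A : ℝ → Matrix (Fin n) (Fin n) ℝ) (lam : ℂ)
    (v : ℝ → Fin n → ℂ) (k : ℕ) : ℝ → Fin n → ℂ :=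
  (fun w => linOp B A w - lam • w)^[k] v

lemma shiftIterate_mem {lam : ℂ} {v : ℝ → Fin n → ℂ} {m : ℕ} (hv : v ∈ genKernel B A T lam m) :
    ∀ k ≤ m, shiftIterate B A lam v k ∈ genKernel B A T lam (m - k) := by
  intro k
  induction k with
  | zero => intro _; exact hv
  | succ k ih =>
    intro hk
    have := ih (by omega)
    obtain ⟨l, hl⟩ : ∃ l, m - k = l + 1 := ⟨m - k - 1, by omega⟩
    rw [hl] at this
    rw [show m - (k + 1) = l by omega, shiftIterate, Function.iterate_succ_apply']
    exact this.2

/-- A generalized eigenfunction is the top coefficient of a periodic series solution. -/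
lemma exists_series_of_mem_genKernel (h : ParabolicCoeffs B A T) {lam : ℂ} {v : ℝ → Fin n → ℂ}
    {m : ℕ} (hv : v ∈ genKernel B A T lam (m + 1)) :
    ∃ Y : ℝ → Fin n ⊕ Fin n → ℂ⟦X⟧,
      IsSeriesSolution (m + 1) (evansCoeff B A lam) (evansCoeffDeriv B) Y ∧
      Function.Periodic Y T ∧ topCoeff m Y = v := by
  -- The chain ends in v: c_j = (L - λ)^(m-j) v. Coefficients beyond m are set to zero, which is
  -- harmless since the system is only required modulo X^(m+1).
  set c : ℕ → ℝ → Fin n → ℂ := fun j =>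
    if j ≤ m then shiftIterate B A lam v (m - j) else 0 with hc
  set Y : ℝ → Fin n ⊕ Fin n → ℂ⟦X⟧ := fun x => Sum.elim
    (fun i => PowerSeries.mk fun j => c j x i) (fun i => PowerSeries.mk fun j => deriv (c j) x i)
    with hY
  have htop : ∀ j, topCoeff j Y = c j := by
    intro j; funext x i; simp [topCoeff, hY]
  have hbot : ∀ j, botCoeff j Y = deriv (c j) := by
    intro j; funext x i; simp [botCoeff, hY]
  have hmem : ∀ j ≤ m, c j ∈ genKernel B A T lam (j + 1) := by
    intro j hj
    have := shiftIterate_mem hv (m - j) (by omega)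
    rw [show m + 1 - (m - j) = j + 1 by omega] at this
    simpa [hc, hj] using this
  have hop : ∀ j ≤ m, linOp B A (c j) - lam • c j = prevCoeff Y j := by
    intro j hj
    rcases j with _ | j
    · exact (hmem 0 hj).2
    · rw [prevCoeff, htop]
      simp only [hc, hj, show j ≤ m by omega, if_true]
      rw [show m - j = (m - (j + 1)) + 1 by omega]
      conv_rhs => rw [shiftIterate, Function.iterate_succ_apply']
      rfl
  refine ⟨Y, ?_, ?_, ?_⟩
  · rw [isSeriesSolution_evans_iff]
    intro j hj x
    rw [htop, hbot]
    exact hasDerivAt_of_linOp_sub_eq h (hmem j (by omega)).1.1 (hop j (by omega)) x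
  · have hp : ∀ j, Function.Periodic (c j) T := by
      intro j
      by_cases hj : j ≤ m
      · exact (hmem j hj).1.2
      · intro x
        simp [hc, hj]
    intro x
    funext i
    rcases i with i | i
    · simp only [hY, Sum.elim_inl, (hp _) x]
    · simp only [hY, Sum.elim_inr, (periodic_deriv (hp _)) x]
  · rw [htop]
    simp [hc, shiftIterate]

/-! ### Algebraic multiplicity and order of the Evans function -/

lemma coeff_eq_zero_iff_exists {N : Type*} (m : ℕ) (φ : N → ℂ⟦X⟧) :
    (∀ j < m, ∀ i, PowerSeries.coeff j (φ i) = 0) ↔ ∃ z : N → ℂ⟦X⟧, φ = (X : ℂ⟦X⟧) ^ m • z := by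
  constructor
  · intro hφ
    have : ∀ i, ∃ z, φ i = X ^ m * z := fun i =>
      PowerSeries.X_pow_dvd_iff.2 fun j hj => hφ j hj i
    choose z hz using this
    exact ⟨z, funext hz⟩
  · rintro ⟨z, rfl⟩ j hj i
    simp [PowerSeries.coeff_X_pow_mul', not_le.2 hj]

section Multiplicity

variable {lam : ℂ} {P : ℝ → Matrix (Fin n ⊕ Fin n) (Fin n ⊕ Fin n) ℂ⟦X⟧} {d : ℕ} {u : ℂ⟦X⟧}

/-- `X ^ d` times the inverse of `P T - 1`. -/
noncomputable def scaledInverse (P : ℝ → Matrix (Fin n ⊕ Fin n) (Fin n ⊕ Fin n) ℂ⟦X⟧) (T : ℝ)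
    (u : ℂ⟦X⟧) : Matrix (Fin n ⊕ Fin n) (Fin n ⊕ Fin n) ℂ⟦X⟧ :=
  Ring.inverse u • (P T - 1).adjugate

lemma mul_scaledInverse (hu : IsUnit u) (hdet : (P T - 1).det = X ^ d * u) :
    (P T - 1) * scaledInverse P T u = (X : ℂ⟦X⟧) ^ d • 1 := by
  rw [scaledInverse, Matrix.mul_smul, Matrix.mul_adjugate, hdet, smul_smul, mul_comm, mul_assoc,
    Ring.mul_inverse_cancel _ hu, mul_one]

/-- The map sending `y` to the residue of `P (P T - 1)⁻¹ y`, first component. -/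
noncomputable def residueMap (P : ℝ → Matrix (Fin n ⊕ Fin n) (Fin n ⊕ Fin n) ℂ⟦X⟧) (T : ℝ)
    (d : ℕ) (u : ℂ⟦X⟧) : (Fin n ⊕ Fin n → ℂ⟦X⟧) →ₗ[ℂ] (ℝ → Fin n → ℂ) where
  -- Write F = P T - 1, with determinant X^d u. The vector is X^(d+1) F⁻¹ y, so its coefficient of
  -- order d is the coefficient of X⁻¹ in P F⁻¹ y.
  toFun y := topCoeff d fun x => P x *ᵥ ((X : ℂ⟦X⟧) • (scaledInverse P T u *ᵥ y))
  map_add' y z := by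
    funext x i
    simp [topCoeff, Matrix.mulVec_add]
  map_smul' c y := by
    funext x i
    have : (X : ℂ⟦X⟧) • c • (scaledInverse P T u *ᵥ y)
        = c • (X : ℂ⟦X⟧) • (scaledInverse P T u *ᵥ y) := smul_comm _ _ _
    simp only [topCoeff, Matrix.mulVec_smul, this, RingHom.id_apply, Pi.smul_apply,
      PowerSeries.coeff_smul]

lemma residueMap_apply (y : Fin n ⊕ Fin n → ℂ⟦X⟧) : residueMap P T d u y
    = topCoeff d fun x => P x *ᵥ ((X : ℂ⟦X⟧) • (scaledInverse P T u *ᵥ y)) := rfl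

/-- The extra factor X raises the order to d + 1, so that by `periodic_topCoeff` all coefficients up
to index d of the series solution, including the residue, are periodic. -/
lemma mulVec_residue_vector (hu : IsUnit u) (hdet : (P T - 1).det = X ^ d * u)
    (y : Fin n ⊕ Fin n → ℂ⟦X⟧) :
    (P T - 1) *ᵥ ((X : ℂ⟦X⟧) • (scaledInverse P T u *ᵥ y)) = (X : ℂ⟦X⟧) ^ (d + 1) • y := by
  rw [Matrix.mulVec_smul, Matrix.mulVec_mulVec, mul_scaledInverse hu hdet, Matrix.smul_mulVec,
    Matrix.one_mulVec, smul_smul, pow_succ']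

/-- The Floquet relation gives P(x + T) φ = P(x) P(T) φ = P(x) φ + X^m P(x) y, whose last term is
invisible below order m. -/
lemma periodic_topCoeff (h : ParabolicCoeffs B A T)
    (hP : IsSeriesFundamental (evansCoeff B A lam) (evansCoeffDeriv B) P) {m : ℕ}
    {φ y : Fin n ⊕ Fin n → ℂ⟦X⟧} (hφ : (P T - 1) *ᵥ φ = (X : ℂ⟦X⟧) ^ m • y) {j : ℕ} (hj : j < m) :
    Function.Periodic (topCoeff j fun x => P x *ᵥ φ) T := by
  intro x
  have hPT : P T *ᵥ φ = φ + (X : ℂ⟦X⟧) ^ m • y := by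
    rw [← hφ, Matrix.sub_mulVec, Matrix.one_mulVec]
    abel
  funext i
  simp only [topCoeff]
  rw [hP.add_period (h.isPeriodicCoeff_evansCoeff lam) h.isPeriodicCoeff_evansCoeffDeriv h.pos,
    ← Matrix.mulVec_mulVec, hPT, Matrix.mulVec_add, Matrix.mulVec_smul]
  simp [PowerSeries.coeff_X_pow_mul', not_le.2 hj]

lemma residueMap_mem (h : ParabolicCoeffs B A T)
    (hP : IsSeriesFundamental (evansCoeff B A lam) (evansCoeffDeriv B) P) (hu : IsUnit u)
    (hdet : (P T - 1).det = X ^ d * u) (y : Fin n ⊕ Fin n → ℂ⟦X⟧) :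
    residueMap P T d u y ∈ genKernel B A T lam (d + 1) :=
  (hP.mulVec_isSeriesSolution _ (d + 1)).topCoeff_mem_genKernel h
    (fun _ hj => periodic_topCoeff h hP (mulVec_residue_vector hu hdet y) hj) d (by omega)

lemma mulVec_sub_one_injective (hu : IsUnit u) (hdet : (P T - 1).det = X ^ d * u) :
    Function.Injective fun v => (P T - 1) *ᵥ v :=
  seriesMulVec_injective (by
    rw [hdet]
    exact mul_ne_zero (pow_ne_zero _ PowerSeries.X_ne_zero) hu.ne_zero)

/-- The series solution Y ending in v is periodic, so with F = P T - 1 one gets F Y(0) = X^(d+m+1) y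
and Y(0) = X^m · X^(d+1) F⁻¹ y. The factor X^m only shifts coefficients, and v, which is coefficient
d + m of Y, becomes the residue of y. -/
lemma exists_residueMap_eq (h : ParabolicCoeffs B A T)
    (hP : IsSeriesFundamental (evansCoeff B A lam) (evansCoeffDeriv B) P) (hu : IsUnit u)
    (hdet : (P T - 1).det = X ^ d * u) {m : ℕ} {v : ℝ → Fin n → ℂ}
    (hv : v ∈ genKernel B A T lam m) : ∃ y, residueMap P T d u y = v := by
  -- The chain is padded with zeros to length d + m + 1, so that inverting P T - 1, which costs d
  -- orders, still leaves a vector in X · `scaledInverse` · y.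
  have hv' : v ∈ genKernel B A T lam (d + m + 1) := genKernel_mono lam (by omega) hv
  obtain ⟨Y, hY, hper, htop⟩ := exists_series_of_mem_genKernel h hv'
  have hYP := hP.coeff_eq (h.isPeriodicCoeff_evansCoeff lam) h.pos hY (Y 0) (fun _ _ _ => rfl)
  have hF : ∀ j < d + m + 1, ∀ i, PowerSeries.coeff j (((P T - 1) *ᵥ Y 0) i) = 0 := by
    intro j hj i
    have h0 : Y T = Y 0 := by simpa using hper 0
    rw [Matrix.sub_mulVec, Matrix.one_mulVec, Pi.sub_apply, map_sub, ← hYP j hj, h0, sub_self]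
  obtain ⟨y, hy⟩ := (coeff_eq_zero_iff_exists _ _).1 hF
  have hY0 : Y 0 = (X : ℂ⟦X⟧) ^ m • (X : ℂ⟦X⟧) • (scaledInverse P T u *ᵥ y) := by
    apply mulVec_sub_one_injective hu hdet
    simp only
    rw [hy, Matrix.mulVec_smul, mulVec_residue_vector hu hdet, smul_smul, ← pow_add]
    congr 2
    omega
  refine ⟨y, ?_⟩
  rw [residueMap_apply, ← htop]
  funext x i
  simp only [topCoeff]
  rw [hYP (d + m) (by omega), hY0, Matrix.mulVec_smul _ (_ ^ m), Pi.smul_apply, smul_eq_mul,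
    PowerSeries.coeff_X_pow_mul]

/-- If coefficient d of the chain vanishes, then so do all lower ones, each being (L - λ) of the
next. The derivative components vanish with them, so the initial vector is X^(d+1) z, and cancelling
X^(d+1) leaves y = (P T - 1) z. The reverse inclusion is the same computation read backwards. -/
lemma ker_residueMap (h : ParabolicCoeffs B A T)
    (hP : IsSeriesFundamental (evansCoeff B A lam) (evansCoeffDeriv B) P) (hu : IsUnit u)
    (hdet : (P T - 1).det = X ^ d * u) :
    LinearMap.ker (residueMap P T d u) = LinearMap.range (seriesMulVec (P T - 1)) := by
  have hXinj : ∀ (k : ℕ) (a b : Fin n ⊕ Fin n → ℂ⟦X⟧), (X : ℂ⟦X⟧) ^ k • a = (X : ℂ⟦X⟧) ^ k • b →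
      a = b := by
    intro k a b hab
    funext i
    exact mul_left_cancel₀ (pow_ne_zero k PowerSeries.X_ne_zero) (congrFun hab i)
  ext y
  constructor
  · intro hy
    rw [LinearMap.mem_ker, residueMap_apply] at hy
    set φ := (X : ℂ⟦X⟧) • (scaledInverse P T u *ᵥ y) with hφ
    have hsol := hP.mulVec_isSeriesSolution φ (d + 1)
    have htop : ∀ k ≤ d, topCoeff (d - k) (fun x => P x *ᵥ φ) = 0 := by
      intro k
      induction k with
      | zero => intro _; exact hy
      | succ k ih =>
        intro hk
        have h1 := ih (by omega)
        rw [show d - k = d - (k + 1) + 1 by omega] at h1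
        have h2 := (hsol.chain h (j := d - (k + 1) + 1) (by omega)).2
        have h3 := (genKernel_mono_succ (B := B) (A := A) (T := T) lam 0 rfl).2
        rw [h1, prevCoeff] at h2
        rw [← h2]
        exact h3
    have hzero : ∀ j < d + 1, ∀ i, PowerSeries.coeff j (φ i) = 0 := by
      intro j hj i
      have h1 := htop (d - j) (by omega)
      rw [show d - (d - j) = j by omega] at h1
      have h2 := (isSeriesSolution_evans_iff.1 hsol j hj 0).1
      have h3 : botCoeff j (fun x => P x *ᵥ φ) 0 = 0 := by
        rw [h1] at h2
        exact h2.unique (hasDerivAt_const (0 : ℝ) (0 : Fin n → ℂ))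
      rcases i with i | i
      · have := congrFun (congrFun h1 0) i
        simpa [topCoeff, hP.init] using this
      · have := congrFun h3 i
        simpa [botCoeff, hP.init] using this
    obtain ⟨z, hz⟩ := (coeff_eq_zero_iff_exists _ _).1 hzero
    refine ⟨z, ?_⟩
    apply hXinj (d + 1)
    rw [← mulVec_residue_vector hu hdet y, ← hφ, hz, Matrix.mulVec_smul]
    rfl
  · rintro ⟨z, rfl⟩
    have hS : (X : ℂ⟦X⟧) • (scaledInverse P T u *ᵥ (seriesMulVec (P T - 1) z))
        = (X : ℂ⟦X⟧) ^ (d + 1) • z := by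
      apply mulVec_sub_one_injective hu hdet
      simp only
      rw [mulVec_residue_vector hu hdet, Matrix.mulVec_smul]
      rfl
    rw [LinearMap.mem_ker, residueMap_apply, hS]
    funext x i
    simp only [topCoeff, Matrix.mulVec_smul, Pi.smul_apply, smul_eq_mul, Pi.zero_apply]
    rw [PowerSeries.coeff_X_pow_mul', if_neg (by omega)]

/-- The generalized eigenspace has the dimension given by the order of the Evans function. -/
theorem finrank_genEigenspace_of_series (h : ParabolicCoeffs B A T)
    (hP : IsSeriesFundamental (evansCoeff B A lam) (evansCoeffDeriv B) P) (hu : IsUnit u)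
    (hdet : (P T - 1).det = X ^ d * u) :
    FiniteDimensional ℂ (genEigenspace B A T lam) ∧
      Module.finrank ℂ (genEigenspace B A T lam) = d := by
  have hspan : genEigenspace B A T lam = LinearMap.range (residueMap P T d u) := by
    apply le_antisymm
    · refine Submodule.span_le.2 (Set.iUnion_subset fun m v hv => ?_)
      exact exists_residueMap_eq h hP hu hdet hv
    · rintro _ ⟨y, rfl⟩
      exact Submodule.subset_span (Set.mem_iUnion.2 ⟨d + 1, residueMap_mem h hP hu hdet y⟩)
  -- By the first isomorphism theorem the generalized eigenspace is the cokernel of P T - 1.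
  obtain ⟨h1, h2⟩ := finrank_coker_eq_order d (P T - 1) u hu hdet
  rw [← ker_residueMap h hP hu hdet] at h1 h2
  rw [hspan]
  have e := (residueMap P T d u).quotKerEquivRange
  exact ⟨Module.Finite.equiv e, by rw [← e.finrank_eq, h2]⟩

end Multiplicity

/-- If the Evans function is not locally zero at `λ`, its order there is the algebraic
multiplicity. -/
theorem finrank_genEigenspace (h : ParabolicCoeffs B A T) {lam : ℂ}
    (hne : analyticOrderAt (evans B A T 0) lam ≠ ⊤) :
    FiniteDimensional ℂ (genEigenspace B A T lam) ∧
      (Module.finrank ℂ (genEigenspace B A T lam) : ℕ∞) = analyticOrderAt (evans B A T 0) lam := by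
  obtain ⟨P, hP⟩ := exists_evans_series h lam
  have hs := evans_hasSeriesAt h hP
  have hdet : (P T - 1).det ≠ 0 := by
    intro h0
    apply hne
    rw [analyticOrderAt_eq_top]
    rw [h0] at hs
    have := hs.hasFPowerSeriesAt.locally_zero_iff.2 (by ext; simp)
    exact this
  obtain ⟨d, u, hu, hd⟩ := exists_eq_X_pow_mul_isUnit hdet
  rw [hd] at hs
  obtain ⟨h1, h2⟩ := finrank_genEigenspace_of_series h hP hu hd
  exact ⟨h1, by rw [h2, hs.analyticOrderAt_eq hu]⟩

/-- Eigenvalues of the operator are zeros of the Evans function. -/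
theorem evans_eq_zero_iff (h : ParabolicCoeffs B A T) {lam : ℂ} :
    evans B A T 0 lam = 0 ↔ ∃ v ∈ periodicDomain n T, v ≠ 0 ∧ linOp B A v = lam • v := by
  obtain ⟨Ψ, hΨ⟩ := exists_fundamentalMatrix h lam
  have hcoef := h.isPeriodicCoeff_evansCoeff lam
  rw [evans_zero, monodromy_eq h hΨ, ← Matrix.exists_mulVec_eq_zero_iff]
  have hsolΨ : ∀ φ : Fin n ⊕ Fin n → ℂ, ∀ x i,
      HasDerivAt (fun x => (Ψ x *ᵥ φ) i) ((evansCoeff B A lam x *ᵥ (Ψ x *ᵥ φ)) i) x := by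
    intro φ x i
    rw [Matrix.mulVec_mulVec]
    simp only [Matrix.mulVec, dotProduct]
    exact HasDerivAt.fun_sum fun k _ => (hΨ.2 x i k).mul_const _
  constructor
  · rintro ⟨φ, hφ0, hφ⟩
    rw [Matrix.sub_mulVec, Matrix.one_mulVec, sub_eq_zero] at hφ
    have hper : Function.Periodic (fun x => Ψ x *ᵥ φ) T := by
      have := hcoef.ode_unique h.pos (y := fun x => Ψ (x + T) *ᵥ φ) (z := fun x => Ψ x *ᵥ φ)
        (fun x i => by
          have := (hsolΨ φ (x + T) i).comp_add_const x T
          rw [hcoef.periodic] at this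
          exact this) (hsolΨ φ) (by simp [hφ, hΨ.1])
      exact congrFun this
    set v : ℝ → Fin n → ℂ := fun x i => (Ψ x *ᵥ φ) (Sum.inl i)
    set v' : ℝ → Fin n → ℂ := fun x i => (Ψ x *ᵥ φ) (Sum.inr i)
    have hv : ∀ x, HasDerivAt v (v' x) x := by
      intro x
      rw [hasDerivAt_pi]
      intro i
      have := hsolΨ φ x (Sum.inl i)
      rw [evansCoeff_mulVec] at this
      exact this
    have hv' : ∀ x, HasDerivAt v' (systemRHS B A lam x (v x) (v' x)
        + complexify ((B x)⁻¹) *ᵥ (0 : ℝ → Fin n → ℂ) x) x := by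
      intro x
      rw [hasDerivAt_pi]
      intro i
      have := hsolΨ φ x (Sum.inr i)
      rw [evansCoeff_mulVec] at this
      rw [Pi.zero_apply, Matrix.mulVec_zero, add_zero]
      exact this
    refine ⟨v, ⟨contDiff_two_of_system h hv continuous_zero hv', fun x => ?_⟩, ?_, ?_⟩
    · funext i
      exact congrFun (hper x) _
    · intro h0
      have h1 : v' 0 = 0 := by
        have := hv 0
        rw [h0] at this
        exact this.unique (hasDerivAt_const (0 : ℝ) (0 : Fin n → ℂ))
      apply hφ0
      funext i
      rcases i with i | i
      · have := congrFun (congrFun h0 0) i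
        simpa [v, hΨ.1] using this
      · have := congrFun h1 i
        simpa [v', hΨ.1] using this
    · exact sub_eq_zero.1 (linOp_sub_eq_of_system h hv hv')
  · rintro ⟨v, ⟨hv2, hper⟩, hv0, hv⟩
    have hsys := hasDerivAt_of_linOp_sub_eq h hv2 (sub_eq_zero.2 hv)
    set w : ℝ → Fin n ⊕ Fin n → ℂ := fun x => Sum.elim (v x) (deriv v x)
    have hw : w = fun x => Ψ x *ᵥ w 0 := by
      refine hcoef.ode_unique h.pos (fun x i => ?_) (hsolΨ (w 0)) (by simp [hΨ.1])
      rw [evansCoeff_mulVec]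
      rcases i with i | i
      · exact hasDerivAt_pi.1 (hsys x).1 i
      · have := hasDerivAt_pi.1 (hsys x).2 i
        simp only [Pi.zero_apply, Matrix.mulVec_zero, add_zero] at this
        exact this
    refine ⟨w 0, ?_, ?_⟩
    · intro h0
      apply hv0
      funext x i
      have := congrFun (congrFun hw x) (Sum.inl i)
      rw [h0] at this
      simpa [w] using this
    · have h1 := congrFun hw T
      have h2 : w T = w 0 := by
        simp only [w]
        rw [← zero_add T, hper, periodic_deriv hper]
      rw [Matrix.sub_mulVec, Matrix.one_mulVec, sub_eq_zero, ← h1, h2]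

end PeriodicEvans

namespace PeriodicEvans

open PowerSeries

/-! ### The order of the Evans function at the origin -/

section Origin

variable {n : ℕ} {B A : ℝ → Matrix (Fin n) (Fin n) ℝ} {T : ℝ}
  {P : ℝ → Matrix (Fin n ⊕ Fin n) (Fin n ⊕ Fin n) ℂ⟦X⟧}

/-- The change of variables `(w, w') ↦ (w, B w' - A w)`. -/
noncomputable def fluxMatrix (B A : ℝ → Matrix (Fin n) (Fin n) ℝ) (x : ℝ) :
    Matrix (Fin n ⊕ Fin n) (Fin n ⊕ Fin n) ℂ :=
  Matrix.fromBlocks 1 0 (-complexify (A x)) (complexify (B x))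

lemma fluxMatrix_mulVec (x : ℝ) (w : Fin n ⊕ Fin n → ℂ) : fluxMatrix B A x *ᵥ w
    = Sum.elim (w ∘ Sum.inl)
      (complexify (B x) *ᵥ (w ∘ Sum.inr) - complexify (A x) *ᵥ (w ∘ Sum.inl)) := by
  rw [fluxMatrix, Matrix.fromBlocks_mulVec, Matrix.neg_mulVec]
  simp [sub_eq_neg_add]

lemma det_fluxMatrix_ne_zero (h : ParabolicCoeffs B A T) (x : ℝ) : (fluxMatrix B A x).det ≠ 0 := by
  rw [fluxMatrix, Matrix.det_fromBlocks_zero₁₂, Matrix.det_one, one_mul]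
  exact Matrix.det_ne_zero_of_left_inverse (h.inv_mul x)

lemma coeff_map_C_mulVec {N : Type*} [Fintype N] (M : Matrix N N ℂ) (v : N → ℂ⟦X⟧) (j : ℕ) (i : N) :
    PowerSeries.coeff j ((M.map PowerSeries.C *ᵥ v) i)
      = (M *ᵥ fun k => PowerSeries.coeff j (v k)) i := by
  simp [Matrix.mulVec, dotProduct]

/-- At `λ = 0` the flux `B w' - A w` of a series solution has derivative given by the preceding
coefficient. -/
lemma flux_increment (h : ParabolicCoeffs B A T) {m : ℕ} {Y : ℝ → Fin n ⊕ Fin n → ℂ⟦X⟧}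
    (hY : IsSeriesSolution m (evansCoeff B A 0) (evansCoeffDeriv B) Y) {j : ℕ} (hj : j < m) :
    (complexify (B T) *ᵥ botCoeff j Y T - complexify (A T) *ᵥ topCoeff j Y T)
      - (complexify (B 0) *ᵥ botCoeff j Y 0 - complexify (A 0) *ᵥ topCoeff j Y 0)
      = ∫ x in (0 : ℝ)..T, prevCoeff Y j x := by
  have hc := (hY.chain h hj).2
  rw [isSeriesSolution_evans_iff] at hY
  have hprev : Continuous (prevCoeff Y j) := by
    rcases j with _ | j
    · exact continuous_zero
    · exact continuous_iff_continuousAt.2 fun x => (hY j (by omega) x).1.continuousAt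
  have hd : ∀ x, HasDerivAt
      (fun x => complexify (B x) *ᵥ botCoeff j Y x - complexify (A x) *ᵥ topCoeff j Y x)
      (prevCoeff Y j x) x := by
    intro x
    have h1 := (hasDerivAt_mulVec (hasDerivAt_complexify h.contDiff_B x) (hY j hj x).2).sub
      (hasDerivAt_mulVec (hasDerivAt_complexify h.contDiff_A x) (hY j hj x).1)
    rw [← linOp_eq h (fun x => (hY j hj x).1) (hY j hj x).2] at h1
    rw [zero_smul, sub_zero] at hc
    rw [hc] at h1
    exact h1
  rw [intervalIntegral.integral_eq_sub_of_hasDerivAt (fun x _ => hd x)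
    (hprev.intervalIntegrable _ _)]

/-- In flux coordinates the lower rows of P T - 1 measure the change of flux over one period. At
order 0 this is zero, since the flux is conserved at λ = 0; at order 1 it is the integral of the
leading coefficient. -/
lemma coeff_flux_mulVec (h : ParabolicCoeffs B A T)
    (hP : IsSeriesFundamental (evansCoeff B A 0) (evansCoeffDeriv B) P)
    (φ : Fin n ⊕ Fin n → ℂ⟦X⟧) (j : ℕ) (i : Fin n) :
    PowerSeries.coeff j (((fluxMatrix B A 0).map PowerSeries.C *ᵥ ((P T - 1) *ᵥ φ)) (Sum.inr i))
      = (∫ x in (0 : ℝ)..T, prevCoeff (fun x => P x *ᵥ φ) j x) i := by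
  rw [← flux_increment h (hP.mulVec_isSeriesSolution φ (j + 1)) (Nat.lt_succ_self j),
    coeff_map_C_mulVec, fluxMatrix_mulVec, Sum.elim_inr]
  have hB : B T = B 0 := by simpa using h.periodic_B 0
  have hA : A T = A 0 := by simpa using h.periodic_A 0
  have e1 : (fun k => PowerSeries.coeff j (((P T - 1) *ᵥ φ) k)) ∘ Sum.inl
      = topCoeff j (fun x => P x *ᵥ φ) T - topCoeff j (fun x => P x *ᵥ φ) 0 := by
    funext i
    simp [topCoeff, Matrix.sub_mulVec, hP.init]
  have e2 : (fun k => PowerSeries.coeff j (((P T - 1) *ᵥ φ) k)) ∘ Sum.inr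
      = botCoeff j (fun x => P x *ᵥ φ) T - botCoeff j (fun x => P x *ᵥ φ) 0 := by
    funext i
    simp [botCoeff, Matrix.sub_mulVec, hP.init]
  rw [e1, e2, hB, hA, Matrix.mulVec_sub, Matrix.mulVec_sub, sub_sub_sub_comm]

/-- The Evans function vanishes to order at least `n + 1` at the origin. -/
theorem succ_le_analyticOrderAt_evans (h : ParabolicCoeffs B A T) {w w' : ℝ → Fin n → ℂ}
    (hw : ∀ x, HasDerivAt w (w' x) x)
    (hBA : ∀ x, complexify (B x) *ᵥ w' x = complexify (A x) *ᵥ w x)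
    (hper : Function.Periodic w T) (hint : ∫ x in (0 : ℝ)..T, w x = 0) (hne : w ≠ 0) :
    ((n + 1 : ℕ) : ℕ∞) ≤ analyticOrderAt (evans B A T 0) 0 := by
  obtain ⟨P, hP⟩ := exists_evans_series h 0
  have hs := evans_hasSeriesAt h hP
  have hcoef := h.isPeriodicCoeff_evansCoeff 0
  set Q : Matrix (Fin n ⊕ Fin n) (Fin n ⊕ Fin n) ℂ⟦X⟧ := (fluxMatrix B A 0).map PowerSeries.C with hQ
  -- division of the lower rows by the variable
  have hdvd : ∀ i k, X ∣ (Q * (P T - 1)) (Sum.inr i) k := by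
    intro i k
    have := coeff_flux_mulVec h hP (Pi.single k 1) 0 i
    rw [Matrix.mulVec_mulVec, Matrix.mulVec_single_one] at this
    rw [PowerSeries.X_dvd_iff, ← PowerSeries.coeff_zero_eq_constantCoeff_apply]
    simpa [prevCoeff, Matrix.col_apply] using this
  choose g hg using hdvd
  set G : Matrix (Fin n ⊕ Fin n) (Fin n ⊕ Fin n) ℂ⟦X⟧ :=
    Matrix.of fun a k => Sum.elim (fun i => (Q * (P T - 1)) (Sum.inl i) k) (fun i => g i k) a with hG
  have hfac : Q * (P T - 1) = Matrix.diagonal (Sum.elim (fun _ => 1) fun _ => X) * G := by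
    ext1 a k
    rw [Matrix.diagonal_mul]
    rcases a with i | i
    · simp [hG]
    · simp [hG, hg]
  -- the derivative of the wave spans a kernel at lowest order
  set φ : Fin n ⊕ Fin n → ℂ := Sum.elim (w 0) (w' 0) with hφ
  have hφ0 : φ ≠ 0 := by
    intro h0
    apply hne
    -- The function w solves the first-order equation w' = B⁻¹ A w, so w(0) = 0 alone would force w
    -- = 0.
    have hwd : ∀ x, HasDerivAt w ((complexify ((B x)⁻¹) * complexify (A x)) *ᵥ w x) x := by
      intro x
      rw [← Matrix.mulVec_mulVec, ← hBA, Matrix.mulVec_mulVec, h.inv_mul, Matrix.one_mulVec]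
      exact hw x
    have hc : IsPeriodicCoeff (fun x => complexify ((B x)⁻¹) * complexify (A x)) T :=
      ⟨h.continuous_inv.mul h.continuous_A, fun x => by simp only [h.periodic_B x, h.periodic_A x]⟩
    refine hc.ode_unique h.pos (fun x i => hasDerivAt_pi.1 (hwd x) i)
      (fun x i => by simpa using hasDerivAt_const x (0 : ℂ)) ?_
    funext i
    exact congrFun h0 (Sum.inl i)
  have hsol : ∀ x, w x = topCoeff 0 (fun x => P x *ᵥ fun k => PowerSeries.C (φ k)) x := by
    have hw'1 : ∀ x, DifferentiableAt ℝ w' x := by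
      have e : w' = fun x => (complexify ((B x)⁻¹) * complexify (A x)) *ᵥ w x := by
        funext x
        rw [← Matrix.mulVec_mulVec, ← hBA, Matrix.mulVec_mulVec, h.inv_mul, Matrix.one_mulVec]
      intro x
      rw [e]
      have hI := hasDerivAt_complexify (fun i j => h.contDiff_inv i j) x
      have hA := hasDerivAt_complexify (fun i j => h.contDiff_A i j) x
      refine (hasDerivAt_mulVec (M' := complexify (matrixDeriv (fun x => (B x)⁻¹) x) * complexify (A x)
        + complexify ((B x)⁻¹) * complexify (matrixDeriv A x)) (fun i j => ?_) (hw x)).differentiableAt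
      simp only [Matrix.mul_apply, Matrix.add_apply, ← Finset.sum_add_distrib]
      exact HasDerivAt.fun_sum fun l _ => (hI i l).mul (hA l j)
    have hlin : linOp B A w - (0 : ℂ) • w = 0 := by
      have hd : deriv w = w' := funext fun y => (hw y).deriv
      funext x
      simp only [linOp, hd, hBA, sub_self, zero_smul, sub_zero, Pi.zero_apply]
    set Y : ℝ → Fin n ⊕ Fin n → ℂ⟦X⟧ := fun x =>
      Sum.elim (fun i => PowerSeries.C (w x i)) (fun i => PowerSeries.C (w' x i)) with hYdef
    have htop : topCoeff 0 Y = w := by funext x i; simp [topCoeff, hYdef]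
    have hbot : botCoeff 0 Y = w' := by funext x i; simp [botCoeff, hYdef]
    have hY : IsSeriesSolution 1 (evansCoeff B A 0) (evansCoeffDeriv B) Y := by
      rw [isSeriesSolution_evans_iff]
      intro j hj x
      obtain rfl : j = 0 := by omega
      rw [htop, hbot]
      refine ⟨hw x, ?_⟩
      have h2 := (hw'1 x).hasDerivAt
      have e := linOp_eq h hw h2
      have e0 := congrFun hlin x
      rw [zero_smul, sub_zero] at e0
      rw [e0, Pi.zero_apply, eq_comm, sub_eq_zero] at e
      have e2 : complexify (B x) *ᵥ deriv w' x = complexify (matrixDeriv A x) *ᵥ w x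
          + (complexify (A x) *ᵥ w' x - complexify (matrixDeriv B x) *ᵥ w' x) := by
        rw [add_sub_assoc', eq_sub_iff_add_eq, ← e]
        abel
      have e3 : deriv w' x = systemRHS B A 0 x (w x) (w' x) := by
        rw [systemRHS, zero_smul, zero_add, ← e2, Matrix.mulVec_mulVec, h.inv_mul,
          Matrix.one_mulVec]
      rw [e3] at h2
      simpa [prevCoeff] using h2
    have := hP.coeff_eq hcoef h.pos hY (fun k => PowerSeries.C (φ k)) (by
      intro j hj i
      rcases i with i | i <;> simp [hYdef, hφ]) 0 one_pos
    intro x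
    funext i
    have := this x (Sum.inl i)
    simpa [topCoeff, hYdef] using this
  -- The upper rows vanish because w is periodic. In the lower rows, G was obtained by dividing by
  -- X, so order 0 of G φ is order 1 of the flux increment, namely ∫ w = 0.
  have hGφ : ∀ a, PowerSeries.coeff 0 ((G *ᵥ fun k => PowerSeries.C (φ k)) a) = 0 := by
    have hmul : ∀ a, ((Q * (P T - 1)) *ᵥ fun k => PowerSeries.C (φ k)) a
        = Sum.elim (fun _ => (1 : ℂ⟦X⟧)) (fun _ => X) a * (G *ᵥ fun k => PowerSeries.C (φ k)) a := by
      intro a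
      rw [hfac, ← Matrix.mulVec_mulVec, Matrix.mulVec_diagonal]
    rintro (i | i)
    · have e := hmul (Sum.inl i)
      rw [Sum.elim_inl, one_mul] at e
      rw [← e, ← Matrix.mulVec_mulVec, hQ, coeff_map_C_mulVec, fluxMatrix_mulVec, Sum.elim_inl]
      have h1 : w T = w 0 := by simpa using hper 0
      have h2 := congrFun (hsol T) i
      simp only [topCoeff] at h2
      simp only [Function.comp_apply]
      rw [Matrix.sub_mulVec, Matrix.one_mulVec, Pi.sub_apply, map_sub, ← h2, h1]
      simp [hφ]
    · have e := congrArg (PowerSeries.coeff 1) (hmul (Sum.inr i))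
      rw [Sum.elim_inr, ← Matrix.mulVec_mulVec, hQ, coeff_flux_mulVec h hP] at e
      have h3 : prevCoeff (fun x => P x *ᵥ fun k => PowerSeries.C (φ k)) 1 = w := by
        funext x
        exact (hsol x).symm
      rw [h3, hint, PowerSeries.coeff_succ_X_mul] at e
      exact e.symm
  have hdetG : PowerSeries.constantCoeff G.det = 0 := by
    rw [RingHom.map_det, ← Matrix.exists_mulVec_eq_zero_iff]
    refine ⟨φ, hφ0, ?_⟩
    funext a
    have := hGφ a
    simpa [Matrix.mulVec, dotProduct] using this
  have hdvd : (X : ℂ⟦X⟧) ^ (n + 1) ∣ (P T - 1).det := by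
    have hdet := congrArg Matrix.det hfac
    rw [Matrix.det_mul, Matrix.det_mul, Matrix.det_diagonal, Fintype.prod_sum_type] at hdet
    simp only [Sum.elim_inl, Sum.elim_inr, Finset.prod_const_one, one_mul, Finset.prod_const,
      Finset.card_univ, Fintype.card_fin] at hdet
    have hQu : IsUnit Q.det := by
      have : Q.det = PowerSeries.C (fluxMatrix B A 0).det :=
        (RingHom.map_det (PowerSeries.C (R := ℂ)) (fluxMatrix B A 0)).symm
      rw [this]
      exact (isUnit_iff_ne_zero.2 (det_fluxMatrix_ne_zero h 0)).map _
    -- The n lower rows contribute X^n and the singularity of G at X = 0 contributes one more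
    -- factor.
    rw [← hQu.dvd_mul_left, hdet, pow_succ]
    exact mul_dvd_mul_left _ (PowerSeries.X_dvd_iff.2 hdetG)
  rw [natCast_le_analyticOrderAt_iff_iteratedDeriv_eq_zero hs.hasFPowerSeriesAt.analyticAt]
  intro j hj
  rw [hs.iteratedDeriv_eq, PowerSeries.X_pow_dvd_iff.1 hdvd j hj, mul_zero]

end Origin

end PeriodicEvans

namespace PeriodicEvans

/-! ### Energy estimate with a symmetrizer -/

section Energy

open scoped InnerProductSpace

variable {E : Type*} [NormedAddCommGroup E] [InnerProductSpace ℂ E]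

/-- Pointwise bound for the symmetrized energy density. -/
lemma energy_density_bounds {S S' Bx Ax : E →L[ℂ] E} {M c : ℝ} (hc : 0 < c) (hS : ‖S‖ ≤ M)
    (hS' : ‖S'‖ ≤ M) (hB : ‖Bx‖ ≤ M) (hA : ‖Ax‖ ≤ M) (v v' : E)
    (hpos : c * ‖v'‖ ^ 2 ≤ (⟪S v', Bx v'⟫_ℂ).re) :
    c / 2 * ‖v'‖ ^ 2 - (2 * M ^ 4 / c + M ^ 2) * ‖v‖ ^ 2
        ≤ (⟪S' v + S v', Bx v' - Ax v⟫_ℂ).re ∧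
      ‖⟪S' v + S v', Bx v' - Ax v⟫_ℂ‖ ≤ 2 * M ^ 2 * (‖v‖ ^ 2 + ‖v'‖ ^ 2) := by
  have hM : 0 ≤ M := (norm_nonneg _).trans hS
  have bd : ∀ (L : E →L[ℂ] E) (w : E), ‖L‖ ≤ M → ‖L w‖ ≤ M * ‖w‖ := fun L w hL =>
    L.le_of_opNorm_le hL w
  have bi : ∀ (L L' : E →L[ℂ] E) (w w' : E), ‖L‖ ≤ M → ‖L'‖ ≤ M →
      |(⟪L w, L' w'⟫_ℂ).re| ≤ M ^ 2 * (‖w‖ * ‖w'‖) := by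
    intro L L' w w' hL hL'
    calc |(⟪L w, L' w'⟫_ℂ).re| ≤ ‖⟪L w, L' w'⟫_ℂ‖ := Complex.abs_re_le_norm _
      _ ≤ ‖L w‖ * ‖L' w'‖ := norm_inner_le_norm _ _
      _ ≤ (M * ‖w‖) * (M * ‖w'‖) := by
        gcongr
        exacts [bd _ _ hL, bd _ _ hL']
      _ = _ := by ring
  constructor
  · have e : (⟪S' v + S v', Bx v' - Ax v⟫_ℂ).re = (⟪S' v, Bx v'⟫_ℂ).re - (⟪S' v, Ax v⟫_ℂ).re
        + ((⟪S v', Bx v'⟫_ℂ).re - (⟪S v', Ax v⟫_ℂ).re) := by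
      simp only [inner_add_left, inner_sub_right, Complex.add_re, Complex.sub_re]
      ring
    rw [e]
    have h1 := (abs_le.1 (bi S' Bx v v' hS' hB)).1
    have h2 := (abs_le.1 (bi S' Ax v v hS' hA)).2
    have h3 := (abs_le.1 (bi S Ax v' v hS hA)).2
    -- Young's inequality spends half of the coercivity constant on the two cross terms, each at
    -- most M² ‖v‖ ‖v'‖.
    have h4 : 2 * M ^ 2 * (‖v‖ * ‖v'‖) ≤ c / 2 * ‖v'‖ ^ 2 + 2 * M ^ 4 / c * ‖v‖ ^ 2 := by
      have : 0 ≤ (c * ‖v'‖ - 2 * M ^ 2 * ‖v‖) ^ 2 / (2 * c) := by positivity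
      have e : (c * ‖v'‖ - 2 * M ^ 2 * ‖v‖) ^ 2 / (2 * c)
          = c / 2 * ‖v'‖ ^ 2 + 2 * M ^ 4 / c * ‖v‖ ^ 2 - 2 * M ^ 2 * (‖v‖ * ‖v'‖) := by
        field_simp
        ring
      linarith
    nlinarith
  · calc ‖⟪S' v + S v', Bx v' - Ax v⟫_ℂ‖ ≤ ‖S' v + S v'‖ * ‖Bx v' - Ax v‖ :=
        norm_inner_le_norm _ _
      _ ≤ (M * ‖v‖ + M * ‖v'‖) * (M * ‖v'‖ + M * ‖v‖) := by
        gcongr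
        · exact (norm_add_le _ _).trans (add_le_add (bd _ _ hS') (bd _ _ hS))
        · exact (norm_sub_le _ _).trans (add_le_add (bd _ _ hB) (bd _ _ hA))
      _ ≤ _ := by nlinarith [sq_nonneg (‖v‖ - ‖v'‖), sq_nonneg M, mul_nonneg (sq_nonneg M) (sq_nonneg (‖v‖ - ‖v'‖))]

/-- Energy estimate: eigenvalues in the closed right half-plane are bounded. -/
theorem eigenvalue_bound {S S' Bx Ax : ℝ → E →L[ℂ] E} {M c T : ℝ} (hT : 0 < T) (hc : 0 < c)
    (hS : ∀ x, ‖S x‖ ≤ M) (hS' : ∀ x, ‖S' x‖ ≤ M) (hB : ∀ x, ‖Bx x‖ ≤ M) (hA : ∀ x, ‖Ax x‖ ≤ M)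
    (hSd : ∀ x, HasDerivAt S (S' x) x) (hS'c : Continuous S') (hBc : Continuous Bx)
    (hAc : Continuous Ax) (hpos : ∀ x v, c * ‖v‖ ^ 2 ≤ (⟪S x v, Bx x v⟫_ℂ).re)
    (hS1 : ∀ x v, ‖v‖ ^ 2 ≤ (⟪S x v, v⟫_ℂ).re) (hSim : ∀ x v, (⟪S x v, v⟫_ℂ).im = 0)
    {v v' : ℝ → E} {lam : ℂ} (hv : ∀ x, HasDerivAt v (v' x) x) (hv'c : Continuous v')
    (hz : ∀ x, HasDerivAt (fun x => Bx x (v' x) - Ax x (v x)) (lam • v x) x)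
    (hper : S T (v T) = S 0 (v 0))
    (hper' : Bx T (v' T) - Ax T (v T) = Bx 0 (v' 0) - Ax 0 (v 0))
    (hne : ∃ x ∈ Set.Icc 0 T, v x ≠ 0) (hlam : 0 ≤ lam.re) :
    ‖lam‖ ≤ 2 * M ^ 2 * (1 + 2 / c * (2 * M ^ 4 / c + M ^ 2)) := by
  have hvc : Continuous v := continuous_iff_continuousAt.2 fun x => (hv x).continuousAt
  have hSc : Continuous S := continuous_iff_continuousAt.2 fun x => (hSd x).continuousAt
  set p : ℝ → ℂ := fun x => ⟪S' x (v x) + S x (v' x), Bx x (v' x) - Ax x (v x)⟫_ℂ with hp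
  set r : ℝ → ℝ := fun x => (⟪S x (v x), v x⟫_ℂ).re with hr
  have hpc : Continuous p :=
    ((hS'c.clm_apply hvc).add (hSc.clm_apply hv'c)).inner
      ((hBc.clm_apply hv'c).sub (hAc.clm_apply hvc))
  have hrc : Continuous r := Complex.continuous_re.comp ((hSc.clm_apply hvc).inner hvc)
  have hrr : ∀ x, ⟪S x (v x), v x⟫_ℂ = (r x : ℂ) := fun x =>
    Complex.ext (by simp [hr]) (by simp [hSim])
  -- Pairing the eigenvalue equation with S v and integrating by parts: the boundary terms cancel by
  -- periodicity, leaving λ ∫ ⟪S v, v⟫ + ∫ p = 0 with ⟪S v, v⟫ real and at least ‖v‖².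
  have hq : ∀ x, HasDerivAt (fun x => ⟪S x (v x), Bx x (v' x) - Ax x (v x)⟫_ℂ)
      (lam * (r x : ℂ) + p x) x := by
    intro x
    have hSv : HasDerivAt (fun x => S x (v x)) (S' x (v x) + S x (v' x)) x := by
      have hSR : HasDerivAt (fun x => (S x).restrictScalars ℝ) ((S' x).restrictScalars ℝ) x := by
        have := ((ContinuousLinearMap.restrictScalarsL ℂ E E ℝ ℝ).hasFDerivAt
          (x := S x)).comp_hasDerivAt x (hSd x)
        exact this
      exact hSR.clm_apply (hv x)
    have := hSv.inner ℂ (hz x)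
    rw [inner_smul_right, hrr] at this
    exact this
  have hint : ∫ x in (0 : ℝ)..T, (lam * (r x : ℂ) + p x) = 0 := by
    rw [intervalIntegral.integral_eq_sub_of_hasDerivAt (fun x _ => hq x)
      (Continuous.intervalIntegrable (by fun_prop) _ _), hper, hper', sub_self]
  have i1 : IntervalIntegrable (fun x => (r x : ℂ)) volume 0 T :=
    Continuous.intervalIntegrable (by fun_prop) _ _
  have ip : IntervalIntegrable p volume 0 T := hpc.intervalIntegrable _ _
  rw [intervalIntegral.integral_add (i1.const_mul lam) ip, intervalIntegral.integral_const_mul,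
    intervalIntegral.integral_ofReal] at hint
  set N := ∫ x in (0 : ℝ)..T, r x
  set a := ∫ x in (0 : ℝ)..T, ‖v x‖ ^ 2
  set b := ∫ x in (0 : ℝ)..T, ‖v' x‖ ^ 2
  have ia : IntervalIntegrable (fun x => ‖v x‖ ^ 2) volume 0 T :=
    Continuous.intervalIntegrable (by fun_prop) _ _
  have ib : IntervalIntegrable (fun x => ‖v' x‖ ^ 2) volume 0 T :=
    Continuous.intervalIntegrable (by fun_prop) _ _
  have haN : a ≤ N := intervalIntegral.integral_mono hT.le ia (hrc.intervalIntegrable _ _)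
    fun x => hS1 x (v x)
  have ha : 0 < a := by
    obtain ⟨x, hx, hvx⟩ := hne
    refine intervalIntegral.integral_pos hT (by fun_prop) (fun y _ => by positivity)
      ⟨x, hx, by positivity⟩
  have hb0 : 0 ≤ b := intervalIntegral.integral_nonneg hT.le fun x _ => by positivity
  set C₁ := 2 * M ^ 4 / c + M ^ 2
  have hre : c / 2 * b - C₁ * a ≤ (∫ x in (0 : ℝ)..T, p x).re := by
    have e : (∫ x in (0 : ℝ)..T, p x).re = ∫ x in (0 : ℝ)..T, (p x).re := by
      have := Complex.reCLM.intervalIntegral_comp_comm ip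
      simpa using this.symm
    rw [e, ← intervalIntegral.integral_const_mul, ← intervalIntegral.integral_const_mul,
      ← intervalIntegral.integral_sub (ib.const_mul _) (ia.const_mul _)]
    exact intervalIntegral.integral_mono hT.le ((ib.const_mul _).sub (ia.const_mul _))
      ((Complex.continuous_re.comp hpc).intervalIntegrable _ _) fun x =>
      (energy_density_bounds hc (hS x) (hS' x) (hB x) (hA x) (v x) (v' x) (hpos x _)).1
  have hnorm : ‖∫ x in (0 : ℝ)..T, p x‖ ≤ 2 * M ^ 2 * (a + b) := by
    rw [← intervalIntegral.integral_add ia ib, ← intervalIntegral.integral_const_mul]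
    refine intervalIntegral.norm_integral_le_of_norm_le hT.le ?_ ((ia.add ib).const_mul _)
    exact Eventually.of_forall fun x _ =>
      (energy_density_bounds hc (hS x) (hS' x) (hB x) (hA x) (v x) (v' x) (hpos x _)).2
  -- The real part, where Re λ ≥ 0 has the favourable sign, controls v' by v.
  have hbC : b ≤ 2 / c * C₁ * a := by
    have h1 := congrArg Complex.re hint
    simp only [Complex.add_re, Complex.mul_re, Complex.ofReal_re, Complex.ofReal_im, mul_zero,
      sub_zero, Complex.zero_re] at h1
    have h2 : 0 ≤ lam.re * N := mul_nonneg hlam (ha.le.trans haN)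
    have h3 : c / 2 * b ≤ C₁ * a := by linarith
    calc b = 2 / c * (c / 2 * b) := by field_simp
      _ ≤ 2 / c * (C₁ * a) := by gcongr
      _ = _ := by ring
  -- The modulus of the same identity then bounds λ.
  have hl : ‖lam‖ * N ≤ 2 * M ^ 2 * (a + b) := by
    have h1 : lam * (N : ℂ) = -∫ x in (0 : ℝ)..T, p x := eq_neg_of_add_eq_zero_left hint
    have h2 := congrArg norm h1
    rw [norm_neg, norm_mul, Complex.norm_real, Real.norm_eq_abs,
      abs_of_nonneg (ha.le.trans haN)] at h2
    rw [h2]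
    exact hnorm
  have h5 : ‖lam‖ * a ≤ 2 * M ^ 2 * (1 + 2 / c * C₁) * a :=
    calc ‖lam‖ * a ≤ ‖lam‖ * N := by gcongr
      _ ≤ 2 * M ^ 2 * (a + b) := hl
      _ ≤ 2 * M ^ 2 * (a + 2 / c * C₁ * a) := by gcongr
      _ = _ := by ring
  exact le_of_mul_le_mul_right h5 ha

end Energy

/-! ### Construction of the symmetrizer -/

section Symmetrizer

open scoped InnerProductSpace

/-- By Gelfand's formula ‖a^k‖^(1/k) tends to the spectral radius, which is below 1 because the
spectrum is compact. -/
lemma exists_norm_pow_lt_one {R : Type*} [NormedRing R] [NormedAlgebra ℂ R] [CompleteSpace R] (a : R)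
    (h : ∀ ν ∈ spectrum ℂ a, ‖ν‖ < 1) : ∃ k, 0 < k ∧ ‖a ^ k‖ < 1 := by
  have hr : spectralRadius ℂ a < 1 := by
    rcases (spectrum ℂ a).eq_empty_or_nonempty with he | hne
    · simp [spectralRadius, he]
    · exact spectrum.spectralRadius_lt_of_forall_lt_of_nonempty hne (r := 1) fun k hk => h k hk
  have := (spectrum.pow_nnnorm_pow_one_div_tendsto_nhds_spectralRadius a).eventually_lt_const hr
  obtain ⟨k, hk, hk0⟩ := (this.and (eventually_gt_atTop 0)).exists
  refine ⟨k, hk0, ?_⟩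
  by_contra! hge
  have h1 : (1 : ℝ≥0∞) ≤ (‖a ^ k‖₊ : ℝ≥0∞) := by
    exact_mod_cast hge
  exact absurd hk (not_lt.2 (ENNReal.one_le_rpow h1 (by positivity)))

variable {n : ℕ}

/-- The Cayley transform of a matrix. -/
noncomputable def cayley (M : Matrix (Fin n) (Fin n) ℂ) : Matrix (Fin n) (Fin n) ℂ :=
  (1 - M) * (1 + M)⁻¹

lemma isUnit_one_add {M : Matrix (Fin n) (Fin n) ℂ} (hM : ∀ μ ∈ spectrum ℂ M, 0 < μ.re) :
    IsUnit (1 + M) := by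
  have h : (-1 : ℂ) ∉ spectrum ℂ M := fun h => by
    have := hM _ h
    norm_num at this
  rw [spectrum.notMem_iff] at h
  have e : algebraMap ℂ (Matrix (Fin n) (Fin n) ℂ) (-1) - M = -(1 + M) := by
    rw [map_neg, map_one]
    abel
  rw [e] at h
  simpa using h.neg

/-- The map μ ↦ (1 - μ)/(1 + μ) sends the right half-plane to the unit disc. A spectral value ν of
the transform comes from (1 - ν)/(1 + ν) in the spectrum of M, and positivity of its real part is
|ν| < 1. -/
lemma norm_lt_one_of_mem_spectrum_cayley {M : Matrix (Fin n) (Fin n) ℂ}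
    (hM : ∀ μ ∈ spectrum ℂ M, 0 < μ.re) {ν : ℂ} (hν : ν ∈ spectrum ℂ (cayley M)) : ‖ν‖ < 1 := by
  have hu := isUnit_one_add hM
  have hdet : IsUnit (1 + M).det := (Matrix.isUnit_iff_isUnit_det _).1 hu
  have hinv : IsUnit ((1 + M)⁻¹) := (Matrix.isUnit_nonsing_inv_iff).2 hu
  have e : algebraMap ℂ (Matrix (Fin n) (Fin n) ℂ) ν - cayley M
      = ((ν - 1) • 1 + (ν + 1) • M) * (1 + M)⁻¹ := by
    have : algebraMap ℂ (Matrix (Fin n) (Fin n) ℂ) ν = (ν • (1 + M)) * (1 + M)⁻¹ := by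
      rw [Matrix.smul_mul, Matrix.mul_nonsing_inv _ hdet, Algebra.algebraMap_eq_smul_one]
    rw [this, cayley, ← sub_mul]
    congr 1
    module
  rw [spectrum.mem_iff, e] at hν
  have hν' : ¬ IsUnit ((ν - 1) • (1 : Matrix (Fin n) (Fin n) ℂ) + (ν + 1) • M) :=
    fun h => hν (h.mul hinv)
  -- The value ν = -1 has no preimage, but there ν - C = -2 (1 + M)⁻¹ is invertible.
  have hne : ν + 1 ≠ 0 := by
    intro h0
    apply hν'
    rw [h0, zero_smul, add_zero]
    have : ν - 1 = -2 := by linear_combination h0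
    rw [this, ← Algebra.algebraMap_eq_smul_one]
    exact (isUnit_iff_ne_zero.2 (by norm_num)).map _
  have hmem : (1 - ν) / (ν + 1) ∈ spectrum ℂ M := by
    rw [spectrum.mem_iff]
    intro h0
    apply hν'
    have e2 : (ν - 1) • (1 : Matrix (Fin n) (Fin n) ℂ) + (ν + 1) • M
        = -(ν + 1) • (algebraMap ℂ (Matrix (Fin n) (Fin n) ℂ) ((1 - ν) / (ν + 1)) - M) := by
      rw [Algebra.algebraMap_eq_smul_one, smul_sub, smul_smul]
      have : -(ν + 1) * ((1 - ν) / (ν + 1)) = ν - 1 := by field_simp; ring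
      rw [this]
      module
    rw [e2]
    rw [Algebra.smul_def (-(ν + 1))]
    exact ((isUnit_iff_ne_zero.2 (neg_ne_zero.2 hne)).map _).mul h0
  have hre := hM _ hmem
  rw [Complex.div_re, ← add_div] at hre
  have hns : 0 < Complex.normSq (ν + 1) := Complex.normSq_pos.2 hne
  have hnum := (div_pos_iff_of_pos_right hns).1 hre
  simp only [Complex.sub_re, Complex.one_re, Complex.add_re, Complex.sub_im, Complex.one_im,
    Complex.add_im] at hnum
  have h2 : ‖ν‖ ^ 2 < 1 := by
    rw [← Complex.normSq_eq_norm_sq, Complex.normSq_apply]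
    nlinarith
  nlinarith [norm_nonneg ν]

/-- A matrix as an operator on Euclidean space. -/
noncomputable abbrev euclCLM (M : Matrix (Fin n) (Fin n) ℂ) :
    EuclideanSpace ℂ (Fin n) →L[ℂ] EuclideanSpace ℂ (Fin n) :=
  Matrix.toEuclideanCLM (n := Fin n) (𝕜 := ℂ) M

lemma contDiff_euclCLM {k : ℕ∞} {M : ℝ → Matrix (Fin n) (Fin n) ℂ}
    (hM : ∀ i j, ContDiff ℝ k fun x => M x i j) : ContDiff ℝ k fun x => euclCLM (M x) := by
  have e : (fun x => euclCLM (M x))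
      = fun x => ∑ i, ∑ j, M x i j • euclCLM (Matrix.single i j 1) := by
    funext x
    conv_lhs => rw [Matrix.matrix_eq_sum_single (M x)]
    simp only [euclCLM, map_sum]
    refine Finset.sum_congr rfl fun i _ => Finset.sum_congr rfl fun j _ => ?_
    rw [← map_smul, Matrix.smul_single, smul_eq_mul, mul_one]
  rw [e]
  exact ContDiff.sum fun i _ => ContDiff.sum fun j _ => (hM i j).smul contDiff_const

/-- The symmetrizer `∑_{k<K} (C^k)ᴴ C^k` for the Cayley transform `C`. -/
noncomputable def symmetrizer (K : ℕ) (M : Matrix (Fin n) (Fin n) ℂ) : Matrix (Fin n) (Fin n) ℂ :=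
  ∑ k ∈ Finset.range K, (cayley M ^ k)ᴴ * cayley M ^ k

lemma inner_symmetrizer (K : ℕ) (M : Matrix (Fin n) (Fin n) ℂ) (v w : EuclideanSpace ℂ (Fin n)) :
    ⟪euclCLM (symmetrizer K M) v, w⟫_ℂ
      = ∑ k ∈ Finset.range K, ⟪euclCLM (cayley M ^ k) v, euclCLM (cayley M ^ k) w⟫_ℂ := by
  have hsum : euclCLM (symmetrizer K M)
      = ∑ k ∈ Finset.range K, euclCLM ((cayley M ^ k)ᴴ * cayley M ^ k) := map_sum _ _ _
  have hk : ∀ k, euclCLM ((cayley M ^ k)ᴴ * cayley M ^ k) v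
      = ContinuousLinearMap.adjoint (euclCLM (cayley M ^ k)) (euclCLM (cayley M ^ k) v) := by
    intro k
    have h1 : euclCLM ((cayley M ^ k)ᴴ * cayley M ^ k)
        = euclCLM (star (cayley M ^ k)) * euclCLM (cayley M ^ k) := map_mul _ _ _
    have h2 : euclCLM (star (cayley M ^ k)) = star (euclCLM (cayley M ^ k)) := map_star _ _
    rw [h1, h2]
    rfl
  rw [hsum, _root_.sum_apply, sum_inner]
  refine Finset.sum_congr rfl fun k _ => ?_
  rw [hk, ContinuousLinearMap.adjoint_inner_left]

/-- Polarization 4 Re⟪a, b⟫ = ‖a + b‖² - ‖a - b‖² with a = C^k v and b = C^k M v: since C (1 + M) =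
1 - M, these are C^k (1 + M) v and C^(k+1) (1 + M) v up to norm, and the sum telescopes. Stopping at
K leaves a finite sum, whose smoothness in x is immediate, and it is coercive once ‖C^K‖ < 1. -/
lemma four_mul_re_inner_symmetrizer (K : ℕ) {M : Matrix (Fin n) (Fin n) ℂ}
    (hM : ∀ μ ∈ spectrum ℂ M, 0 < μ.re) (v : EuclideanSpace ℂ (Fin n)) :
    4 * (⟪euclCLM (symmetrizer K M) v, euclCLM M v⟫_ℂ).re
      = ‖euclCLM (1 + M) v‖ ^ 2 - ‖euclCLM (cayley M ^ K) (euclCLM (1 + M) v)‖ ^ 2 := by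
  have hdet : IsUnit (1 + M).det := (Matrix.isUnit_iff_isUnit_det _).1 (isUnit_one_add hM)
  have hadd : ∀ k, euclCLM (cayley M ^ k) (euclCLM (1 + M) v)
      = euclCLM (cayley M ^ k) v + euclCLM (cayley M ^ k) (euclCLM M v) := by
    intro k
    simp only [euclCLM, map_add, map_one, _root_.add_apply, one_apply_eq_self]
  have hsub : ∀ k, euclCLM (cayley M ^ (k + 1)) (euclCLM (1 + M) v)
      = euclCLM (cayley M ^ k) v - euclCLM (cayley M ^ k) (euclCLM M v) := by
    intro k
    have e : cayley M ^ (k + 1) * (1 + M) = cayley M ^ k * (1 - M) := by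
      rw [pow_succ, mul_assoc]
      congr 1
      rw [cayley, mul_assoc, Matrix.nonsing_inv_mul _ hdet, mul_one]
    have e2 := congrArg (fun N => euclCLM N v) e
    simp only [euclCLM, map_mul, mul_apply_eq_comp] at e2
    simp only [euclCLM]
    rw [e2]
    simp only [map_sub, map_one, _root_.sub_apply, one_apply_eq_self]
  have hk : ∀ k, 4 * (⟪euclCLM (cayley M ^ k) v, euclCLM (cayley M ^ k) (euclCLM M v)⟫_ℂ).re
      = ‖euclCLM (cayley M ^ k) (euclCLM (1 + M) v)‖ ^ 2
        - ‖euclCLM (cayley M ^ (k + 1)) (euclCLM (1 + M) v)‖ ^ 2 := by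
    intro k
    rw [hadd, hsub, norm_add_sq (𝕜 := ℂ), norm_sub_sq (𝕜 := ℂ)]
    simp only [RCLike.re_eq_complex_re]
    ring
  rw [inner_symmetrizer, Complex.re_sum, Finset.mul_sum]
  simp only [hk]
  rw [Finset.sum_range_sub']
  simp [euclCLM]

end Symmetrizer

/-! ### A symmetrizer valid over the whole period -/

section Bound

variable {n : ℕ} {B A : ℝ → Matrix (Fin n) (Fin n) ℝ} {T : ℝ}

lemma contDiff_cayley_pow (h : ParabolicCoeffs B A T) (k : ℕ) (i j : Fin n) :
    ContDiff ℝ 1 fun x => (cayley (complexify (B x)) ^ k) i j := by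
  have hB : ∀ i j, ContDiff ℝ 1 fun x => complexify (B x) i j := fun i j => by
    exact Complex.ofRealCLM.contDiff.comp (h.contDiff_B i j)
  have hadd : ∀ i j, ContDiff ℝ 1 fun x => (1 + complexify (B x)) i j := fun i j => by
    simpa using contDiff_const.add (hB i j)
  have hsub : ∀ i j, ContDiff ℝ 1 fun x => (1 - complexify (B x)) i j := fun i j => by
    simpa using contDiff_const.sub (hB i j)
  have hC : ∀ i j, ContDiff ℝ 1 fun x => cayley (complexify (B x)) i j :=
    contDiff_matrix_mul (k := 1) hsub (contDiff_matrix_inv (k := 1) hadd fun x =>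
      ((Matrix.isUnit_iff_isUnit_det _).1 (isUnit_one_add (h.spectrum_B x))).ne_zero)
  induction k generalizing i j with
  | zero => simpa using contDiff_const
  | succ k ih =>
    simp only [pow_succ]
    exact contDiff_matrix_mul (k := 1) ih hC i j

lemma contDiff_symmetrizer (h : ParabolicCoeffs B A T) (K : ℕ) (i j : Fin n) :
    ContDiff ℝ 1 fun x => symmetrizer K (complexify (B x)) i j := by
  simp only [symmetrizer, Matrix.sum_apply]
  refine ContDiff.sum fun k _ => ?_
  refine contDiff_matrix_mul (k := 1) (fun i j => ?_) (contDiff_cayley_pow h k) i j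
  simp only [Matrix.conjTranspose_apply]
  exact (Complex.conjCLE.contDiff).comp (contDiff_cayley_pow h k j i)

/-- Some power of the Cayley transform of `B` is a uniform strict contraction. -/
lemma exists_uniform_contraction (h : ParabolicCoeffs B A T) :
    ∃ K, 0 < K ∧ ∀ x, ‖euclCLM (cayley (complexify (B x)) ^ K)‖ < 1 := by
  have hcont : ∀ k, Continuous fun x => euclCLM (cayley (complexify (B x)) ^ k) := fun k =>
    (contDiff_euclCLM (k := 1) (contDiff_cayley_pow h k)).continuous
  have hpt : ∀ x, ∃ k, 0 < k ∧ ‖euclCLM (cayley (complexify (B x)) ^ k)‖ < 1 := by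
    intro x
    obtain ⟨k, hk, hlt⟩ := exists_norm_pow_lt_one (euclCLM (cayley (complexify (B x)))) (by
      intro ν hν
      rw [euclCLM, AlgEquiv.spectrum_eq] at hν
      exact norm_lt_one_of_mem_spectrum_cayley (h.spectrum_B x) hν)
    exact ⟨k, hk, by rwa [euclCLM, map_pow]⟩
  choose k hk0 hk using hpt
  obtain ⟨s, -, hs⟩ := (isCompact_Icc (a := (0 : ℝ)) (b := T)).elim_nhds_subcover
    (fun x => {y | ‖euclCLM (cayley (complexify (B y)) ^ k x)‖ < 1})
    (fun x _ => (isOpen_lt (hcont (k x)).norm continuous_const).mem_nhds (hk x))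
  -- A common multiple of the finitely many local exponents works everywhere, since powers of a
  -- strict contraction are strict contractions.
  refine ⟨∏ x ∈ s, k x, Finset.prod_pos fun x _ => hk0 x, fun x => ?_⟩
  obtain ⟨y, hy, hxy⟩ := (show Function.Periodic
      (fun x => euclCLM (cayley (complexify (B x)) ^ ∏ x ∈ s, k x)) T from
    fun x => by simp only [h.periodic_B x]).exists_mem_Ico₀ h.pos x
  rw [hxy]
  obtain ⟨z, hz, hyz⟩ := Set.mem_iUnion₂.1 (hs ⟨hy.1, hy.2.le⟩)
  obtain ⟨l, hl⟩ := Finset.dvd_prod_of_mem k hz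
  have hl0 : l ≠ 0 := by
    rintro rfl
    exact (Finset.prod_pos fun x (_ : x ∈ s) => hk0 x).ne' (by simpa using hl)
  rw [hl, pow_mul, euclCLM, map_pow]
  exact (norm_pow_le' _ (Nat.pos_of_ne_zero hl0)).trans_lt (pow_lt_one₀ (norm_nonneg _) hyz hl0)

lemma exists_bound_of_periodic {F : Type*} [NormedAddCommGroup F] {g : ℝ → F} (hg : Continuous g)
    (hT : 0 < T) (hper : Function.Periodic g T) : ∃ K, ∀ x, ‖g x‖ ≤ K := by
  obtain ⟨K, hK⟩ := (hper.isBounded_of_continuous hT.ne' hg).exists_norm_le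
  exact ⟨K, fun x => hK _ ⟨x, rfl⟩⟩

end Bound

end PeriodicEvans

namespace PeriodicEvans

/-! ### The a priori bound for periodic eigenvalues with nonnegative real part -/

section EigenvalueBound

open scoped InnerProductSpace

variable {n : ℕ} {B A : ℝ → Matrix (Fin n) (Fin n) ℝ} {T : ℝ}

lemma hasDerivAt_toLp {v : ℝ → Fin n → ℂ} {v' : Fin n → ℂ} {x : ℝ} (hv : HasDerivAt v v' x) :
    HasDerivAt (fun x => WithLp.toLp 2 (v x)) (WithLp.toLp 2 v') x :=
  ((PiLp.continuousLinearEquiv 2 ℝ fun _ : Fin n => ℂ).symm.hasFDerivAt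
    (x := v x)).comp_hasDerivAt x hv

/-- With q = ‖C^K‖ < 1, four times the real part is at least (1 - q²) ‖(1 + B) v‖², and (1 + B)⁻¹
recovers v. Continuity and periodicity make the constants uniform in x. -/
lemma exists_coercive (h : ParabolicCoeffs B A T) : ∃ K, 0 < K ∧ ∃ c > 0,
    ∀ x v, c * ‖v‖ ^ 2 ≤
      (⟪euclCLM (symmetrizer K (complexify (B x))) v, euclCLM (complexify (B x)) v⟫_ℂ).re := by
  obtain ⟨K, hK0, hK⟩ := exists_uniform_contraction h
  have hB : ∀ i j, ContDiff ℝ 1 fun x => complexify (B x) i j := fun i j =>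
    Complex.ofRealCLM.contDiff.comp (h.contDiff_B i j)
  have hadd : ∀ i j, ContDiff ℝ 1 fun x => (1 + complexify (B x)) i j := fun i j => by
    simpa using contDiff_const.add (hB i j)
  have hu : ∀ x, IsUnit (1 + complexify (B x)).det := fun x =>
    (Matrix.isUnit_iff_isUnit_det _).1 (isUnit_one_add (h.spectrum_B x))
  have hcI : Continuous fun x => euclCLM ((1 + complexify (B x))⁻¹) :=
    (contDiff_euclCLM (k := 1) (contDiff_matrix_inv (k := 1) hadd fun x => (hu x).ne_zero)).continuous
  have hcC : Continuous fun x => euclCLM (cayley (complexify (B x)) ^ K) :=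
    (contDiff_euclCLM (k := 1) (contDiff_cayley_pow h K)).continuous
  have hpos : ∀ x, 0 < 1 - ‖euclCLM (cayley (complexify (B x)) ^ K)‖ ^ 2 := by
    intro x
    have := hK x
    have h0 := norm_nonneg (euclCLM (cayley (complexify (B x)) ^ K))
    nlinarith
  obtain ⟨L, hL⟩ := exists_bound_of_periodic
    (g := fun x => ‖euclCLM ((1 + complexify (B x))⁻¹)‖ ^ 2
      / (1 - ‖euclCLM (cayley (complexify (B x)) ^ K)‖ ^ 2))
    ((hcI.norm.pow 2).div (continuous_const.sub (hcC.norm.pow 2)) fun x => (hpos x).ne') h.pos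
    (fun x => by simp only [h.periodic_B x])
  have hL0 : 0 ≤ L := (norm_nonneg _).trans (hL 0)
  -- L bounds ‖(1 + B)⁻¹‖² / (1 - q²); the `+ 1` avoids dividing by zero when L = 0.
  refine ⟨K, hK0, 1 / (4 * (L + 1)), by positivity, fun x v => ?_⟩
  have h4 := four_mul_re_inner_symmetrizer K (h.spectrum_B x) v
  set y := euclCLM (1 + complexify (B x)) v with hy
  set q := ‖euclCLM (cayley (complexify (B x)) ^ K)‖
  have hv : v = euclCLM ((1 + complexify (B x))⁻¹) y := by
    have e : euclCLM ((1 + complexify (B x))⁻¹) * euclCLM (1 + complexify (B x)) = 1 := by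
      have : euclCLM ((1 + complexify (B x))⁻¹ * (1 + complexify (B x)))
          = euclCLM ((1 + complexify (B x))⁻¹) * euclCLM (1 + complexify (B x)) := map_mul _ _ _
      rw [← this, Matrix.nonsing_inv_mul _ (hu x)]
      exact map_one _
    exact (DFunLike.congr_fun e v).symm
  have h1 : ‖v‖ ≤ ‖euclCLM ((1 + complexify (B x))⁻¹)‖ * ‖y‖ := by
    conv_lhs => rw [hv]
    exact ContinuousLinearMap.le_opNorm _ _
  have h2 : ‖euclCLM ((1 + complexify (B x))⁻¹)‖ ^ 2 ≤ L * (1 - q ^ 2) := by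
    have := (le_abs_self _).trans (hL x)
    exact (div_le_iff₀ (hpos x)).1 this
  have h3 : ‖euclCLM (cayley (complexify (B x)) ^ K) y‖ ^ 2 ≤ q ^ 2 * ‖y‖ ^ 2 := by
    rw [← mul_pow]
    gcongr
    exact ContinuousLinearMap.le_opNorm _ _
  have h5 : ‖v‖ ^ 2 ≤ L * ((1 - q ^ 2) * ‖y‖ ^ 2) := by
    calc ‖v‖ ^ 2 ≤ (‖euclCLM ((1 + complexify (B x))⁻¹)‖ * ‖y‖) ^ 2 := by gcongr
      _ = ‖euclCLM ((1 + complexify (B x))⁻¹)‖ ^ 2 * ‖y‖ ^ 2 := mul_pow _ _ _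
      _ ≤ L * (1 - q ^ 2) * ‖y‖ ^ 2 := by gcongr
      _ = _ := by ring
  have h6 : 0 ≤ (1 - q ^ 2) * ‖y‖ ^ 2 := mul_nonneg (hpos x).le (sq_nonneg _)
  rw [div_mul_eq_mul_div, one_mul, div_le_iff₀ (by positivity)]
  nlinarith

/-- Eigenvalues of `L` in the closed right half-plane are uniformly bounded. -/
theorem exists_eigenvalue_bound (h : ParabolicCoeffs B A T) : ∃ R, ∀ lam : ℂ, 0 ≤ lam.re →
    ∀ v ∈ periodicDomain n T, v ≠ 0 → linOp B A v = lam • v → ‖lam‖ ≤ R := by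
  obtain ⟨K, hK, c, hc, hco⟩ := exists_coercive h
  have hS1 := contDiff_euclCLM (k := 1) (contDiff_symmetrizer h K)
  set S := fun x => euclCLM (symmetrizer K (complexify (B x))) with hS
  have hBc : Continuous fun x => euclCLM (complexify (B x)) :=
    (contDiff_euclCLM (k := 1) fun i j =>
      Complex.ofRealCLM.contDiff.comp (h.contDiff_B i j)).continuous
  have hAc : Continuous fun x => euclCLM (complexify (A x)) :=
    (contDiff_euclCLM (k := 1) fun i j =>
      Complex.ofRealCLM.contDiff.comp (h.contDiff_A i j)).continuous
  have hSper : Function.Periodic S T := fun x => by simp only [hS, h.periodic_B x]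
  have hS'c : Continuous (deriv S) := hS1.continuous_deriv le_rfl
  have hS'per : Function.Periodic (deriv S) T := fun x => by
    rw [← deriv_comp_add_const]
    simp only [hSper _]
  obtain ⟨M₁, h₁⟩ := exists_bound_of_periodic hS1.continuous h.pos hSper
  obtain ⟨M₂, h₂⟩ := exists_bound_of_periodic hS'c h.pos hS'per
  obtain ⟨M₃, h₃⟩ := exists_bound_of_periodic hBc h.pos fun x => by simp only [h.periodic_B x]
  obtain ⟨M₄, h₄⟩ := exists_bound_of_periodic hAc h.pos fun x => by simp only [h.periodic_A x]
  set M := max (max M₁ M₂) (max M₃ M₄)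
  refine ⟨2 * M ^ 2 * (1 + 2 / c * (2 * M ^ 4 / c + M ^ 2)), fun lam hlam v hv hv0 heq => ?_⟩
  obtain ⟨hv2, hper⟩ := hv
  have hvd : ∀ x, HasDerivAt v (deriv v x) x := fun x =>
    (hv2.differentiable two_ne_zero x).hasDerivAt
  have hv1 : ContDiff ℝ 1 (deriv v) := (contDiff_succ_iff_deriv (n := 1).1 hv2).2.2
  have hvd' : ∀ x, HasDerivAt (deriv v) (deriv (deriv v) x) x := fun x =>
    (hv1.differentiable one_ne_zero x).hasDerivAt
  have hper' : Function.Periodic (deriv v) T := periodic_deriv hper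
  have e0 : ∀ {β : Type} {g : ℝ → β}, Function.Periodic g T → g T = g 0 := fun hg => by
    simpa using hg 0
  refine eigenvalue_bound (S := S) (S' := deriv S) (Bx := fun x => euclCLM (complexify (B x)))
    (Ax := fun x => euclCLM (complexify (A x))) (v := fun x => WithLp.toLp 2 (v x))
    (v' := fun x => WithLp.toLp 2 (deriv v x)) h.pos hc
    (fun x => (h₁ x).trans (by simp [M])) (fun x => (h₂ x).trans (by simp [M]))
    (fun x => (h₃ x).trans (by simp [M])) (fun x => (h₄ x).trans (by simp [M]))
    (fun x => (hS1.differentiable one_ne_zero x).hasDerivAt) hS'c hBc hAc hco ?_ ?_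
    (fun x => hasDerivAt_toLp (hvd x)) ?_ ?_ ?_ ?_ ?_ hlam
  · intro x w
    simp only [hS]
    rw [inner_symmetrizer, Complex.re_sum]
    have h0 : ∀ k ∈ Finset.range K, 0 ≤ (⟪euclCLM (cayley (complexify (B x)) ^ k) w,
        euclCLM (cayley (complexify (B x)) ^ k) w⟫_ℂ).re := fun k _ => inner_self_nonneg (𝕜 := ℂ)
    -- All summands are nonnegative and the one with k = 0, present because K > 0, is already ‖w‖².
    refine le_trans ?_ (Finset.single_le_sum h0 (Finset.mem_range.2 hK))
    rw [pow_zero]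
    have : euclCLM (1 : Matrix (Fin n) (Fin n) ℂ) w = w := by simp [euclCLM]
    rw [this, inner_self_eq_norm_sq_to_K]
    norm_cast
  · intro x w
    simp only [hS]
    rw [inner_symmetrizer, Complex.im_sum]
    exact Finset.sum_eq_zero fun k _ => inner_self_im (𝕜 := ℂ) _
  · exact (PiLp.continuousLinearEquiv 2 ℝ fun _ : Fin n => ℂ).symm.continuous.comp hv1.continuous
  · intro x
    have h1 := (hasDerivAt_mulVec (hasDerivAt_complexify h.contDiff_B x) (hvd' x)).sub
      (hasDerivAt_mulVec (hasDerivAt_complexify h.contDiff_A x) (hvd x))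
    rw [← linOp_eq h hvd (hvd' x), heq] at h1
    exact hasDerivAt_toLp h1
  · rw [e0 hSper, e0 hper]
  · rw [e0 h.periodic_B, e0 h.periodic_A, e0 hper, e0 hper']
  · obtain ⟨x, hx⟩ := Function.ne_iff.1 hv0
    obtain ⟨y, hy, hxy⟩ := hper.exists_mem_Ico₀ h.pos x
    refine ⟨y, ⟨hy.1, hy.2.le⟩, ?_⟩
    rw [← hxy]
    simpa using hx

end EigenvalueBound

end PeriodicEvans

namespace PeriodicEvans

/-! ### Parity of the number of zeros of a real entire function in the right half-plane -/

section Parity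

open ComplexConjugate

variable {D : ℂ → ℂ} {R : ℝ}

lemma exists_norm_large (R : ℝ) : ∃ r : ℝ, 0 < r ∧ R < r := ⟨max R 0 + 1, by positivity, by
  have := le_max_left R 0
  linarith⟩

lemma analyticOrderAt_ne_top_of_bounded_zeros (hD : Differentiable ℂ D)
    (hR : ∀ z : ℂ, 0 ≤ z.re → R < ‖z‖ → D z ≠ 0) (z : ℂ) : analyticOrderAt D z ≠ ⊤ := by
  intro htop
  rw [analyticOrderAt_eq_top] at htop
  have h0 : D = 0 := AnalyticOnNhd.eq_of_frequently_eq (z₀ := z)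
    (fun w _ => hD.analyticAt w) (fun w _ => analyticAt_const)
    (htop.filter_mono nhdsWithin_le_nhds).frequently
  obtain ⟨r, hr0, hr⟩ := exists_norm_large R
  refine hR r (by simpa using hr0.le) ?_ (congrFun h0 _)
  rwa [Complex.norm_real, Real.norm_eq_abs, abs_of_pos hr0]

/-- The zeros lie in a compact ball; an accumulation point would force D to vanish identically,
contradicting its nonvanishing at large positive reals. -/
lemma finite_zeros (hD : Differentiable ℂ D) (hR : ∀ z : ℂ, 0 ≤ z.re → R < ‖z‖ → D z ≠ 0) :
    {z : ℂ | 0 ≤ z.re ∧ D z = 0}.Finite := by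
  by_contra hinf
  obtain ⟨x, -, hx⟩ := Set.Infinite.exists_accPt_of_subset_isCompact hinf
    (isCompact_closedBall (0 : ℂ) R) (fun z hz => by
      rw [mem_closedBall_zero_iff]
      by_contra! hlt
      exact hR z hz.1 hlt hz.2)
  rw [accPt_iff_frequently_nhdsNE] at hx
  refine analyticOrderAt_ne_top_of_bounded_zeros hD hR x ?_
  rw [analyticOrderAt_eq_top]
  exact (hD.analyticAt x).frequently_zero_iff_eventually_zero.1 (hx.mono fun z hz => hz.2)

lemma exists_entire_factor {f : ℂ → ℂ} (hf : Differentiable ℂ f) {a : ℂ} {m : ℕ}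
    (hm : analyticOrderAt f a = m) :
    ∃ g : ℂ → ℂ, Differentiable ℂ g ∧ g a ≠ 0 ∧ ∀ z, f z = (z - a) ^ m * g z := by
  obtain ⟨g₀, hg₀, hne, heq⟩ := (hf.analyticAt a).analyticOrderAt_eq_natCast.1 hm
  classical
  set g : ℂ → ℂ := fun z => if z = a then g₀ a else f z / (z - a) ^ m with hg
  have hga : g a = g₀ a := by simp [hg]
  have hgz : ∀ z, z ≠ a → g z = f z / (z - a) ^ m := fun z hz => by simp [hg, hz]
  have hloc : g =ᶠ[𝓝 a] g₀ := by
    filter_upwards [heq] with z hz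
    by_cases h : z = a
    · rw [h, hga]
    · rw [hgz z h, hz, smul_eq_mul, mul_div_cancel_left₀ _ (pow_ne_zero _ (sub_ne_zero.2 h))]
  refine ⟨g, fun z => ?_, by rwa [hga], fun z => ?_⟩
  · by_cases h : z = a
    · rw [h]
      exact hg₀.differentiableAt.congr_of_eventuallyEq hloc
    · have : g =ᶠ[𝓝 z] fun z => f z / (z - a) ^ m := by
        filter_upwards [isOpen_ne.mem_nhds h] with w hw using hgz w hw
      refine DifferentiableAt.congr_of_eventuallyEq ?_ this
      exact (hf z).div (by fun_prop) (pow_ne_zero _ (sub_ne_zero.2 h))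
  · by_cases h : z = a
    · have := heq.self_of_nhds
      rw [h, this, hga, smul_eq_mul]
    · rw [hgz z h, mul_div_cancel₀ _ (pow_ne_zero _ (sub_ne_zero.2 h))]

/-- If g is the nonvanishing cofactor at a, its reflection z ↦ conj (g (conj z)) is one at the
conjugate point. -/
lemma analyticOrderAt_conj (hD : Differentiable ℂ D) (hconj : ∀ z, D (conj z) = conj (D z))
    {a : ℂ} (ha : analyticOrderAt D a ≠ ⊤) :
    analyticOrderAt D (conj a) = analyticOrderAt D a := by
  obtain ⟨m, hm⟩ := ENat.ne_top_iff_exists.1 ha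
  obtain ⟨g, hg, hga, hfac⟩ := exists_entire_factor hD hm.symm
  rw [← hm, (hD.analyticAt _).analyticOrderAt_eq_natCast]
  have hg' : Differentiable ℂ (conj ∘ g ∘ conj) := fun z => by
    have := (hg (conj z)).conj_conj
    simpa using this
  refine ⟨conj ∘ g ∘ conj, hg'.analyticAt _, by simpa using hga, Eventually.of_forall fun z => ?_⟩
  have := hconj (conj z)
  rw [Complex.conj_conj] at this
  rw [this, hfac]
  simp

lemma exists_factorization (hD : Differentiable ℂ D) (hord : ∀ z, analyticOrderAt D z ≠ ⊤)
    (S : Finset ℂ) : ∃ g : ℂ → ℂ, Differentiable ℂ g ∧ (∀ a ∈ S, g a ≠ 0) ∧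
      ∀ z, D z = (∏ a ∈ S, (z - a) ^ analyticOrderNatAt D a) * g z := by
  classical
  induction S using Finset.induction_on with
  | empty => exact ⟨D, hD, by simp, by simp⟩
  | insert a S ha ih =>
    obtain ⟨g, hg, hgS, hfac⟩ := ih
    have hpa : analyticOrderAt (fun z => ∏ b ∈ S, (z - b) ^ analyticOrderNatAt D b) a = 0 := by
      rw [analyticOrderAt_eq_zero]
      right
      exact Finset.prod_ne_zero_iff.2 fun b hb => pow_ne_zero _ (sub_ne_zero.2 (by
        rintro rfl
        exact ha hb))
    have hm : analyticOrderAt g a = analyticOrderNatAt D a := by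
      have e : D = (fun z => ∏ b ∈ S, (z - b) ^ analyticOrderNatAt D b) * g := funext hfac
      have := analyticOrderAt_mul (z₀ := a)
        (f := fun z => ∏ b ∈ S, (z - b) ^ analyticOrderNatAt D b) (g := g)
        (Differentiable.analyticAt (by fun_prop) a) (hg.analyticAt a)
      rw [← e, hpa, zero_add] at this
      rw [← this, Nat.cast_analyticOrderNatAt (hord a)]
    obtain ⟨k, hk, hka, hkfac⟩ := exists_entire_factor hg hm
    refine ⟨k, hk, fun b hb => ?_, fun z => ?_⟩
    · rcases Finset.mem_insert.1 hb with rfl | hb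
      · exact hka
      · have := hgS b hb
        rw [hkfac] at this
        exact right_ne_zero_of_mul this
    · rw [hfac, hkfac, Finset.prod_insert ha]
      ring

lemma mul_pos_of_preconnected {G : ℝ → ℝ} (hG : Continuous G) (h0 : ∀ x, 0 < x → G x ≠ 0) {x y : ℝ}
    (hx : 0 < x) (hy : 0 < y) : 0 < G x * G y := by
  have hpre : IsPreconnected (G '' Set.Ioi 0) := isPreconnected_Ioi.image G hG.continuousOn
  by_contra! hle
  have hx' := h0 x hx
  have hy' := h0 y hy
  have hmem : (0 : ℝ) ∈ G '' Set.Ioi 0 := by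
    rcases lt_or_gt_of_ne hx' with hlt | hgt
    · have : 0 < G y := lt_of_le_of_ne (by nlinarith) hy'.symm
      exact hpre.ordConnected.out ⟨x, hx, rfl⟩ ⟨y, hy, rfl⟩ ⟨hlt.le, this.le⟩
    · have : G y < 0 := lt_of_le_of_ne (by nlinarith) hy'
      exact hpre.ordConnected.out ⟨y, hy, rfl⟩ ⟨x, hx, rfl⟩ ⟨this.le, hgt.le⟩
  obtain ⟨z, hz, hz0⟩ := hmem
  exact h0 z hz hz0

lemma im_eq_zero_of_conj (hconj : ∀ z, D (conj z) = conj (D z)) (r : ℝ) : (D r).im = 0 := by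
  have := hconj r
  rw [Complex.conj_ofReal] at this
  exact Complex.conj_eq_iff_im.1 this.symm

/-- The sign of a real entire function changes across its positive zeros according to the number of
these zeros, counted with multiplicity. -/
lemma sign_change (hD : Differentiable ℂ D) (hconj : ∀ z, D (conj z) = conj (D z))
    (hord : ∀ z, analyticOrderAt D z ≠ ⊤) (S : Finset ℂ)
    (hS : ∀ z, z ∈ S ↔ 0 < z.re ∧ z.im = 0 ∧ D z = 0) {x y : ℝ} (hx : 0 < x)
    (hxS : ∀ a ∈ S, x < a.re) (hyS : ∀ a ∈ S, a.re < y) (hy : 0 < y) :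
    0 < (-1) ^ (∑ a ∈ S, analyticOrderNatAt D a) * ((D x).re * (D y).re) := by
  obtain ⟨g, hg, hgS, hfac⟩ := exists_factorization hD hord S
  have hreal : ∀ a ∈ S, (a.re : ℂ) = a := fun a ha =>
    Complex.ext rfl (by simp [((hS a).1 ha).2.1])
  set p : ℝ → ℝ := fun t => ∏ a ∈ S, (t - a.re) ^ analyticOrderNatAt D a with hp
  have hpc : ∀ t : ℝ, D t = (p t : ℂ) * g t := by
    intro t
    rw [hfac, hp]
    congr 1
    push_cast
    refine Finset.prod_congr rfl fun a ha => ?_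
    rw [hreal a ha]
  have hDre : ∀ t : ℝ, (D t).re = p t * (g t).re := by
    intro t
    rw [hpc, Complex.re_ofReal_mul]
  have hgc : Continuous fun t : ℝ => g t := hg.continuous.comp Complex.continuous_ofReal
  -- Where the real polynomial p is nonzero, g = D/p is real; the finitely many roots are filled in
  -- by continuity.
  have him : ∀ t : ℝ, (g t).im = 0 := by
    have hdense : Dense ((↑(S.image Complex.re) : Set ℝ)ᶜ) :=
      Set.Countable.dense_compl ℝ (Finset.countable_toSet _)
    have hcl : IsClosed {t : ℝ | (g t).im = 0} :=
      isClosed_eq (Complex.continuous_im.comp hgc) continuous_const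
    have hsub : ((↑(S.image Complex.re) : Set ℝ)ᶜ) ⊆ {t : ℝ | (g t).im = 0} := by
      intro t ht
      have h1 := im_eq_zero_of_conj hconj t
      rw [hpc, Complex.im_ofReal_mul] at h1
      refine (mul_eq_zero.1 h1).resolve_left ?_
      refine Finset.prod_ne_zero_iff.2 fun a ha => pow_ne_zero _ (sub_ne_zero.2 ?_)
      rintro rfl
      exact ht (by simpa using ⟨a, ha, rfl⟩)
    intro t
    exact (hcl.closure_subset_iff.2 hsub) (hdense t)
  have hG0 : ∀ t : ℝ, 0 < t → (g t).re ≠ 0 := by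
    intro t ht h0
    have hg0 : g t = 0 := Complex.ext h0 (him t)
    have hDt : D t = 0 := by rw [hpc, hg0, mul_zero]
    exact hgS t ((hS t).2 ⟨by simpa using ht, by simp, hDt⟩) hg0
  have hG := mul_pos_of_preconnected (Complex.continuous_re.comp hgc) hG0 hx hy
  simp only [Function.comp_apply] at hG
  have hpy : 0 < p y := Finset.prod_pos fun a ha => pow_pos (sub_pos.2 (hyS a ha)) _
  -- To the left of all roots each linear factor is negative, so p(x) carries one sign per zero,
  -- with multiplicity. To the right p is positive, and g has no zeros on the positive axis.
  have hpx : 0 < (-1) ^ (∑ a ∈ S, analyticOrderNatAt D a) * p x := by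
    rw [hp, ← Finset.prod_pow_eq_pow_sum, ← Finset.prod_mul_distrib]
    refine Finset.prod_pos fun a ha => ?_
    rw [← mul_pow]
    exact pow_pos (by linarith [hxS a ha]) _
  rw [hDre, hDre]
  have := mul_pos (mul_pos hpx hpy) hG
  linarith

/-- Near `0` the sign is that of the first possibly nonzero derivative. -/
lemma sign_near_zero (hD : Differentiable ℂ D) {m : ℕ} (hm : (m : ℕ∞) ≤ analyticOrderAt D 0)
    (hc : (iteratedDeriv m D 0).re ≠ 0) :
    ∀ᶠ x : ℝ in 𝓝[>] 0, 0 < (iteratedDeriv m D 0).re * (D x).re := by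
  -- Only order at least m is given, so D = z^m g with g(0) possibly zero; `hc` rules this out,
  -- because the m-th derivative at 0 is m! g(0).
  obtain ⟨g, hg, heq⟩ := (natCast_le_analyticOrderAt (hD.analyticAt 0)).1 hm
  have hval : iteratedDeriv m D 0 = (Nat.factorial m : ℂ) * g 0 := by
    obtain ⟨q, hq⟩ := hg
    have hgs : HasSeriesAt g (PowerSeries.mk fun j => q.coeff j) 0 := by
      rw [hasFPowerSeriesAt_iff] at hq
      simpa [HasSeriesAt] using hq
    have hX : HasSeriesAt (fun z => z ^ m) (PowerSeries.X ^ m) 0 := by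
      refine Eventually.of_forall fun t => ?_
      have := hasSum_single (f := fun j => t ^ j • PowerSeries.coeff j
        ((PowerSeries.X : PowerSeries ℂ) ^ m)) m (fun j hj => by
          simp [PowerSeries.coeff_X_pow, hj])
      simpa using this
    have hs := hX.mul hgs
    have hDs : HasSeriesAt D (PowerSeries.X ^ m * PowerSeries.mk fun j => q.coeff j) 0 := by
      have h0 : ∀ᶠ t in 𝓝 (0 : ℂ), D (0 + t) = (0 + t) ^ m * g (0 + t) := by
        filter_upwards [heq] with z hz
        simpa using hz
      filter_upwards [hs, h0] with t h1 h2
      rw [h2]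
      exact h1
    rw [hDs.iteratedDeriv_eq, PowerSeries.coeff_X_pow_mul', if_pos le_rfl, Nat.sub_self]
    congr 1
    have h0 := hgs.self_of_nhds
    have h1 := HasSum.hasSum_at_zero (𝕜 := ℂ)
      (fun j => PowerSeries.coeff j (PowerSeries.mk fun j => q.coeff j))
    have := h0.unique h1
    simpa using this.symm
  have hre : (iteratedDeriv m D 0).re = (Nat.factorial m : ℝ) * (g 0).re := by
    rw [hval, ← Complex.ofReal_natCast, Complex.re_ofReal_mul]
  have hfac : (0 : ℝ) < Nat.factorial m := Nat.cast_pos.2 (Nat.factorial_pos m)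
  have hg0 : (g 0).re ≠ 0 := by
    intro h0
    rw [hre, h0, mul_zero] at hc
    exact hc rfl
  have hcont : Tendsto (fun x : ℝ => (g 0).re * (g x).re) (𝓝[>] 0) (𝓝 ((g 0).re * (g 0).re)) := by
    have h1 : Tendsto (fun x : ℝ => (x : ℂ)) (𝓝[>] 0) (𝓝 0) := by
      have := Complex.continuous_ofReal.tendsto 0
      rw [Complex.ofReal_zero] at this
      exact this.mono_left nhdsWithin_le_nhds
    exact tendsto_const_nhds.mul (((Complex.continuous_re.tendsto _).comp hg.continuousAt.tendsto).comp h1)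
  have hpos := hcont.eventually_const_lt (mul_self_pos.2 hg0)
  have h1 : Tendsto (fun x : ℝ => (x : ℂ)) (𝓝[>] 0) (𝓝 0) := by
    have := Complex.continuous_ofReal.tendsto 0
    rw [Complex.ofReal_zero] at this
    exact this.mono_left nhdsWithin_le_nhds
  filter_upwards [hpos, h1.eventually heq, self_mem_nhdsWithin] with x hx hDx hx0
  have hx0 : 0 < x := hx0
  rw [hDx, sub_zero, smul_eq_mul, ← Complex.ofReal_pow, Complex.re_ofReal_mul, hre]
  have : (0 : ℝ) < (Nat.factorial m : ℝ) * x ^ m * ((g 0).re * (g x).re) := by positivity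
  linarith

/-- For large real arguments the sign is constant and nonzero. -/
lemma exists_sign_at_top (hD : Differentiable ℂ D) (hconj : ∀ z, D (conj z) = conj (D z))
    (hR : ∀ z : ℂ, 0 ≤ z.re → R < ‖z‖ → D z ≠ 0) :
    ∃ σ : ℝ, σ ≠ 0 ∧ ∀ᶠ r : ℝ in atTop, Real.sign (D r).re = σ := by
  obtain ⟨r₀, hr0, hr⟩ := exists_norm_large R
  have hne : ∀ t : ℝ, 0 < t → (D ((t + r₀ : ℝ) : ℂ)).re ≠ 0 := by
    intro t ht h0
    refine hR ((t + r₀ : ℝ) : ℂ) (by simp; linarith) ?_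
      (Complex.ext h0 (im_eq_zero_of_conj hconj _))
    rw [Complex.norm_real, Real.norm_eq_abs, abs_of_pos (by linarith)]
    linarith
  have hc : Continuous fun t : ℝ => (D ((t + r₀ : ℝ) : ℂ)).re :=
    Complex.continuous_re.comp (hD.continuous.comp (Complex.continuous_ofReal.comp (by fun_prop)))
  refine ⟨Real.sign (D ((1 + r₀ : ℝ) : ℂ)).re, ?_, ?_⟩
  · rw [Ne, Real.sign_eq_zero_iff]
    exact hne 1 one_pos
  · filter_upwards [eventually_gt_atTop r₀] with r hr
    have h1 := mul_pos_of_preconnected hc hne (sub_pos.2 hr) one_pos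
    rw [sub_add_cancel] at h1
    rcases pos_and_pos_or_neg_and_neg_of_mul_pos h1 with ⟨a, b⟩ | ⟨a, b⟩
    · rw [Real.sign_of_pos a, Real.sign_of_pos b]
    · rw [Real.sign_of_neg a, Real.sign_of_neg b]

/-- The parity of the number of zeros in the open right half-plane is determined by the signs of
the first derivative at the origin and of the function at `+∞`. -/
theorem parity_zeros (hD : Differentiable ℂ D) (hconj : ∀ z, D (conj z) = conj (D z))
    (hR : ∀ z : ℂ, 0 ≤ z.re → R < ‖z‖ → D z ≠ 0) {m : ℕ} (hm : (m : ℕ∞) ≤ analyticOrderAt D 0)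
    {σ : ℝ} (hσ : ∀ᶠ r : ℝ in atTop, Real.sign (D r).re = σ) (U : Finset ℂ)
    (hU : ∀ z, z ∈ U ↔ 0 < z.re ∧ D z = 0) (hc : (iteratedDeriv m D 0).re * σ ≠ 0) :
    0 < (-1) ^ (∑ a ∈ U, analyticOrderNatAt D a) * ((iteratedDeriv m D 0).re * σ) := by
  classical
  have hord := analyticOrderAt_ne_top_of_bounded_zeros hD hR
  set S := U.filter fun z => z.im = 0 with hSdef
  have hS : ∀ z, z ∈ S ↔ 0 < z.re ∧ z.im = 0 ∧ D z = 0 := by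
    intro z
    rw [hSdef, Finset.mem_filter, hU]
    tauto
  have hpar : (-1 : ℝ) ^ (∑ a ∈ U, analyticOrderNatAt D a)
      = (-1) ^ (∑ a ∈ S, analyticOrderNatAt D a) := by
    have hsplit := Finset.sum_filter_add_sum_filter_not U (fun z => z.im = 0)
      (fun a => analyticOrderNatAt D a)
    -- Conjugation is a fixed-point-free involution on the nonreal zeros and preserves their order,
    -- so their total cancels modulo 2.
    have heven : Even (∑ a ∈ U.filter (fun z => ¬ z.im = 0), analyticOrderNatAt D a) := by
      rw [← ZMod.natCast_eq_zero_iff_even, Nat.cast_sum]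
      refine Finset.sum_involution (fun a _ => conj a) ?_ ?_ ?_ ?_
      · intro a ha
        have : analyticOrderNatAt D (conj a) = analyticOrderNatAt D a := by
          rw [analyticOrderNatAt, analyticOrderNatAt, analyticOrderAt_conj hD hconj (hord a)]
        rw [this]
        exact CharTwo.add_self_eq_zero _
      · intro a ha _ h
        exact (Finset.mem_filter.1 ha).2 (Complex.conj_eq_iff_im.1 h)
      · intro a ha
        rw [Finset.mem_filter, hU] at ha ⊢
        refine ⟨⟨by simpa using ha.1.1, by rw [hconj, ha.1.2, map_zero]⟩, by simpa using ha.2⟩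
      · intro a ha
        exact Complex.conj_conj a
    rw [← hsplit, pow_add, heven.neg_one_pow, mul_one]
  have hc1 : (iteratedDeriv m D 0).re ≠ 0 := left_ne_zero_of_mul hc
  obtain ⟨x, hx⟩ : ∃ x : ℝ, 0 < x ∧ (∀ a ∈ S, x < a.re) ∧
      0 < (iteratedDeriv m D 0).re * (D x).re := by
    have h1 := sign_near_zero hD hm hc1
    have h2 : ∀ᶠ x : ℝ in 𝓝[>] 0, ∀ a ∈ S, x < a.re := by
      rw [Filter.eventually_all_finset]
      intro a ha
      exact (eventually_lt_nhds ((hS a).1 ha).1).filter_mono nhdsWithin_le_nhds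
    obtain ⟨x, hx1, hx2, hx3⟩ := (h1.and (h2.and self_mem_nhdsWithin)).exists
    exact ⟨x, hx3, hx2, hx1⟩
  obtain ⟨y, hy⟩ : ∃ y : ℝ, 0 < y ∧ (∀ a ∈ S, a.re < y) ∧ Real.sign (D y).re = σ := by
    have h2 : ∀ᶠ y : ℝ in atTop, ∀ a ∈ S, a.re < y := by
      rw [Filter.eventually_all_finset]
      intro a ha
      exact eventually_gt_atTop _
    obtain ⟨y, hy1, hy2, hy3⟩ := (hσ.and (h2.and (eventually_gt_atTop 0))).exists
    exact ⟨y, hy3, hy2, hy1⟩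
  obtain ⟨hx0, hxS, hxc⟩ := hx
  obtain ⟨hy0, hyS, hyσ⟩ := hy
  have hsc := sign_change hD hconj hord S hS hx0 hxS hyS hy0
  rw [hpar]
  set e : ℝ := (-1) ^ (∑ a ∈ S, analyticOrderNatAt D a)
  set c := (iteratedDeriv m D 0).re
  have hDy : 0 < σ * (D y).re := by
    have h0 : (D y).re ≠ 0 := by
      intro h0
      rw [h0] at hsc
      simp at hsc
    rcases lt_or_gt_of_ne h0 with h | h
    · rw [← hyσ, Real.sign_of_neg h]; linarith
    · rw [← hyσ, Real.sign_of_pos h]; linarith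
  -- The three sign relations are multiplied together; D(x) and D(y) then occur only through
  -- squares.
  have h1 : 0 < (e * (c * σ)) * ((D x).re * (D y).re) ^ 2 := by
    have := mul_pos hsc (mul_pos hxc hDy)
    have e1 : e * ((D x).re * (D y).re) * (c * (D x).re * (σ * (D y).re))
        = (e * (c * σ)) * ((D x).re * (D y).re) ^ 2 := by ring
    rwa [e1] at this
  exact pos_of_mul_pos_left h1 (sq_nonneg _)

end Parity

end PeriodicEvans

namespace PeriodicEvans

/-! ### Periodic eigenvalues belong to the spectrum on the whole line -/

section WeakDerivative

variable {n : ℕ}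

lemma hasWeakDeriv_of_hasDerivAt {u u' : ℝ → Fin n → ℂ} (hu : ∀ x, HasDerivAt u (u' x) x)
    (hu' : Continuous u') : HasWeakDeriv u u' := by
  intro φ hφ hφc
  have huc : Continuous u := continuous_iff_continuousAt.2 fun x => (hu x).continuousAt
  have hφd : ∀ x, HasDerivAt φ (deriv φ x) x := fun x =>
    (hφ.differentiable (by simp) x).hasDerivAt
  have hφ' : Continuous (deriv φ) := hφ.continuous_deriv (by simp)
  have i1 : Integrable fun x => φ x • u' x :=
    (hφ.continuous.smul hu').integrable_of_hasCompactSupport hφc.smul_right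
  have i2 : Integrable fun x => deriv φ x • u x :=
    (hφ'.smul huc).integrable_of_hasCompactSupport hφc.deriv.smul_right
  have i3 : Integrable fun x => φ x • u x :=
    (hφ.continuous.smul huc).integrable_of_hasCompactSupport hφc.smul_right
  have h0 := integral_eq_zero_of_hasDerivAt_of_integrable
    (fun x => (hφd x).smul (hu x)) (i1.add i2) i3
  rw [integral_add i1 i2] at h0
  exact eq_neg_of_add_eq_zero_right h0

lemma hasWeakDeriv_congr_ae {u u' w w' : ℝ → Fin n → ℂ} (h : HasWeakDeriv u u')
    (hu : w =ᵐ[volume] u) (hu' : w' =ᵐ[volume] u') : HasWeakDeriv w w' := by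
  intro φ hφ hφc
  have e1 : ∫ x, deriv φ x • w x = ∫ x, deriv φ x • u x :=
    integral_congr_ae (by filter_upwards [hu] with x hx; rw [hx])
  have e2 : ∫ x, φ x • w' x = ∫ x, φ x • u' x :=
    integral_congr_ae (by filter_upwards [hu'] with x hx; rw [hx])
  rw [e1, e2, h φ hφ hφc]

variable {B A : ℝ → Matrix (Fin n) (Fin n) ℝ} {T : ℝ}

lemma isLpImage_of_contDiff (h : ParabolicCoeffs B A T) {p : ℝ≥0∞} {w w' w'' : ℝ → Fin n → ℂ}
    (hw : ∀ x, HasDerivAt w (w' x) x) (hw' : ∀ x, HasDerivAt w' (w'' x) x) (hw''c : Continuous w'')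
    (m0 : MemLp w p volume) (m1 : MemLp w' p volume) (m2 : MemLp w'' p volume)
    (g : Lp (Fin n → ℂ) p (volume : Measure ℝ)) (hg : g =ᵐ[volume] linOp B A w) :
    IsLpImage B A p m0.toLp g := by
  have hwc : Continuous w := continuous_iff_continuousAt.2 fun x => (hw x).continuousAt
  have hwc' : Continuous w' := continuous_iff_continuousAt.2 fun x => (hw' x).continuousAt
  refine ⟨m1.toLp, m2.toLp, ?_, ?_, ?_⟩
  · exact hasWeakDeriv_congr_ae (hasWeakDeriv_of_hasDerivAt hw hwc') m0.coeFn_toLp m1.coeFn_toLp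
  · exact hasWeakDeriv_congr_ae (hasWeakDeriv_of_hasDerivAt hw' hw''c) m1.coeFn_toLp m2.coeFn_toLp
  · have hd : ∀ x, HasDerivAt (fun x => complexify (B x) *ᵥ w' x - complexify (A x) *ᵥ w x)
        (linOp B A w x) x := by
      intro x
      have h1 := (hasDerivAt_mulVec (hasDerivAt_complexify h.contDiff_B x) (hw' x)).sub
        (hasDerivAt_mulVec (hasDerivAt_complexify h.contDiff_A x) (hw x))
      rw [← linOp_eq h hw (hw' x)] at h1
      exact h1
    have hc : Continuous (linOp B A w) := by
      have e : linOp B A w = fun x =>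
          (complexify (matrixDeriv B x) *ᵥ w' x + complexify (B x) *ᵥ w'' x)
          - (complexify (matrixDeriv A x) *ᵥ w x + complexify (A x) *ᵥ w' x) :=
        funext fun x => linOp_eq h hw (hw' x)
      rw [e]
      exact ((h.continuous_matrixDeriv_B.matrix_mulVec hwc').add
        (h.continuous_B.matrix_mulVec hw''c)).sub
        ((h.continuous_matrixDeriv_A.matrix_mulVec hwc).add (h.continuous_A.matrix_mulVec hwc'))
    refine hasWeakDeriv_congr_ae (hasWeakDeriv_of_hasDerivAt hd hc) ?_ hg
    filter_upwards [m0.coeFn_toLp, m1.coeFn_toLp] with x h0 h1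
    rw [h0, h1]

end WeakDerivative

/-! ### Truncated eigenfunctions as approximate eigenfunctions on the line -/

section Spectrum

variable {n : ℕ} {B A : ℝ → Matrix (Fin n) (Fin n) ℝ} {T : ℝ}

/-- The commutator of `L` with multiplication by `χ`, applied to `v`. -/
noncomputable def commutatorTerm (B A : ℝ → Matrix (Fin n) (Fin n) ℝ) (χ : ℝ → ℝ)
    (v : ℝ → Fin n → ℂ) (x : ℝ) : Fin n → ℂ :=
  deriv (deriv χ) x • (complexify (B x) *ᵥ v x)
    + deriv χ x • ((2 : ℝ) • (complexify (B x) *ᵥ deriv v x) + complexify (matrixDeriv B x) *ᵥ v x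
      - complexify (A x) *ᵥ v x)

lemma mulVec_real_smul (M : Matrix (Fin n) (Fin n) ℂ) (r : ℝ) (v : Fin n → ℂ) :
    M *ᵥ (r • v) = r • (M *ᵥ v) := by
  funext i
  simp only [Matrix.mulVec, dotProduct, Pi.smul_apply, Finset.smul_sum, Complex.real_smul]
  exact Finset.sum_congr rfl fun j _ => by ring

/-- Product rule: terms without derivatives of χ reassemble to χ L v = λ χ v, and all others contain
χ' or χ''. -/
lemma linOp_smul (h : ParabolicCoeffs B A T) {χ : ℝ → ℝ} (hχ : ContDiff ℝ 2 χ)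
    {v : ℝ → Fin n → ℂ} (hv : ContDiff ℝ 2 v) {lam : ℂ} (heq : linOp B A v = lam • v) :
    (∀ x, HasDerivAt (fun x => χ x • v x) (χ x • deriv v x + deriv χ x • v x) x) ∧
    (∀ x, HasDerivAt (fun x => χ x • deriv v x + deriv χ x • v x)
      ((χ x • deriv (deriv v) x + deriv χ x • deriv v x)
        + (deriv χ x • deriv v x + deriv (deriv χ) x • v x)) x) ∧
    linOp B A (fun x => χ x • v x)
      = fun x => lam • (χ x • v x) + commutatorTerm B A χ v x := by
  have hv1 : ∀ x, HasDerivAt v (deriv v x) x := fun x =>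
    (hv.differentiable two_ne_zero x).hasDerivAt
  have hv2 : ∀ x, HasDerivAt (deriv v) (deriv (deriv v) x) x := fun x =>
    (((contDiff_succ_iff_deriv (n := 1).1 hv).2.2).differentiable one_ne_zero x).hasDerivAt
  have hχ1 : ∀ x, HasDerivAt χ (deriv χ x) x := fun x =>
    (hχ.differentiable two_ne_zero x).hasDerivAt
  have hχ2 : ∀ x, HasDerivAt (deriv χ) (deriv (deriv χ) x) x := fun x =>
    (((contDiff_succ_iff_deriv (n := 1).1 hχ).2.2).differentiable one_ne_zero x).hasDerivAt
  have a1 : ∀ x, HasDerivAt (fun x => χ x • v x) (χ x • deriv v x + deriv χ x • v x) x :=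
    fun x => (hχ1 x).smul (hv1 x)
  have a2 : ∀ x, HasDerivAt (fun x => χ x • deriv v x + deriv χ x • v x)
      ((χ x • deriv (deriv v) x + deriv χ x • deriv v x)
        + (deriv χ x • deriv v x + deriv (deriv χ) x • v x)) x := fun x =>
    ((hχ1 x).smul (hv2 x)).add ((hχ2 x).smul (hv1 x))
  refine ⟨a1, a2, ?_⟩
  funext x
  have e := congrFun heq x
  rw [linOp_eq h hv1 (hv2 x), Pi.smul_apply] at e
  rw [linOp_eq h a1 (a2 x), smul_comm lam, ← e, commutatorTerm]
  simp only [Matrix.mulVec_add, mulVec_real_smul, smul_sub, smul_add]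
  module

/-- Since (L - λ)(χ v) is the commutator term, a bounded left inverse R of L - λ sends that term
back to χ v. -/
lemma toLp_le_of_resolvent (h : ParabolicCoeffs B A T) {p : ℝ≥0∞} [Fact (1 ≤ p)] {χ : ℝ → ℝ}
    (hχ : ContDiff ℝ 2 χ) {v : ℝ → Fin n → ℂ} (hv : ContDiff ℝ 2 v) {lam : ℂ}
    (heq : linOp B A v = lam • v)
    {R : Lp (Fin n → ℂ) p (volume : Measure ℝ) →L[ℂ] Lp (Fin n → ℂ) p (volume : Measure ℝ)}
    (hR : ∀ v g, IsLpImage B A p v g → R (g - lam • v) = v)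
    (m0 : MemLp (fun x => χ x • v x) p volume)
    (m1 : MemLp (fun x => χ x • deriv v x + deriv χ x • v x) p volume)
    (m2 : MemLp (fun x => (χ x • deriv (deriv v) x + deriv χ x • deriv v x)
        + (deriv χ x • deriv v x + deriv (deriv χ) x • v x)) p volume)
    (me : MemLp (commutatorTerm B A χ v) p volume) : ‖m0.toLp‖ ≤ ‖R‖ * ‖me.toLp‖ := by
  obtain ⟨a1, a2, a3⟩ := linOp_smul h hχ hv heq
  have hχ1 := (contDiff_succ_iff_deriv (n := 1).1 hχ).2.2
  have hv1 := (contDiff_succ_iff_deriv (n := 1).1 hv).2.2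
  have c1 : Continuous (deriv (deriv χ)) := hχ1.continuous_deriv le_rfl
  have c2 : Continuous (deriv (deriv v)) := hv1.continuous_deriv le_rfl
  have c3 := hχ1.continuous
  have c4 := hv1.continuous
  have c5 := hχ.continuous
  have c6 := hv.continuous
  have himg := isLpImage_of_contDiff h a1 a2 (by fun_prop) m0 m1 m2 (lam • m0.toLp + me.toLp) (by
    rw [a3]
    filter_upwards [Lp.coeFn_add (lam • m0.toLp) me.toLp, Lp.coeFn_smul lam m0.toLp,
      m0.coeFn_toLp, me.coeFn_toLp] with x h1 h2 h3 h4
    rw [h1, Pi.add_apply, h2, Pi.smul_apply, h3, h4])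
  have := hR _ _ himg
  rw [add_sub_cancel_left] at this
  rw [← this]
  exact R.le_opNorm _

/-- The cutoff function at scale `k`. -/
noncomputable def cutoff (k : ℝ) (x : ℝ) : ℝ :=
  (⟨1, 2, one_pos, one_lt_two⟩ : ContDiffBump (0 : ℝ)) (k⁻¹ * x)

lemma contDiff_cutoff (k : ℝ) : ContDiff ℝ 2 (cutoff k) :=
  (ContDiffBump.contDiff _).comp (contDiff_const.mul contDiff_id)

lemma cutoff_eq_one {k x : ℝ} (hk : 0 < k) (hx : |x| ≤ k) : cutoff k x = 1 := by
  apply ContDiffBump.one_of_mem_closedBall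
  rw [mem_closedBall_zero_iff, norm_mul, norm_inv, Real.norm_eq_abs, Real.norm_eq_abs,
    abs_of_pos hk, inv_mul_le_iff₀ hk, mul_one]
  exact hx

lemma cutoff_eq_zero {k x : ℝ} (hk : 0 < k) (hx : 2 * k ≤ |x|) : cutoff k x = 0 := by
  apply ContDiffBump.zero_of_le_dist
  rw [dist_zero_right, norm_mul, norm_inv, Real.norm_eq_abs, Real.norm_eq_abs,
    abs_of_pos hk, le_inv_mul_iff₀ hk]
  linarith

lemma hasCompactSupport_cutoff {k : ℝ} (hk : 0 < k) : HasCompactSupport (cutoff k) :=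
  HasCompactSupport.intro (isCompact_Icc (a := -(2 * k)) (b := 2 * k)) fun x hx =>
    cutoff_eq_zero hk (by
      by_contra! hlt
      exact hx (abs_le.1 hlt.le))

/-- Each derivative of the rescaled bump gains a factor 1/k; for k ≥ 1 the bound 1/k² on the second
is weakened to 1/k. -/
lemma exists_cutoff_deriv_bound : ∃ C, 0 ≤ C ∧ ∀ k : ℝ, 1 ≤ k → ∀ x,
    |deriv (cutoff k) x| ≤ C / k ∧ |deriv (deriv (cutoff k)) x| ≤ C / k := by
  set b : ContDiffBump (0 : ℝ) := ⟨1, 2, one_pos, one_lt_two⟩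
  have hb : ContDiff ℝ 2 b := b.contDiff
  have hb1 := (contDiff_succ_iff_deriv (n := 1).1 hb).2.2
  obtain ⟨C₁, h₁⟩ := b.hasCompactSupport.deriv.exists_bound_of_continuous hb1.continuous
  obtain ⟨C₂, h₂⟩ := b.hasCompactSupport.deriv.deriv.exists_bound_of_continuous
    (hb1.continuous_deriv le_rfl)
  refine ⟨max C₁ C₂, (norm_nonneg _).trans ((h₁ 0).trans (le_max_left _ _)), fun k hk x => ?_⟩
  have hk0 : 0 < k := by linarith
  have hC : 0 ≤ max C₁ C₂ := (norm_nonneg _).trans ((h₁ 0).trans (le_max_left _ _))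
  have e1 : deriv (cutoff k) = fun x => k⁻¹ * deriv b (k⁻¹ * x) := by
    funext x
    exact deriv_comp_mul_left k⁻¹ (b : ℝ → ℝ) x
  have e2 : deriv (deriv (cutoff k)) x = k⁻¹ * (k⁻¹ * deriv (deriv b) (k⁻¹ * x)) := by
    rw [e1, deriv_const_mul_field]
    congr 1
    exact deriv_comp_mul_left k⁻¹ (deriv b) x
  constructor
  · rw [e1, abs_mul, abs_inv, abs_of_pos hk0, div_eq_inv_mul]
    gcongr
    exact (h₁ _).trans (le_max_left _ _)
  · rw [e2, abs_mul, abs_mul, abs_inv, abs_of_pos hk0, div_eq_inv_mul]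
    gcongr
    refine (mul_le_of_le_one_left (abs_nonneg _) (inv_le_one_of_one_le₀ hk)).trans ?_
    exact (h₂ _).trans (le_max_right _ _)

lemma norm_commutatorTerm_le (h : ParabolicCoeffs B A T) {v : ℝ → Fin n → ℂ}
    (hv : v ∈ periodicDomain n T) : ∃ C, 0 ≤ C ∧ ∀ k : ℝ, 1 ≤ k → ∀ x,
      ‖commutatorTerm B A (cutoff k) v x‖ ≤ C / k := by
  obtain ⟨C₀, hC₀, hC⟩ := exists_cutoff_deriv_bound
  obtain ⟨hv2, hper⟩ := hv
  have hv1 : Continuous (deriv v) := hv2.continuous_deriv (by norm_num)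
  have hper' := periodic_deriv hper
  obtain ⟨M₁, h₁⟩ := exists_bound_of_periodic (h.continuous_B.matrix_mulVec hv2.continuous) h.pos
    (fun x => by simp only [h.periodic_B x, hper x])
  obtain ⟨M₂, h₂⟩ := exists_bound_of_periodic
    (g := fun x => (2 : ℝ) • (complexify (B x) *ᵥ deriv v x) + complexify (matrixDeriv B x) *ᵥ v x
      - complexify (A x) *ᵥ v x)
    ((((h.continuous_B.matrix_mulVec hv1).const_smul (2 : ℝ)).add
      (h.continuous_matrixDeriv_B.matrix_mulVec hv2.continuous)).sub
      (h.continuous_A.matrix_mulVec hv2.continuous)) h.pos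
    (fun x => by simp only [h.periodic_B x, h.periodic_A x, hper x, hper' x,
      matrixDeriv_periodic h.periodic_B x])
  have hM₁ : 0 ≤ M₁ := (norm_nonneg _).trans (h₁ 0)
  have hM₂ : 0 ≤ M₂ := (norm_nonneg _).trans (h₂ 0)
  refine ⟨C₀ * (M₁ + M₂), by positivity, fun k hk x => ?_⟩
  have hk0 : 0 < k := by linarith
  calc ‖commutatorTerm B A (cutoff k) v x‖ ≤ C₀ / k * M₁ + C₀ / k * M₂ := by
        refine (norm_add_le _ _).trans (add_le_add ?_ ?_)
        · rw [norm_smul]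
          exact mul_le_mul (hC k hk x).2 (h₁ x) (norm_nonneg _) (by positivity)
        · rw [norm_smul]
          exact mul_le_mul (hC k hk x).1 (h₂ x) (norm_nonneg _) (by positivity)
    _ = _ := by ring

lemma commutatorTerm_eq_zero {k x : ℝ} (hk : 0 < k) (hx : 2 * k < |x|) (v : ℝ → Fin n → ℂ) :
    commutatorTerm B A (cutoff k) v x = 0 := by
  have hloc : cutoff k =ᶠ[𝓝 x] fun _ => 0 := by
    filter_upwards [(isOpen_lt continuous_const continuous_abs).mem_nhds hx] with y hy
    exact cutoff_eq_zero hk (le_of_lt hy)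
  have h1 := hloc.deriv
  have h2 := h1.deriv
  rw [commutatorTerm, h1.eq_of_nhds, h2.eq_of_nhds]
  simp

lemma continuous_commutatorTerm (h : ParabolicCoeffs B A T) {χ : ℝ → ℝ} (hχ : ContDiff ℝ 2 χ)
    {v : ℝ → Fin n → ℂ} (hv : ContDiff ℝ 2 v) : Continuous (commutatorTerm B A χ v) := by
  have hχ1 := (contDiff_succ_iff_deriv (n := 1).1 hχ).2.2
  have hv1 := (contDiff_succ_iff_deriv (n := 1).1 hv).2.2
  have c1 : Continuous (deriv (deriv χ)) := hχ1.continuous_deriv le_rfl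
  exact (c1.smul (h.continuous_B.matrix_mulVec hv.continuous)).add
    (hχ1.continuous.smul ((((h.continuous_B.matrix_mulVec hv1.continuous).const_smul (2 : ℝ)).add
      (h.continuous_matrixDeriv_B.matrix_mulVec hv.continuous)).sub
      (h.continuous_A.matrix_mulVec hv.continuous)))

lemma norm_toLp_rpow {p : ℝ≥0∞} (hp0 : p ≠ 0) (hp : p ≠ ⊤) {w : ℝ → Fin n → ℂ}
    (hw : MemLp w p volume) : ‖hw.toLp‖ ^ p.toReal = ∫ x, ‖w x‖ ^ p.toReal := by
  have hpos : 0 < p.toReal := ENNReal.toReal_pos hp0 hp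
  have hint : 0 ≤ ∫ x, ‖w x‖ ^ p.toReal := integral_nonneg fun x => by positivity
  rw [Lp.norm_toLp, hw.eLpNorm_eq_integral_rpow_norm hp0 hp, ENNReal.toReal_ofReal (by positivity),
    ← Real.rpow_mul hint, inv_mul_cancel₀ hpos.ne', Real.rpow_one]

/-- Unstable (indeed all) periodic eigenvalues belong to the `Lᵖ(ℝ)` spectrum. -/
theorem mem_lpSpectrum_of_eigenvalue (h : ParabolicCoeffs B A T) {lam : ℂ} {v : ℝ → Fin n → ℂ}
    (hv : v ∈ periodicDomain n T) (hv0 : v ≠ 0) (heq : linOp B A v = lam • v) (p : ℝ≥0∞)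
    [hp1 : Fact (1 ≤ p)] : lam ∈ lpSpectrum B A p := by
  rintro ⟨R, hR, -⟩
  obtain ⟨hv2, hper⟩ := hv
  have hvc := hv2.continuous
  have hv1 := (contDiff_succ_iff_deriv (n := 1).1 hv2).2.2
  have hv1c := hv1.continuous
  have hv2c : Continuous (deriv (deriv v)) := hv1.continuous_deriv le_rfl
  have hper' := periodic_deriv hper
  have hper'' := periodic_deriv hper'
  -- For p = ∞ the periodic eigenfunction is itself in the domain and R 0 = v gives a contradiction;
  -- for finite p it must be truncated.
  by_cases hp : p = ⊤
  · subst hp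
    have hb : ∀ {g : ℝ → Fin n → ℂ}, Continuous g → Function.Periodic g T → MemLp g ⊤ volume := by
      intro g hg hgp
      obtain ⟨K, hK⟩ := exists_bound_of_periodic hg h.pos hgp
      exact memLp_top_of_bound hg.aestronglyMeasurable K (Eventually.of_forall hK)
    have m0 := hb hvc hper
    have himg := isLpImage_of_contDiff (p := ⊤) h
      (fun x => (hv2.differentiable two_ne_zero x).hasDerivAt)
      (fun x => (hv1.differentiable one_ne_zero x).hasDerivAt) hv2c m0
      (hb hv1c hper') (hb hv2c hper'') (lam • m0.toLp) (by
        rw [heq]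
        filter_upwards [Lp.coeFn_smul lam m0.toLp, m0.coeFn_toLp] with x h1 h2
        rw [h1, Pi.smul_apply, h2, Pi.smul_apply])
    have h0 := hR _ _ himg
    rw [sub_self, map_zero] at h0
    apply hv0
    have h1 : v =ᵐ[volume] (0 : ℝ → Fin n → ℂ) := by
      have h2 := m0.coeFn_toLp
      rw [← h0] at h2
      exact h2.symm.trans (Lp.coeFn_zero _ _ _)
    exact (Continuous.ae_eq_iff_eq volume hvc continuous_zero).1 h1
  · have hp0 : p ≠ 0 := (zero_lt_one.trans_le hp1.out).ne'
    set q := p.toReal with hq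
    have hq0 : 0 < q := ENNReal.toReal_pos hp0 hp
    obtain ⟨C, hC0, hC⟩ := norm_commutatorTerm_le h ⟨hv2, hper⟩
    set I := ∫ x in (0 : ℝ)..T, ‖v x‖ ^ q with hI
    have hcq : Continuous fun x => ‖v x‖ ^ q :=
      hvc.norm.rpow_const fun x => Or.inr hq0.le
    have hI0 : 0 < I := by
      obtain ⟨x, hx⟩ := Function.ne_iff.1 hv0
      obtain ⟨y, hy, hxy⟩ := hper.exists_mem_Ico₀ h.pos x
      refine intervalIntegral.integral_pos h.pos hcq.continuousOn (fun y _ => by positivity)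
        ⟨y, ⟨hy.1, hy.2.le⟩, ?_⟩
      rw [← hxy]
      exact Real.rpow_pos_of_pos (norm_pos_iff.2 hx) _
    -- the estimate at scale `N T`
    have key : ∀ N : ℕ, 1 ≤ (N : ℝ) * T → I ≤ (‖R‖ * C) ^ q * (4 * T) / ((N : ℝ) * T) ^ q := by
      intro N hN
      set k := (N : ℝ) * T
      have hk0 : 0 < k := by linarith
      have hN0 : (0 : ℝ) < N := by
        have := h.pos
        by_contra! hle
        have : k ≤ 0 := mul_nonpos_of_nonpos_of_nonneg hle this.le
        linarith
      have hχ := contDiff_cutoff k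
      have hχ1 := (contDiff_succ_iff_deriv (n := 1).1 hχ).2.2
      have hχc := hχ.continuous
      have hχ1c := hχ1.continuous
      have hχ2c : Continuous (deriv (deriv (cutoff k))) := hχ1.continuous_deriv le_rfl
      have s0 := hasCompactSupport_cutoff hk0
      have s1 := s0.deriv
      have s2 := s1.deriv
      have hec := continuous_commutatorTerm h hχ hv2
      have m0 : MemLp (fun x => cutoff k x • v x) p volume :=
        (hχc.smul hvc).memLp_of_hasCompactSupport s0.smul_right
      have m1 : MemLp (fun x => cutoff k x • deriv v x + deriv (cutoff k) x • v x) p volume :=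
        ((hχc.smul hv1c).memLp_of_hasCompactSupport s0.smul_right).add
          ((hχ1c.smul hvc).memLp_of_hasCompactSupport s1.smul_right)
      have m2 : MemLp (fun x => (cutoff k x • deriv (deriv v) x + deriv (cutoff k) x • deriv v x)
          + (deriv (cutoff k) x • deriv v x + deriv (deriv (cutoff k)) x • v x)) p volume :=
        (((hχc.smul hv2c).memLp_of_hasCompactSupport s0.smul_right).add
          ((hχ1c.smul hv1c).memLp_of_hasCompactSupport s1.smul_right)).add
          (((hχ1c.smul hv1c).memLp_of_hasCompactSupport s1.smul_right).add
          ((hχ2c.smul hvc).memLp_of_hasCompactSupport s2.smul_right))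
      have hesupp : ∀ x, x ∉ Set.Icc (-(2 * k)) (2 * k) →
          commutatorTerm B A (cutoff k) v x = 0 := fun x hx =>
        commutatorTerm_eq_zero hk0 (by
          by_contra! hle
          exact hx (abs_le.1 hle)) v
      have me : MemLp (commutatorTerm B A (cutoff k) v) p volume :=
        hec.memLp_of_hasCompactSupport (HasCompactSupport.intro isCompact_Icc hesupp)
      have hle := toLp_le_of_resolvent h hχ hv2 heq hR m0 m1 m2 me
      have hle' := Real.rpow_le_rpow (norm_nonneg _) hle hq0.le
      rw [Real.mul_rpow (norm_nonneg _) (norm_nonneg _), norm_toLp_rpow hp0 hp m0,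
        norm_toLp_rpow hp0 hp me] at hle'
      -- The cutoff equals 1 on (0, N T], which contains N full periods of v.
      have lower : (N : ℝ) * I ≤ ∫ x, ‖cutoff k x • v x‖ ^ q := by
        have hperq : Function.Periodic (fun x => ‖v x‖ ^ q) T := fun x => by simp only [hper x]
        have e1 := hperq.intervalIntegral_add_zsmul_eq (N : ℤ) 0
          (fun _ _ => hcq.intervalIntegrable _ _)
        simp only [zero_add, natCast_zsmul, nsmul_eq_mul] at e1
        rw [← e1, intervalIntegral.integral_of_le hk0.le]
        have e2 : ∫ x in Set.Ioc 0 k, ‖v x‖ ^ q = ∫ x in Set.Ioc 0 k, ‖cutoff k x • v x‖ ^ q := by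
          refine setIntegral_congr_fun measurableSet_Ioc fun x hx => ?_
          rw [cutoff_eq_one hk0 (by rw [abs_of_pos hx.1]; exact hx.2), one_smul]
        change ∫ x in Set.Ioc 0 k, ‖v x‖ ^ q ≤ _
        rw [e2]
        exact setIntegral_le_integral (m0.integrable_norm_rpow hp0 hp)
          (Eventually.of_forall fun x => by positivity)
      -- The commutator is O(1/k) and supported in an interval of length 4 k, so the mass grows like
      -- N while the error has the additional factor k^(-q).
      have upper : ∫ x, ‖commutatorTerm B A (cutoff k) v x‖ ^ q ≤ (C / k) ^ q * (4 * k) := by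
        have e1 : ∫ x, ‖commutatorTerm B A (cutoff k) v x‖ ^ q
            = ∫ x in Set.Icc (-(2 * k)) (2 * k), ‖commutatorTerm B A (cutoff k) v x‖ ^ q := by
          rw [setIntegral_eq_integral_of_forall_compl_eq_zero]
          intro x hx
          rw [hesupp x hx, norm_zero, Real.zero_rpow hq0.ne']
        rw [e1]
        have e2 := norm_setIntegral_le_of_norm_le_const (μ := volume)
          (s := Set.Icc (-(2 * k)) (2 * k))
          (f := fun x => ‖commutatorTerm B A (cutoff k) v x‖ ^ q) (C := (C / k) ^ q)
          (by simp [Real.volume_Icc]) (fun x _ => by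
            rw [Real.norm_of_nonneg (by positivity)]
            exact Real.rpow_le_rpow (norm_nonneg _) (hC k hN x) hq0.le)
        refine (le_abs_self _).trans (e2.trans (le_of_eq ?_))
        rw [Measure.real, Real.volume_Icc, ENNReal.toReal_ofReal (by linarith)]
        ring
      have hfin : (N : ℝ) * I ≤ ‖R‖ ^ q * ((C / k) ^ q * (4 * k)) :=
        lower.trans (hle'.trans (by gcongr))
      have e : ‖R‖ ^ q * ((C / k) ^ q * (4 * k))
          = N * ((‖R‖ * C) ^ q * (4 * T) / k ^ q) := by
        rw [Real.div_rpow hC0 hk0.le, Real.mul_rpow (norm_nonneg _) hC0]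
        simp only [k]
        ring
      rw [e] at hfin
      exact le_of_mul_le_mul_left hfin hN0
    have hlim : Tendsto (fun N : ℕ => (‖R‖ * C) ^ q * (4 * T) / ((N : ℝ) * T) ^ q) atTop (𝓝 0) := by
      refine Tendsto.const_div_atTop ?_ _
      exact (tendsto_rpow_atTop hq0).comp
        (tendsto_natCast_atTop_atTop.atTop_mul_const h.pos)
    have hev : ∀ᶠ N : ℕ in atTop, 1 ≤ (N : ℝ) * T :=
      (tendsto_natCast_atTop_atTop.atTop_mul_const h.pos).eventually_ge_atTop 1
    have : I ≤ 0 := ge_of_tendsto hlim (hev.mono key)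
    linarith

end Spectrum

end PeriodicEvans

namespace PeriodicEvans

/-! ### The coefficients of the linearization about a periodic wave -/

section Wave

variable {n : ℕ} {f : (Fin n → ℝ) → (Fin n → ℝ)} {B : (Fin n → ℝ) → Matrix (Fin n) (Fin n) ℝ}
  {s T : ℝ} {um : Fin n → ℝ} {ubar : ℝ → (Fin n → ℝ)}

lemma wave_hasDerivAt (hwave : IsTravelingWaveOn f B um s ubar Set.univ) (x : ℝ) :
    HasDerivAt ubar (deriv ubar x) x ∧
      coeffB B ubar x *ᵥ deriv ubar x = f (ubar x) - f um - s • (ubar x - um) := by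
  obtain ⟨u', hu', he⟩ := hwave x (Set.mem_univ x)
  rw [hasDerivWithinAt_univ] at hu'
  rw [hu'.deriv]
  exact ⟨hu', he⟩

lemma wave_deriv_eq (hwave : IsTravelingWaveOn f B um s ubar Set.univ) (h1 : HypH1 B ubar) :
    deriv ubar = fun x => (coeffB B ubar x)⁻¹ *ᵥ (f (ubar x) - f um - s • (ubar x - um)) := by
  funext x
  rw [← (wave_hasDerivAt hwave x).2, Matrix.mulVec_mulVec,
    Matrix.nonsing_inv_mul _ (isUnit_det_of_spectrum (M := coeffB B ubar x) (h1 x)), Matrix.one_mulVec]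

lemma contDiff_coeffB {k : ℕ∞} (hk : (k : WithTop ℕ∞) ≤ 2) (h0 : HypH0 f B) (hu : ContDiff ℝ k ubar)
    (i j : Fin n) : ContDiff ℝ k fun x => coeffB B ubar x i j :=
  ((h0.2 i j).of_le hk).comp hu

lemma contDiff_deriv_wave {k : ℕ∞} (hk : (k : WithTop ℕ∞) ≤ 2) (h0 : HypH0 f B) (h1 : HypH1 B ubar)
    (hwave : IsTravelingWaveOn f B um s ubar Set.univ) (hu : ContDiff ℝ k ubar) :
    ContDiff ℝ k (deriv ubar) := by
  rw [wave_deriv_eq hwave h1]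
  refine contDiff_mulVec (contDiff_matrix_inv (contDiff_coeffB hk h0 hu)
    fun x => (isUnit_det_of_spectrum (h1 x)).ne_zero) ?_
  exact (((h0.1.of_le hk).comp hu).sub contDiff_const).sub
    ((hu.sub contDiff_const).const_smul s)

/-- Bootstrap in ū' = B(ū)⁻¹(f(ū) - f(u₋) - s(ū - u₋)): continuity of ū gives a C¹ profile, and then
ū' is C¹ as well. This makes A, which contains ū', of class C¹. -/
lemma contDiff_one_wave (h0 : HypH0 f B) (h1 : HypH1 B ubar)
    (hwave : IsTravelingWaveOn f B um s ubar Set.univ) :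
    ContDiff ℝ 1 ubar ∧ ContDiff ℝ 1 (deriv ubar) := by
  have hd : Differentiable ℝ ubar := fun x => (wave_hasDerivAt hwave x).1.differentiableAt
  have hu0 : ContDiff ℝ 0 ubar := contDiff_zero.2 hd.continuous
  have hu1 : ContDiff ℝ 1 ubar := contDiff_one_iff_deriv.2
    ⟨hd, contDiff_zero.1 (contDiff_deriv_wave (k := 0) (by simp) h0 h1 hwave hu0)⟩
  exact ⟨hu1, contDiff_deriv_wave (k := 1) (by norm_num) h0 h1 hwave hu1⟩

lemma periodic_deriv_wave (hper : Function.Periodic ubar T) :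
    Function.Periodic (deriv ubar) T := by
  intro x
  rw [← deriv_comp_add_const]
  simp only [hper _]

lemma parabolicCoeffs_wave (hT : 0 < T) (hwave : IsTravelingWaveOn f B um s ubar Set.univ)
    (hper : Function.Periodic ubar T) (h0 : HypH0 f B) (h1 : HypH1 B ubar) :
    ParabolicCoeffs (coeffB B ubar) (coeffA f B s ubar) T where
  pos := hT
  contDiff_B := contDiff_coeffB (k := 1) (by norm_num) h0 (contDiff_one_wave h0 h1 hwave).1
  contDiff_A i j := by
    obtain ⟨hu, hu'⟩ := contDiff_one_wave h0 h1 hwave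
    simp only [coeffA, jacobian, Matrix.sub_apply, Matrix.smul_apply, Matrix.of_apply]
    refine (ContDiff.sub ?_ contDiff_const).sub (ContDiff.sum fun k _ => ContDiff.mul ?_ ?_)
    · exact contDiff_pi.1 (((h0.1.fderiv_right (m := 1) (by norm_num)).comp hu).clm_apply
        contDiff_const) i
    · exact (((h0.2 i k).fderiv_right (m := 1) (by norm_num)).comp hu).clm_apply contDiff_const
    · exact contDiff_pi.1 hu' k
  periodic_B x := by simp only [coeffB, hper x]
  periodic_A x := by simp only [coeffA, hper x, periodic_deriv_wave hper x]
  spectrum_B := h1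

/-- The derivative of the wave satisfies the linearized profile equation. -/
lemma linearized_profile (h0 : HypH0 f B) (h1 : HypH1 B ubar)
    (hwave : IsTravelingWaveOn f B um s ubar Set.univ) (x : ℝ) :
    coeffB B ubar x *ᵥ deriv (deriv ubar) x = coeffA f B s ubar x *ᵥ deriv ubar x := by
  obtain ⟨hu, hu'⟩ := contDiff_one_wave h0 h1 hwave
  have d0 := (wave_hasDerivAt hwave x).1
  have d1 : HasDerivAt (deriv ubar) (deriv (deriv ubar) x) x :=
    (hu'.differentiable one_ne_zero x).hasDerivAt
  have dB : ∀ i k, HasDerivAt (fun x => coeffB B ubar x i k)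
      ((Matrix.of fun i k => fderiv ℝ (fun u => B u i k) (ubar x) (deriv ubar x)) i k) x :=
    fun i k => ((h0.2 i k).differentiable two_ne_zero _).hasFDerivAt.comp_hasDerivAt x d0
  -- The identity is the derivative of the profile equation along the wave.
  have e1 := hasDerivAt_mulVec dB d1
  have e2 := (((h0.1.differentiable two_ne_zero _).hasFDerivAt.comp_hasDerivAt x d0).sub_const
    (f um)).sub ((d0.sub_const um).const_smul s)
  have e : (fun x => coeffB B ubar x *ᵥ deriv ubar x)
      = fun x => f (ubar x) - f um - s • (ubar x - um) :=
    funext fun x => (wave_hasDerivAt hwave x).2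
  rw [e] at e1
  have h := e1.unique e2
  have expand : ∀ {F : Type} [NormedAddCommGroup F] [NormedSpace ℝ F]
      (φ : (Fin n → ℝ) →L[ℝ] F) (v : Fin n → ℝ), φ v = ∑ j, v j • φ (Pi.single j 1) := by
    intro F _ _ φ v
    conv_lhs => rw [pi_eq_sum_univ' v]
    simp [map_sum]
  rw [← eq_sub_iff_add_eq'] at h
  rw [h]
  ext i
  simp only [coeffA, jacobian, Matrix.sub_mulVec, Matrix.smul_mulVec, Matrix.one_mulVec,
    Pi.sub_apply, Pi.smul_apply]
  congr 1
  · congr 1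
    rw [expand]
    simp [Matrix.mulVec, dotProduct, mul_comm]
  -- Here (dB(ū) v) ū' is evaluated at v = ū', so both slots carry ū' and the double sums agree
  -- after exchanging the order of summation.
  · simp only [Matrix.mulVec, dotProduct, Matrix.of_apply, Finset.sum_mul]
    rw [Finset.sum_comm]
    refine Finset.sum_congr rfl fun k _ => ?_
    rw [expand, Finset.sum_mul]
    refine Finset.sum_congr rfl fun j _ => ?_
    rw [smul_eq_mul]
    ring

lemma hasDerivAt_ofReal_pi {v : ℝ → Fin n → ℝ} {v' : Fin n → ℝ} {x : ℝ} (hv : HasDerivAt v v' x) :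
    HasDerivAt (fun x i => (v x i : ℂ)) (fun i => (v' i : ℂ)) x :=
  hasDerivAt_pi.2 fun i => (hasDerivAt_pi.1 hv i).ofReal_comp

lemma complexify_mulVec (M : Matrix (Fin n) (Fin n) ℝ) (v : Fin n → ℝ) :
    complexify M *ᵥ (fun i => (v i : ℂ)) = fun i => ((M *ᵥ v) i : ℂ) := by
  ext i
  simp [complexify, Matrix.mulVec, dotProduct]

/-- The general bound is applied to w = ū': its integral over a period vanishes because ū is
periodic, and w ≠ 0 because ū is not constant. -/
lemma succ_le_analyticOrderAt_evans_wave (hT : 0 < T)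
    (hwave : IsTravelingWaveOn f B um s ubar Set.univ) (hper : Function.Periodic ubar T)
    (hnonconst : ∃ x y, ubar x ≠ ubar y) (h0 : HypH0 f B) (h1 : HypH1 B ubar) :
    ((n + 1 : ℕ) : ℕ∞) ≤
      analyticOrderAt (evans (coeffB B ubar) (coeffA f B s ubar) T 0) 0 := by
  obtain ⟨hu, hu'⟩ := contDiff_one_wave h0 h1 hwave
  have d0 : ∀ x, HasDerivAt ubar (deriv ubar x) x := fun x => (wave_hasDerivAt hwave x).1
  have d1 : ∀ x, HasDerivAt (deriv ubar) (deriv (deriv ubar) x) x :=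
    fun x => (hu'.differentiable one_ne_zero x).hasDerivAt
  refine succ_le_analyticOrderAt_evans (parabolicCoeffs_wave hT hwave hper h0 h1)
    (w := fun x i => (deriv ubar x i : ℂ)) (w' := fun x i => (deriv (deriv ubar) x i : ℂ))
    (fun x => hasDerivAt_ofReal_pi (d1 x)) (fun x => ?_) (fun x => ?_) ?_ ?_
  · rw [complexify_mulVec, complexify_mulVec, linearized_profile h0 h1 hwave x]
  · simp only [periodic_deriv_wave hper x]
  · have hc : Continuous fun x i => (deriv ubar x i : ℂ) :=
      continuous_iff_continuousAt.2 fun x => (hasDerivAt_ofReal_pi (d1 x)).continuousAt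
    rw [intervalIntegral.integral_eq_sub_of_hasDerivAt (fun x _ => hasDerivAt_ofReal_pi (d0 x))
      (hc.intervalIntegrable _ _)]
    have : ubar T = ubar 0 := by simpa using hper 0
    rw [this, sub_self]
  · intro hw
    obtain ⟨x, y, hxy⟩ := hnonconst
    refine hxy (is_const_of_deriv_eq_zero (fun x => (d0 x).differentiableAt) (fun x => ?_) x y)
    ext i
    simpa using congrFun (congrFun hw x) i

end Wave

/-! ### The parity of the number of unstable eigenvalues -/

section Index

lemma pos_of_sign_pos {r : ℝ} (h : 0 < Real.sign r) : 0 < r := by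
  have h0 : r ≠ 0 := fun h0 => by simp [h0] at h
  exact pos_of_mul_pos_right (Real.sign_mul_pos_of_ne_zero r h0) h.le

lemma neg_of_sign_neg {r : ℝ} (h : Real.sign r < 0) : r < 0 := by
  have := pos_of_sign_pos (r := -r) (by rw [Real.sign_neg]; linarith)
  linarith

variable {n : ℕ} {B A : ℝ → Matrix (Fin n) (Fin n) ℝ} {T : ℝ}

lemma unstableEigenvalues_eq (h : ParabolicCoeffs B A T) :
    unstableEigenvalues B A T = {z | 0 < z.re ∧ evans B A T 0 z = 0} := by
  ext z
  simp only [unstableEigenvalues, Set.mem_ofPred_eq, evans_eq_zero_iff h]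

lemma exists_zero_bound (h : ParabolicCoeffs B A T) :
    ∃ R, ∀ z : ℂ, 0 ≤ z.re → R < ‖z‖ → evans B A T 0 z ≠ 0 := by
  obtain ⟨R, hR⟩ := exists_eigenvalue_bound h
  refine ⟨R, fun z hz hlt h0 => ?_⟩
  obtain ⟨v, hv, hne, he⟩ := (evans_eq_zero_iff h).1 h0
  exact absurd (hR z hz v hv hne he) (not_le.2 hlt)

lemma stabilityIndexWellDefined (h : ParabolicCoeffs B A T) :
    StabilityIndexWellDefined B A T ∧
      ∀ᶠ r : ℝ in atTop, Real.sign (evans B A T 0 r).re = evansSignInfty B A T := by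
  obtain ⟨R, hR⟩ := exists_zero_bound h
  obtain ⟨σ, hσ0, hσ⟩ := exists_sign_at_top (differentiable_evans h) (evans_conj h) hR
  have hlim : Tendsto (fun r : ℝ => Real.sign (evans B A T 0 (r : ℂ)).re) atTop (𝓝 σ) :=
    tendsto_const_nhds.congr' (hσ.mono fun r hr => hr.symm)
  have e : evansSignInfty B A T = σ := hlim.limUnder_eq
  rw [StabilityIndexWellDefined, e]
  exact ⟨⟨differentiable_evans h, im_eq_zero_of_conj (evans_conj h), hlim, hσ0⟩, hσ⟩

lemma finite_unstableEigenvalues (h : ParabolicCoeffs B A T) :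
    (unstableEigenvalues B A T).Finite := by
  obtain ⟨R, hR⟩ := exists_zero_bound h
  rw [unstableEigenvalues_eq h]
  exact (finite_zeros (differentiable_evans h) hR).subset fun z hz => ⟨hz.1.le, hz.2⟩

lemma finrank_genEigenspace_eq (h : ParabolicCoeffs B A T) (lam : ℂ) :
    FiniteDimensional ℂ (genEigenspace B A T lam) ∧
      Module.finrank ℂ (genEigenspace B A T lam)
        = analyticOrderNatAt (evans B A T 0) lam := by
  obtain ⟨R, hR⟩ := exists_zero_bound h
  obtain ⟨h1, h2⟩ := finrank_genEigenspace h
    (analyticOrderAt_ne_top_of_bounded_zeros (differentiable_evans h) hR lam)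
  exact ⟨h1, by rw [analyticOrderNatAt, ← h2, ENat.toNat_natCast]⟩

lemma unstableCount_parity (h : ParabolicCoeffs B A T) {m : ℕ}
    (hm : (m : ℕ∞) ≤ analyticOrderAt (evans B A T 0) 0)
    (hc : (iteratedDeriv m (evans B A T 0) 0).re * evansSignInfty B A T ≠ 0) :
    0 < (-1) ^ unstableCount B A T *
      ((iteratedDeriv m (evans B A T 0) 0).re * evansSignInfty B A T) := by
  obtain ⟨R, hR⟩ := exists_zero_bound h
  have hU := finite_unstableEigenvalues h
  have key := parity_zeros (differentiable_evans h) (evans_conj h) hR hm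
    (stabilityIndexWellDefined h).2 hU.toFinset
    (fun z => by rw [hU.mem_toFinset, unstableEigenvalues_eq h]; rfl) hc
  rwa [unstableCount, finsum_mem_eq_finite_toFinset_sum _ hU,
    Finset.sum_congr rfl fun lam _ => (finrank_genEigenspace_eq h lam).2]

end Index

end PeriodicEvans

theorem proposition5p7 {n : ℕ} (f : (Fin n → ℝ) → (Fin n → ℝ))
    (B : (Fin n → ℝ) → Matrix (Fin n) (Fin n) ℝ) (s T : ℝ) (um : Fin n → ℝ)
    (ubar : ℝ → (Fin n → ℝ)) (hT : 0 < T)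
    (hwave : IsTravelingWaveOn f B um s ubar Set.univ)
    (hper : Function.Periodic ubar T) (hnonconst : ∃ x y, ubar x ≠ ubar y)
    (h0 : HypH0 f B) (h1 : HypH1 B ubar) (h2 : HypH2 f um s) (h3 : HypH3 f B T um s ubar) :
    StabilityIndexWellDefined (coeffB B ubar) (coeffA f B s ubar) T ∧
    (unstableEigenvalues (coeffB B ubar) (coeffA f B s ubar) T).Finite ∧
    (∀ lam ∈ unstableEigenvalues (coeffB B ubar) (coeffA f B s ubar) T,
      FiniteDimensional ℂ (genEigenspace (coeffB B ubar) (coeffA f B s ubar) T lam)) ∧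
    (0 < stabilityIndex (coeffB B ubar) (coeffA f B s ubar) T →
      Even (unstableCount (coeffB B ubar) (coeffA f B s ubar) T)) ∧
    (stabilityIndex (coeffB B ubar) (coeffA f B s ubar) T < 0 →
      Odd (unstableCount (coeffB B ubar) (coeffA f B s ubar) T)) ∧
    (∀ (p : ℝ≥0∞) [Fact (1 ≤ p)],
      WeaklySpectrallyStable (coeffB B ubar) (coeffA f B s ubar) p →
        0 ≤ stabilityIndex (coeffB B ubar) (coeffA f B s ubar) T) := by
  have h := PeriodicEvans.parabolicCoeffs_wave hT hwave hper h0 h1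
  have hparity := PeriodicEvans.unstableCount_parity h
    (PeriodicEvans.succ_le_analyticOrderAt_evans_wave hT hwave hper hnonconst h0 h1)
  have hodd : stabilityIndex (coeffB B ubar) (coeffA f B s ubar) T < 0 →
      Odd (unstableCount (coeffB B ubar) (coeffA f B s ubar) T) := by
    intro hneg
    have hc := PeriodicEvans.neg_of_sign_neg hneg
    by_contra hev
    have := hparity hc.ne
    rw [(Nat.not_odd_iff_even.1 hev).neg_one_pow, one_mul] at this
    exact lt_asymm this hc
  refine ⟨(PeriodicEvans.stabilityIndexWellDefined h).1,
    PeriodicEvans.finite_unstableEigenvalues h,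
    fun lam _ => (PeriodicEvans.finrank_genEigenspace_eq h lam).1, fun hpos => ?_, hodd,
    fun p _ hst => ?_⟩
  · have hc := PeriodicEvans.pos_of_sign_pos hpos
    by_contra hev
    have := hparity hc.ne'
    rw [(Nat.not_even_iff_odd.1 hev).neg_one_pow] at this
    linarith
  -- An odd count cannot be zero, so an unstable periodic eigenvalue exists, and it lies in the Lᵖ
  -- spectrum.
  · by_contra! hneg
    have hodd := hodd hneg
    rcases (unstableEigenvalues (coeffB B ubar) (coeffA f B s ubar) T).eq_empty_or_nonempty
      with he | ⟨lam, hre, v, hv, hv0, heq⟩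
    · rw [unstableCount, he, finsum_mem_empty] at hodd
      exact Nat.not_odd_zero hodd
    · exact absurd (hst (PeriodicEvans.mem_lpSpectrum_of_eigenvalue h hv hv0 heq p))
        (not_le.2 hre)
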